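/- Let $0<\tau<1$ and let $H_j$ be the Hermite polynomials with leading coefficient $2^j$. Put $\omega(Z)=\exp\left(-\frac{(\operatorname{Re}Z)^2}{1+\tau}-\frac{(\operatorname{Im}Z)^2}{1-\tau}\right)$ and consider the correlation kernel of the elliptic Ginibre ensemble $$\mathcal K_n(Z,Z')=\frac{1}{\pi\sqrt{1-\tau^2}}\sum_{j=0}^{n-1}\frac{(\tau/2)^j}{j!}\sqrt{\omega(Z)\omega(Z')}\,H_j\left(\tfrac{Z}{\sqrt{2\tau}}\right)\overline{H_j\left(\tfrac{Z'}{\sqrt{2\tau}}\right)},\qquad \mathbb K_n(Z,Z')=n\,\mathcal K_n(\sqrt n\,Z,\sqrt n\,Z').$$ For $\xi,\xi'>0$ and $\eta,\eta'\in(-\pi,\pi]$ write $Z=2\sqrt\tau\cosh(\xi+i\eta)$, $Z'=2\sqrt\tau\cosh(\xi'+i\eta')$, $\xi_+=\frac12(\xi+\xi')$, $\xi_\tau=-\frac12\log\tau$. For $\xi\ge 0$, $\eta\in\mathbb R$ define $g$ by $$-(\xi-\xi_\tau)^2g(\xi+i\eta)=\tfrac12+\xi-\xi_\tau+\tfrac12e^{-2\xi}\cos(2\eta)-2\tau\frac{\cosh^2\xi\cos^2\eta}{1+\tau}-2\tau\frac{\sinh^2\xi\sin^2\eta}{1-\tau}\quad(\xi\ne\xi_\tau),$$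 and $g(\xi_\tau+i\eta)=\frac{1+\tau^2-2\tau\cos(2\eta)}{1-\tau^2}$. Then $g$ is continuous on $\{\zeta\in\mathbb C:\operatorname{Re}\zeta\ge0\}$ and bounded from below there by a positive constant. Moreover, as $n\to\infty$, $$\begin{aligned}\mathbb K_n(Z,Z')=\;&\frac{n\,\mathbf 1_{\xi_+<\xi_\tau}}{\pi(1-\tau^2)}\exp\left(-\frac{n}{1-\tau^2}\,\frac{|Z|^2+|Z'|^2-2Z\overline{Z'}}{2}\right)C_\tau^n(Z,Z')\\&+\varepsilon\,\sqrt{\frac{n}{32\pi^3\tau(1-\tau^2)}}\;\frac{e^{-n(\xi-\xi_\tau)^2g(\xi+i\eta)}e^{-n(\xi'-\xi_\tau)^2g(\xi'+i\eta')}}{\sinh\left(\xi_+-\xi_\tau+i\frac{\eta-\eta'}{2}\right)\sqrt{\sinh(\xi+i\eta)\sinh(\xi'-i\eta')}}\,D_\tau^n(Z,Z')\\&+\mathcal O\left(\frac{1}{\sqrt n}\,e^{-n(\xi-\xi_\tau)^2g(\xi+i\eta)}e^{-n(\xi'-\xi_\tau)^2g(\xi'+i\eta')}\right),\end{aligned}$$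 where $$C_\tau^n(Z,Z')=\exp\left(-\frac{in\tau}{1-\tau^2}\,\frac{\operatorname{Im}(Z^2-Z'^2)}{2}\right),\qquad D_\tau^n(Z,Z')=\exp\left(in\left(\eta-\eta'-\tfrac{e^{-2\xi}}2\sin(2\eta)+\tfrac{e^{-2\xi'}}2\sin(2\eta')\right)\right),$$ all square roots are principal, and the sign $\varepsilon=\varepsilon(Z,Z')\in\{1,-1\}$, which does not depend on $n$, is the one for which $$\sqrt{e^{-2\xi_+-i(\eta-\eta')}\sinh(\xi+i\eta)\sinh(\xi'-i\eta')}=\varepsilon\,e^{-\xi_+-i(\eta-\eta')/2}\sqrt{\sinh(\xi+i\eta)\sinh(\xi'-i\eta')}.$$ The $\mathcal O$ term is uniform on every compact set of pairs $(Z,Z')\in\mathbb C^2$ all of whose points satisfy $\xi,\xi'>0$ and $(\xi_+-\xi_\tau)^2+(\eta-\eta')^2>0$; that is, for every such set the implied constant and the threshold for $n$ depend only on $\tau$ and the set. -/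

import Mathlib

open Real ComplexConjugate

noncomputable section

namespace EllipticGinibre

/-- The Hermite polynomial `H_j` with leading coefficient `2 ^ j` (physicists' normalization),
written through Mathlib's monic (probabilists') Hermite polynomial `He_j`:
`H_j(z) = 2 ^ (j / 2) He_j(√2 z)`. -/
def hermiteH (j : ℕ) (z : ℂ) : ℂ :=
  ((√2 : ℝ) : ℂ) ^ j * Polynomial.aeval (((√2 : ℝ) : ℂ) * z) (Polynomial.hermite j)

/-- The weight `ω(Z) = exp (-(Re Z)² / (1 + τ) - (Im Z)² / (1 - τ))`. -/
def weight (τ : ℝ) (Z : ℂ) : ℝ :=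
  Real.exp (-(Z.re ^ 2 / (1 + τ)) - Z.im ^ 2 / (1 - τ))

/-- The (unscaled) correlation kernel of the elliptic Ginibre ensemble, in dimension one. -/
def kernel (τ : ℝ) (n : ℕ) (Z Z' : ℂ) : ℂ :=
  ((1 / (π * √(1 - τ ^ 2)) : ℝ) : ℂ) *
    ∑ j ∈ Finset.range n,
      (((τ / 2) ^ j / (j.factorial : ℝ) * √(weight τ Z * weight τ Z') : ℝ) : ℂ) *
        hermiteH j (Z / ((√(2 * τ) : ℝ) : ℂ)) * conj (hermiteH j (Z' / ((√(2 * τ) : ℝ) : ℂ)))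

/-- The rescaled kernel `𝕂_n(Z, Z') = n 𝒦_n(√n Z, √n Z')`. -/
def scaledKernel (τ : ℝ) (n : ℕ) (Z Z' : ℂ) : ℂ :=
  (n : ℂ) * kernel τ n (((√(n : ℝ) : ℝ) : ℂ) * Z) (((√(n : ℝ) : ℝ) : ℂ) * Z')

/-- The point `2 √τ cosh (ξ + i η)` with elliptic coordinates `(ξ, η)`. -/
def ellipticPoint (τ ξ η : ℝ) : ℂ :=
  2 * ((√τ : ℝ) : ℂ) * Complex.cosh ((ξ : ℂ) + (η : ℂ) * Complex.I)

/-- `ξ_τ = -(1/2) log τ`; the limiting ellipse is the set where `ξ ≤ ξ_τ`. -/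
def xiTau (τ : ℝ) : ℝ := -(1 / 2) * Real.log τ

/-- The rate function `g(ξ + i η)`. -/
def rate (τ : ℝ) (ζ : ℂ) : ℝ :=
  if ζ.re = xiTau τ then
    (1 + τ ^ 2 - 2 * τ * Real.cos (2 * ζ.im)) / (1 - τ ^ 2)
  else
    -(1 / 2 + ζ.re - xiTau τ + 1 / 2 * Real.exp (-2 * ζ.re) * Real.cos (2 * ζ.im)
        - 2 * τ * (Real.cosh ζ.re ^ 2 * Real.cos ζ.im ^ 2 / (1 + τ))
        - 2 * τ * (Real.sinh ζ.re ^ 2 * Real.sin ζ.im ^ 2 / (1 - τ))) / (ζ.re - xiTau τ) ^ 2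

/-- The factor `exp (-n (ξ - ξ_τ)² g(ξ + i η)) exp (-n (ξ' - ξ_τ)² g(ξ' + i η'))`. -/
def decay (τ : ℝ) (n : ℕ) (ξ η ξ' η' : ℝ) : ℝ :=
  Real.exp (-(n : ℝ) * (ξ - xiTau τ) ^ 2 * rate τ ((ξ : ℂ) + (η : ℂ) * Complex.I)) *
    Real.exp (-(n : ℝ) * (ξ' - xiTau τ) ^ 2 * rate τ ((ξ' : ℂ) + (η' : ℂ) * Complex.I))

/-- The cocycle `C_τ^n(Z, Z')`. -/
def cocycleC (τ : ℝ) (n : ℕ) (Z Z' : ℂ) : ℂ :=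
  Complex.exp (-(Complex.I * (((n : ℝ) * τ / (1 - τ ^ 2) * ((Z ^ 2 - Z' ^ 2).im / 2) : ℝ) : ℂ)))

/-- The cocycle `D_τ^n(Z, Z')` in elliptic coordinates. -/
def cocycleD (n : ℕ) (ξ η ξ' η' : ℝ) : ℂ :=
  Complex.exp (Complex.I * (((n : ℝ) * (η - η' - Real.exp (-2 * ξ) / 2 * Real.sin (2 * η)
    + Real.exp (-2 * ξ') / 2 * Real.sin (2 * η')) : ℝ) : ℂ))

/-- The infinite Ginibre kernel with its cocycle:
`n / (π (1 - τ²)) exp (-n / (1 - τ²) (|Z|² + |Z'|² - 2 Z conj Z') / 2) C_τ^n(Z, Z')`. -/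
def bulkTerm (τ : ℝ) (n : ℕ) (Z Z' : ℂ) : ℂ :=
  (((n : ℝ) / (π * (1 - τ ^ 2)) : ℝ) : ℂ) *
    Complex.exp (-((((n : ℝ) / (1 - τ ^ 2) : ℝ) : ℂ) *
      ((((‖Z‖ ^ 2 + ‖Z'‖ ^ 2 : ℝ) : ℂ) - 2 * Z * conj Z') / 2))) *
    cocycleC τ n Z Z'

/-- `sinh (ξ + i η) sinh (ξ' - i η')`. -/
def sinhProd (ξ η ξ' η' : ℝ) : ℂ :=
  Complex.sinh ((ξ : ℂ) + (η : ℂ) * Complex.I) * Complex.sinh ((ξ' : ℂ) - (η' : ℂ) * Complex.I)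

/-- The principal complex square root. -/
def csqrt (w : ℂ) : ℂ := w ^ (1 / 2 : ℂ)

open Classical in
/-- The sign in front of the boundary term: with `a = exp (ξ + ξ' + i (η - η'))`,
`a^(-1/2) = exp (-(ξ + ξ') / 2 - i (η - η') / 2)` and principal square roots, it is the sign in
`√(a⁻¹ sinh (ξ + i η) sinh (ξ' - i η')) = ± a^(-1/2) √(sinh (ξ + i η) sinh (ξ' - i η'))`.
The squares of both sides agree, so that exactly one sign is right when `ξ, ξ' > 0`. -/
def boundarySign (ξ η ξ' η' : ℝ) : ℂ :=
  if csqrt (Complex.exp (-(((ξ + ξ' : ℝ) : ℂ) + ((η - η' : ℝ) : ℂ) * Complex.I))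
        * sinhProd ξ η ξ' η')
      = Complex.exp (-((((ξ + ξ') / 2 : ℝ) : ℂ) + (((η - η') / 2 : ℝ) : ℂ) * Complex.I))
        * csqrt (sinhProd ξ η ξ' η')
  then 1 else -1

/-- The boundary term of order `√n`, without its sign. -/
def boundaryTerm (τ : ℝ) (n : ℕ) (ξ η ξ' η' : ℝ) : ℂ :=
  ((√((n : ℝ) / (32 * π ^ 3 * τ * (1 - τ ^ 2))) : ℝ) : ℂ) *
    ((decay τ n ξ η ξ' η' : ℂ) /
      (Complex.sinh ((((ξ + ξ') / 2 - xiTau τ : ℝ) : ℂ) + (((η - η') / 2 : ℝ) : ℂ) * Complex.I) *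
        csqrt (sinhProd ξ η ξ' η'))) *
    cocycleD n ξ η ξ' η'

/-- The condition on the elliptic coordinates: `ξ, ξ' > 0`, `η, η' ∈ (-π, π]` and
`(ξ_+ - ξ_τ)² + (η - η')² > 0`, where `ξ_+ = (ξ + ξ') / 2`. -/
def Admissible (τ ξ η ξ' η' : ℝ) : Prop :=
  0 < ξ ∧ 0 < ξ' ∧ η ∈ Set.Ioc (-π) π ∧ η' ∈ Set.Ioc (-π) π ∧
    0 < ((ξ + ξ') / 2 - xiTau τ) ^ 2 + (η - η') ^ 2

/-- The set of pairs `(Z, Z')` whose elliptic coordinates are admissible. -/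
def admissiblePairs (τ : ℝ) : Set (ℂ × ℂ) :=
  {p | ∃ ξ η ξ' η' : ℝ, Admissible τ ξ η ξ' η' ∧
    p = (ellipticPoint τ ξ η, ellipticPoint τ ξ' η')}

end EllipticGinibre

end

/-!
The kernel is, up to a Gaussian weight, the partial sum at `s = τ` of the Mehler expansion
`∑ H_k(z) H_k(w) (s / 2) ^ k / k!`, whose sum has the closed form `mehlerKernel z w s`. Both the
coefficients and the moments of the closed form on a circle around `0` obey the same recurrence
(`mehlerMoment_neg`), so the partial sum is a contour integral: summing the geometric series gives

  `∑_{k<n} τ^k c_k = [τ inside] F(τ) - (2πi)⁻¹ ∮ F(s) (τ / s) ^ n (s - τ)⁻¹ ds`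

for every circle in the unit disc that winds around `0` and avoids `τ`
(`sum_mehlerCoeff_of_mem_ball`, `sum_mehlerCoeff_of_notMem_closedBall`). The residue `F(τ)` turns
out to be the bulk term (`bulkTerm_eq`).

In elliptic coordinates, with `ζ = ξ + i η` and `ζ' = ξ' + i η'`, the integrand has a saddle point
at `s = σ = exp (-(ζ + conj ζ'))`. Writing `s = σ t`, `p = exp (-2ζ)`, `q = exp (-2 conj ζ')` and
`w = τ / σ`, the integrand becomes `amplitude p q w t * exp (n * phase p q t)`, up to a factor that
does not depend on `t`. It has its saddle point at `t = 1`, branch points `t² p q = 1` outside of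
the unit disc and a pole at `w`; `|w| < 1` holds exactly when `ξ_+ < ξ_τ`, and admissibility keeps
`w` away from `1`. The value at the saddle point, multiplied by the weights, has modulus `decay`,
which is where the rate function comes from
(`sqrtWeights_mul_saddle_value`).

On the unit circle the real part of the phase is `-|t - 1|² / 2` times the real part of
`(1 - a) (1 - b) / (1 - a b)` with `a = p t` and `b = q t`. That real part is bounded below by a
positive constant, since the reciprocal is the mean of two Cayley transforms (`re_curvature_ge`).
The bound survives on the circles with centre `1 - κ` and radius `κ`, for `κ` near `1`
(`exists_re_phase_le`). These touch the unit circle at the saddle point, and surround it for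
`κ > 1` while they lie inside of it for `κ < 1`. Taking `κ = 1 + ε` for `|w| < 1` and `κ = 1 - ε`
for `|w| ≥ 1` therefore keeps the circle at a positive distance from the pole, however close `w`
is to the unit circle (`le_norm_sub_of_mem_sphere`), and decides that the residue is present
exactly in the first case. Laplace's method, with errors controlled by a few suprema only
(`laplace_integral`), then gives the leading term with a relative error of order `1 / n`, uniformly
in `p`, `q`, `w` (`exists_contour_asymptotics`). The leading term is the boundary term, up to the
sign that comes from the choice of the square root (`boundaryTerm_eq`). Compact sets of pairs of
points have compact sets of coordinates, so `|p|`, `|q|` stay away from `1` and `w` from `1`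
(`exists_uniform_bounds`).

For the rate function, `(ξ - ξ_τ)² g` is affine in `cos (2 η)`, and its coefficients are values of
`exp x - 1 - x`; dividing by `x²` leaves an entire function (`rate_eq`). The lower bound is then
needed only for `cos (2 η) = 1`, where it follows from monotonicity if `ξ ≥ ξ_τ`, and from
`tanh y < y` for `y > 0` together with `τ ≤ exp (2 (ξ - ξ_τ))` if `0 ≤ ξ < ξ_τ`
(`expRemainder_sub_pos`).
-/

namespace EllipticGinibre

/-! ### Hermite polynomials and the Mehler kernel -/

theorem derivative_hermite_succ (n : ℕ) :
    Polynomial.derivative (Polynomial.hermite (n + 1))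
      = ((n : Polynomial ℤ) + 1) * Polynomial.hermite n := by
  induction n with
  | zero => simp
  | succ n ih =>
    rw [Polynomial.hermite_succ (n + 1)]
    simp only [Polynomial.derivative_sub, Polynomial.derivative_mul, Polynomial.derivative_X,
      ih, Polynomial.derivative_add, Polynomial.derivative_natCast, Polynomial.derivative_one]
    rw [Polynomial.hermite_succ n]
    push_cast
    ring

theorem hermiteH_zero (z : ℂ) : hermiteH 0 z = 1 := by
  simp [hermiteH]

theorem sqrt_two_mul_self : ((√2 : ℝ) : ℂ) * ((√2 : ℝ) : ℂ) = 2 := by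
  rw [← Complex.ofReal_mul, Real.mul_self_sqrt (by norm_num)]
  norm_num

theorem hermiteH_one (z : ℂ) : hermiteH 1 z = 2 * z := by
  have h := sqrt_two_mul_self
  simp only [hermiteH, Polynomial.hermite_one, Polynomial.aeval_X, pow_one]
  linear_combination z * h

theorem hermiteH_add_two (j : ℕ) (z : ℂ) :
    hermiteH (j + 2) z = 2 * z * hermiteH (j + 1) z - 2 * (j + 1) * hermiteH j z := by
  have h := sqrt_two_mul_self
  have e : Polynomial.hermite (j + 2)
      = Polynomial.X * Polynomial.hermite (j + 1)
        - ((j : Polynomial ℤ) + 1) * Polynomial.hermite j := by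
    rw [Polynomial.hermite_succ (j + 1), derivative_hermite_succ]
  simp only [hermiteH, e, map_sub, map_mul, Polynomial.aeval_X, map_add, map_natCast, map_one]
  generalize Polynomial.aeval (((√2 : ℝ) : ℂ) * z) (Polynomial.hermite (j + 1)) = a
  generalize Polynomial.aeval (((√2 : ℝ) : ℂ) * z) (Polynomial.hermite j) = b
  generalize ((√2 : ℝ) : ℂ) = r at h
  linear_combination (r ^ (j + 1) * z * a - r ^ j * (j + 1) * b) * h

theorem conj_hermiteH (j : ℕ) (z : ℂ) : conj (hermiteH j z) = hermiteH j (conj z) := by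
  simp only [hermiteH, map_mul, map_pow, Complex.conj_ofReal]
  congr 1
  rw [Polynomial.aeval_def, Polynomial.aeval_def, Polynomial.hom_eval₂]
  congr 1
  · ext; simp
  · simp

/-- The coefficient `H_k(z) H_k(w) / (2 ^ k k!)` of the Mehler expansion. -/
noncomputable def mehlerCoeff (z w : ℂ) (k : ℕ) : ℂ :=
  hermiteH k z * hermiteH k w / (2 ^ k * (k.factorial : ℂ))

theorem mehlerCoeff_zero (z w : ℂ) : mehlerCoeff z w 0 = 1 := by
  simp [mehlerCoeff, hermiteH_zero]

theorem mehlerCoeff_one (z w : ℂ) : mehlerCoeff z w 1 = 2 * z * w := by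
  simp only [mehlerCoeff, hermiteH_one]
  norm_num
  ring

theorem mehlerCoeff_two (z w : ℂ) :
    2 * mehlerCoeff z w 2 = 2 * z * w * mehlerCoeff z w 1
      + (1 - 2 * (z ^ 2 + w ^ 2)) * mehlerCoeff z w 0 := by
  simp only [mehlerCoeff, hermiteH_one, hermiteH_zero, hermiteH_add_two, zero_add]
  norm_num [Nat.factorial]
  ring

theorem mehlerCoeff_three (z w : ℂ) :
    3 * mehlerCoeff z w 3 = 2 * z * w * mehlerCoeff z w 2
      + (3 - 2 * (z ^ 2 + w ^ 2)) * mehlerCoeff z w 1 + 2 * z * w * mehlerCoeff z w 0 := by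
  simp only [mehlerCoeff, hermiteH_one, hermiteH_zero, hermiteH_add_two, zero_add,
    show (3 : ℕ) = 1 + 2 from rfl]
  norm_num [Nat.factorial]
  ring

theorem mehlerCoeff_add_four (z w : ℂ) (k : ℕ) :
    (k + 4) * mehlerCoeff z w (k + 4) = 2 * z * w * mehlerCoeff z w (k + 3)
      + (2 * k + 5 - 2 * (z ^ 2 + w ^ 2)) * mehlerCoeff z w (k + 2)
      + 2 * z * w * mehlerCoeff z w (k + 1) - (k + 1) * mehlerCoeff z w k := by
  have h2 : ((k : ℂ) + 2) ≠ 0 := by exact_mod_cast Nat.succ_ne_zero (k + 1)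
  have h3 : ((k : ℂ) + 3) ≠ 0 := by exact_mod_cast Nat.succ_ne_zero (k + 2)
  have h4 : ((k : ℂ) + 4) ≠ 0 := by exact_mod_cast Nat.succ_ne_zero (k + 3)
  have f1 : ((k + 1).factorial : ℂ) = (k + 1) * k.factorial := by
    push_cast [Nat.factorial_succ]; ring
  have f2 : ((k + 2).factorial : ℂ) = (k + 2) * ((k + 1) * k.factorial) := by
    push_cast [Nat.factorial_succ]; ring
  have f3 : ((k + 3).factorial : ℂ) = (k + 3) * ((k + 2) * ((k + 1) * k.factorial)) := by
    push_cast [Nat.factorial_succ]; ring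
  have f4 : ((k + 4).factorial : ℂ)
      = (k + 4) * ((k + 3) * ((k + 2) * ((k + 1) * k.factorial))) := by
    push_cast [Nat.factorial_succ]; ring
  have r2 := fun z => hermiteH_add_two k z
  have r3 := fun z => hermiteH_add_two (k + 1) z
  have r4 := fun z => hermiteH_add_two (k + 2) z
  simp only [mehlerCoeff, f1, f2, f3, f4]
  rw [show k + 4 = k + 2 + 2 from rfl, show k + 3 = k + 1 + 2 from rfl]
  rw [r4 z, r4 w, show k + 2 + 1 = k + 1 + 2 from rfl, r3 z, r3 w,
    show k + 1 + 1 = k + 2 from rfl, r2 z, r2 w]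
  generalize hermiteH (k + 1) z = x
  generalize hermiteH (k + 1) w = y
  generalize hermiteH k z = x'
  generalize hermiteH k w = y'
  push_cast
  rw [pow_add 2 k 1, pow_add 2 k 2, show k + 1 + 2 = k + 3 from rfl, pow_add 2 k 3,
    show k + 2 + 2 = k + 4 from rfl, pow_add 2 k 4]
  field_simp
  ring

/-- The Mehler kernel `∑ k, H_k(z) H_k(w) (s / 2) ^ k / k!` in closed form. -/
noncomputable def mehlerKernel (z w s : ℂ) : ℂ :=
  (1 - s ^ 2) ^ (-(1 / 2) : ℂ)
    * Complex.exp ((2 * s * (z * w) - s ^ 2 * (z ^ 2 + w ^ 2)) / (1 - s ^ 2))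

theorem one_sub_re_pos {s : ℂ} (hs : ‖s‖ < 1) : 0 < (1 - s).re := by
  have := (Complex.abs_re_le_norm s).trans_lt hs
  simp only [Complex.sub_re, Complex.one_re]
  linarith [le_abs_self s.re]

theorem one_sub_ne_zero_of_norm_lt {s : ℂ} (hs : ‖s‖ < 1) : 1 - s ≠ 0 := by
  intro h
  have := one_sub_re_pos hs
  rw [h] at this
  simp at this

theorem norm_sq_lt_one {s : ℂ} (hs : ‖s‖ < 1) : ‖s ^ 2‖ < 1 := by
  rw [norm_pow]
  exact pow_lt_one₀ (norm_nonneg _) hs two_ne_zero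

/-- The first order differential equation
`(1 - s²)² F' = (s (1 - s²) + 2 z w (1 + s²) - 2 s (z² + w²)) F` of the Mehler kernel. -/
theorem hasDerivAt_mehlerKernel (z w : ℂ) {s : ℂ} (hs : ‖s‖ < 1) :
    HasDerivAt (mehlerKernel z w)
      ((s * (1 - s ^ 2) + 2 * (z * w) * (1 + s ^ 2) - 2 * s * (z ^ 2 + w ^ 2)) / (1 - s ^ 2) ^ 2
        * mehlerKernel z w s) s := by
  have hre := one_sub_re_pos (norm_sq_lt_one hs)
  have hne := one_sub_ne_zero_of_norm_lt (norm_sq_lt_one hs)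
  have hd : HasDerivAt (fun s : ℂ => 1 - s ^ 2) (-(2 * s)) s := by
    simpa using (hasDerivAt_pow 2 s).const_sub 1
  have h1 := hd.cpow_const (c := (-(1 / 2) : ℂ)) (Or.inl hre)
  have hnum : HasDerivAt (fun s : ℂ => 2 * s * (z * w) - s ^ 2 * (z ^ 2 + w ^ 2))
      (2 * (z * w) - 2 * s * (z ^ 2 + w ^ 2)) s := by
    have a := ((hasDerivAt_id s).const_mul (2 : ℂ)).mul_const (z * w)
    have b := (hasDerivAt_pow 2 s).mul_const (z ^ 2 + w ^ 2)
    refine (a.sub b).congr_deriv ?_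
    simp
  have h2 := (hnum.div hd hne).cexp
  have h3 := h1.mul h2
  refine h3.congr_deriv ?_
  simp only [mehlerKernel]
  have hp : (1 - s ^ 2) ^ (-(1 / 2) - 1 : ℂ) = (1 - s ^ 2) ^ (-(1 / 2) : ℂ) / (1 - s ^ 2) := by
    rw [Complex.cpow_sub _ _ hne, Complex.cpow_one]
  rw [hp]
  simp only [Pi.div_apply]
  generalize (1 - s ^ 2) ^ (-(1 / 2) : ℂ) = a
  generalize Complex.exp _ = b
  field_simp
  ring

theorem mehlerKernel_zero (z w : ℂ) : mehlerKernel z w 0 = 1 := by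
  simp [mehlerKernel]

section Contour

variable {c σ : ℂ} {R : ℝ}

/-- The moment `∮ F(σ t) t ^ j dt` of the Mehler kernel over the circle `C(c, R)`. -/
noncomputable def mehlerMoment (z w c σ : ℂ) (R : ℝ) (j : ℤ) : ℂ :=
  ∮ t in C(c, R), mehlerKernel z w (σ * t) * t ^ j

theorem ne_zero_of_mem_sphere (h0 : (0 : ℂ) ∈ Metric.ball c R) {t : ℂ}
    (ht : t ∈ Metric.sphere c R) : t ≠ 0 := by
  rintro rfl
  rw [Metric.mem_sphere] at ht
  rw [Metric.mem_ball] at h0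
  linarith

theorem differentiableAt_mehlerKernel_comp (z w : ℂ) {t : ℂ} (ht : ‖σ * t‖ < 1) :
    DifferentiableAt ℂ (fun t => mehlerKernel z w (σ * t)) t :=
  (hasDerivAt_mehlerKernel z w ht).differentiableAt.comp t
    (differentiableAt_id.const_mul σ)

theorem circleIntegrable_mehlerKernel_mul (z w : ℂ) (h0 : (0 : ℂ) ∈ Metric.ball c R)
    (hσ : ∀ t ∈ Metric.closedBall c R, ‖σ * t‖ < 1) (j : ℤ) :
    CircleIntegrable (fun t => mehlerKernel z w (σ * t) * t ^ j) c R := by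
  have hR : 0 < R := dist_nonneg.trans_lt (Metric.mem_ball.1 h0)
  refine ContinuousOn.circleIntegrable hR.le fun t ht => ?_
  refine ((differentiableAt_mehlerKernel_comp z w
    (hσ t (Metric.sphere_subset_closedBall ht))).continuousAt.mul ?_).continuousWithinAt
  exact continuousAt_zpow₀ t j (Or.inl (ne_zero_of_mem_sphere h0 ht))

theorem mehlerMoment_of_nonneg (z w : ℂ) (h0 : (0 : ℂ) ∈ Metric.ball c R)
    (hσ : ∀ t ∈ Metric.closedBall c R, ‖σ * t‖ < 1) (j : ℕ) :
    mehlerMoment z w c σ R j = 0 := by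
  have hR : 0 < R := dist_nonneg.trans_lt (Metric.mem_ball.1 h0)
  have hd : ∀ t ∈ Metric.closedBall c R,
      DifferentiableAt ℂ (fun t => mehlerKernel z w (σ * t) * t ^ (j : ℤ)) t := by
    intro t ht
    simp only [zpow_natCast]
    exact (differentiableAt_mehlerKernel_comp z w (hσ t ht)).mul (differentiableAt_pow j)
  exact Complex.circleIntegral_eq_zero_of_differentiable_on_off_countable hR.le
    Set.countable_empty (fun t ht => (hd t ht).continuousAt.continuousWithinAt)
    (fun t ht => hd t (Metric.ball_subset_closedBall ht.1))

theorem mehlerMoment_neg_one (z w : ℂ) (h0 : (0 : ℂ) ∈ Metric.ball c R)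
    (hσ : ∀ t ∈ Metric.closedBall c R, ‖σ * t‖ < 1) :
    mehlerMoment z w c σ R (-1) = 2 * π * Complex.I := by
  have h := DifferentiableOn.circleIntegral_sub_inv_smul (c := c) (R := R) (w := 0)
    (f := fun t => mehlerKernel z w (σ * t))
    (fun t ht => (differentiableAt_mehlerKernel_comp z w (hσ t ht)).differentiableWithinAt) h0
  simp only [mul_zero, mehlerKernel_zero, smul_eq_mul, mul_one, sub_zero] at h
  rw [← h, mehlerMoment]
  congr 1
  funext t
  rw [zpow_neg_one, mul_comm]

/-- The differential equation of the Mehler kernel, integrated against `t ^ m`. -/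
theorem mehlerMoment_recurrence (z w : ℂ) (h0 : (0 : ℂ) ∈ Metric.ball c R)
    (hσ : ∀ t ∈ Metric.closedBall c R, ‖σ * t‖ < 1) (m : ℤ) :
    m * mehlerMoment z w c σ R (m - 1) + 2 * (z * w) * σ * mehlerMoment z w c σ R m
      + σ ^ 2 * (-2 * m - 3 - 2 * (z ^ 2 + w ^ 2)) * mehlerMoment z w c σ R (m + 1)
      + 2 * (z * w) * σ ^ 3 * mehlerMoment z w c σ R (m + 2)
      + σ ^ 4 * (m + 3) * mehlerMoment z w c σ R (m + 3) = 0 := by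
  have hR : 0 < R := dist_nonneg.trans_lt (Metric.mem_ball.1 h0)
  have hi := circleIntegrable_mehlerKernel_mul z w h0 hσ
  have key : ∮ t in C(c, R),
      (m * (mehlerKernel z w (σ * t) * t ^ (m - 1))
      + 2 * (z * w) * σ * (mehlerKernel z w (σ * t) * t ^ m)
      + σ ^ 2 * (-2 * m - 3 - 2 * (z ^ 2 + w ^ 2)) * (mehlerKernel z w (σ * t) * t ^ (m + 1))
      + 2 * (z * w) * σ ^ 3 * (mehlerKernel z w (σ * t) * t ^ (m + 2))
      + σ ^ 4 * (m + 3) * (mehlerKernel z w (σ * t) * t ^ (m + 3))) = 0 := by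
    refine circleIntegral.integral_eq_zero_of_hasDerivWithinAt hR.le
      (f := fun t => mehlerKernel z w (σ * t) * (t ^ m * (1 - σ ^ 2 * t ^ 2) ^ 2))
      fun t ht => HasDerivAt.hasDerivWithinAt ?_
    have hn := hσ t (Metric.sphere_subset_closedBall ht)
    have ht0 := ne_zero_of_mem_sphere h0 ht
    have hne := one_sub_ne_zero_of_norm_lt (norm_sq_lt_one hn)
    have hF : HasDerivAt (fun t => mehlerKernel z w (σ * t)) _ t :=
      HasDerivAt.comp t (h₂ := mehlerKernel z w) (hasDerivAt_mehlerKernel z w hn)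
        ((hasDerivAt_id t).const_mul σ)
    have hP : HasDerivAt (fun t : ℂ => (1 - σ ^ 2 * t ^ 2) ^ 2)
        (2 * (1 - σ ^ 2 * t ^ 2) * (-(σ ^ 2 * (2 * t)))) t := by
      have := (((hasDerivAt_pow 2 t).const_mul (σ ^ 2)).const_sub 1).pow 2
      refine this.congr_deriv ?_
      simp
    refine (hF.mul ((hasDerivAt_zpow m t (Or.inl ht0)).mul hP)).congr_deriv ?_
    simp only [Pi.mul_apply]
    rw [zpow_sub_one₀ ht0, zpow_add_one₀ ht0, zpow_add₀ ht0 m 2, zpow_add₀ ht0 m 3]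
    rw [show (t ^ (2 : ℤ)) = t ^ 2 from zpow_natCast t 2,
      show (t ^ (3 : ℤ)) = t ^ 3 from zpow_natCast t 3]
    generalize mehlerKernel z w (σ * t) = F
    generalize t ^ m = T
    rw [mul_pow] at hne ⊢
    simp only [mul_one]
    field_simp
    ring
  have i1 := hi (m - 1)
  have i2 := hi m
  have i3 := hi (m + 1)
  have i4 := hi (m + 2)
  have i5 := hi (m + 3)
  have cm : ∀ (a : ℂ) {f : ℂ → ℂ}, CircleIntegrable f c R →
      CircleIntegrable (fun t => a * f t) c R := fun a f hf => by
    exact hf.const_smul (a := a)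
  have ca : ∀ {f g : ℂ → ℂ}, CircleIntegrable f c R → CircleIntegrable g c R →
      CircleIntegrable (fun t => f t + g t) c R := fun hf hg => hf.add hg
  rw [circleIntegral.integral_add (ca (ca (ca (cm _ i1) (cm _ i2)) (cm _ i3)) (cm _ i4))
      (cm _ i5),
    circleIntegral.integral_add (ca (ca (cm _ i1) (cm _ i2)) (cm _ i3)) (cm _ i4),
    circleIntegral.integral_add (ca (cm _ i1) (cm _ i2)) (cm _ i3),
    circleIntegral.integral_add (cm _ i1) (cm _ i2)] at key
  simpa only [circleIntegral.integral_const_mul, mehlerMoment] using key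

/-- **Mehler's formula** in contour form. The moments satisfy the same recurrence as the
coefficients `H_k(z) H_k(w) / (2 ^ k k!)`. -/
theorem mehlerMoment_neg (z w : ℂ) (h0 : (0 : ℂ) ∈ Metric.ball c R)
    (hσ : ∀ t ∈ Metric.closedBall c R, ‖σ * t‖ < 1) (k : ℕ) :
    mehlerMoment z w c σ R (-(k : ℤ) - 1) = 2 * π * Complex.I * (σ ^ k * mehlerCoeff z w k) := by
  have hz := mehlerMoment_of_nonneg z w h0 hσ
  have hr := mehlerMoment_recurrence z w h0 hσ
  have h_neg_one := mehlerMoment_neg_one z w h0 hσ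
  induction k using Nat.strong_induction_on with
  | _ k ih =>
    match k, ih with
    | 0, _ => simpa [mehlerCoeff_zero] using h_neg_one
    | 1, ih =>
      have h := hr (-1)
      have e0 := ih 0 (by norm_num)
      have z0 := hz 0
      have z1 := hz 1
      have z2 := hz 2
      norm_num at h e0 z0 z1 z2 ⊢
      rw [e0, z0, z1, z2, mehlerCoeff_zero] at h
      rw [mehlerCoeff_one]
      linear_combination -h
    | 2, ih =>
      have h := hr (-2)
      have e0 := ih 0 (by norm_num)
      have e1 := ih 1 (by norm_num)
      have z0 := hz 0
      have z1 := hz 1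
      norm_num at h e0 e1 z0 z1 ⊢
      rw [e0, e1, z0, z1] at h
      linear_combination -h / 2 - π * Complex.I * σ ^ 2 * mehlerCoeff_two z w
    | 3, ih =>
      have h := hr (-3)
      have e0 := ih 0 (by norm_num)
      have e1 := ih 1 (by norm_num)
      have e2 := ih 2 (by norm_num)
      have z0 := hz 0
      norm_num at h e0 e1 e2 z0 ⊢
      rw [e0, e1, e2] at h
      linear_combination -h / 3 - 2 / 3 * π * Complex.I * σ ^ 3 * mehlerCoeff_three z w
    | k + 4, ih =>
      have h := hr (-(k : ℤ) - 4)
      have e0 := ih k (by lia)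
      have e1 := ih (k + 1) (by lia)
      have e2 := ih (k + 2) (by lia)
      have e3 := ih (k + 3) (by lia)
      push_cast at h e0 e1 e2 e3 ⊢
      rw [show -(k : ℤ) - 4 - 1 = -(k + 4) - 1 by ring, show -(k : ℤ) - 4 = -(k + 3) - 1 by ring,
        show -((k : ℤ) + 3) - 1 + 1 = -(k + 2) - 1 by ring,
        show -((k : ℤ) + 3) - 1 + 2 = -(k + 1) - 1 by ring,
        show -((k : ℤ) + 3) - 1 + 3 = -k - 1 by ring, e0, e1, e2, e3] at h
      have h4 : ((k : ℂ) + 4) ≠ 0 := by exact_mod_cast Nat.succ_ne_zero (k + 3)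
      have r := mehlerCoeff_add_four z w k
      refine mul_left_cancel₀ h4 ?_
      linear_combination -h - 2 * π * Complex.I * σ ^ (k + 4) * r

/-- The partial sums of the Mehler expansion at `s = σ v`, as the difference of a Cauchy integral
and of the contour integral that carries the `n`-dependence. -/
theorem sum_mehlerCoeff_eq_circleIntegral (z w : ℂ) (h0 : (0 : ℂ) ∈ Metric.ball c R)
    (hσ : ∀ t ∈ Metric.closedBall c R, ‖σ * t‖ < 1) {v : ℂ} (hv : v ∉ Metric.sphere c R) (n : ℕ) :
    2 * π * Complex.I * ∑ k ∈ Finset.range n, (σ * v) ^ k * mehlerCoeff z w k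
      = (∮ t in C(c, R), (t - v)⁻¹ * mehlerKernel z w (σ * t))
        - ∮ t in C(c, R), mehlerKernel z w (σ * t) * (v / t) ^ n * (t - v)⁻¹ := by
  have hR : 0 < R := dist_nonneg.trans_lt (Metric.mem_ball.1 h0)
  have hsub : ∀ t ∈ Metric.sphere c R, t - v ≠ 0 := fun t ht h => by
    rw [sub_eq_zero] at h
    exact hv (h ▸ ht)
  have hF : ContinuousOn (fun t => mehlerKernel z w (σ * t)) (Metric.sphere c R) := fun t ht =>
    (differentiableAt_mehlerKernel_comp z w
      (hσ t (Metric.sphere_subset_closedBall ht))).continuousAt.continuousWithinAt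
  have hinv : ContinuousOn (fun t => (t - v)⁻¹) (Metric.sphere c R) :=
    (continuousOn_id.sub continuousOn_const).inv₀ hsub
  have hpow : ContinuousOn (fun t => (v / t) ^ n) (Metric.sphere c R) :=
    (continuousOn_const.div continuousOn_id fun t ht => ne_zero_of_mem_sphere h0 ht).pow n
  rw [← circleIntegral.integral_sub (f := fun t => (t - v)⁻¹ * mehlerKernel z w (σ * t))
    (g := fun t => mehlerKernel z w (σ * t) * (v / t) ^ n * (t - v)⁻¹)
    ((hinv.mul hF).circleIntegrable hR.le)
    (((hF.mul hpow).mul hinv).circleIntegrable hR.le)]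
  have e : Set.EqOn (fun t => (t - v)⁻¹ * mehlerKernel z w (σ * t)
        - mehlerKernel z w (σ * t) * (v / t) ^ n * (t - v)⁻¹)
      (fun t => ∑ k ∈ Finset.range n, v ^ k * (mehlerKernel z w (σ * t) * t ^ (-(k : ℤ) - 1)))
      (Metric.sphere c R) := by
    intro t ht
    have ht0 := ne_zero_of_mem_sphere h0 ht
    have hg := mul_neg_geom_sum (v / t) n
    have hs : ∑ k ∈ Finset.range n, v ^ k * (mehlerKernel z w (σ * t) * t ^ (-(k : ℤ) - 1))
        = mehlerKernel z w (σ * t) * t⁻¹ * ∑ k ∈ Finset.range n, (v / t) ^ k := by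
      rw [Finset.mul_sum]
      refine Finset.sum_congr rfl fun k _ => ?_
      rw [zpow_sub_one₀ ht0, zpow_neg, zpow_natCast, div_pow]
      field_simp
    simp only [hs]
    have h1 : (t - v)⁻¹ * (1 - v / t) = t⁻¹ := by
      have := hsub t ht
      field_simp
    rw [← h1]
    linear_combination -(mehlerKernel z w (σ * t) * (t - v)⁻¹) * hg
  rw [circleIntegral.integral_congr hR.le e]
  have hsum : (∮ t in C(c, R), ∑ k ∈ Finset.range n,
        v ^ k * (mehlerKernel z w (σ * t) * t ^ (-(k : ℤ) - 1)))
      = ∑ k ∈ Finset.range n, v ^ k * mehlerMoment z w c σ R (-(k : ℤ) - 1) := by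
    rw [circleIntegral.integral_fun_sum]
    · simp only [circleIntegral.integral_const_mul, mehlerMoment]
    · intro k _
      exact (circleIntegrable_mehlerKernel_mul z w h0 hσ _).const_smul (a := v ^ k)
  rw [hsum, Finset.mul_sum]
  refine Finset.sum_congr rfl fun k _ => ?_
  rw [mehlerMoment_neg z w h0 hσ, mul_pow]
  ring

theorem sum_mehlerCoeff_of_mem_ball (z w : ℂ) (h0 : (0 : ℂ) ∈ Metric.ball c R)
    (hσ : ∀ t ∈ Metric.closedBall c R, ‖σ * t‖ < 1) {v : ℂ} (hv : v ∈ Metric.ball c R) (n : ℕ) :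
    ∑ k ∈ Finset.range n, (σ * v) ^ k * mehlerCoeff z w k
      = mehlerKernel z w (σ * v) - (2 * π * Complex.I)⁻¹ *
          ∮ t in C(c, R), mehlerKernel z w (σ * t) * (v / t) ^ n * (t - v)⁻¹ := by
  have h := sum_mehlerCoeff_eq_circleIntegral z w h0 hσ (v := v)
    (fun h => by rw [Metric.mem_sphere] at h; rw [Metric.mem_ball] at hv; linarith) n
  have hc := DifferentiableOn.circleIntegral_sub_inv_smul (c := c) (R := R) (w := v)
    (f := fun t => mehlerKernel z w (σ * t))
    (fun t ht => (differentiableAt_mehlerKernel_comp z w (hσ t ht)).differentiableWithinAt) hv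
  simp only [smul_eq_mul] at hc
  rw [hc] at h
  generalize (∮ t in C(c, R), mehlerKernel z w (σ * t) * (v / t) ^ n * (t - v)⁻¹) = J at h ⊢
  field_simp
  linear_combination h

theorem sum_mehlerCoeff_of_notMem_closedBall (z w : ℂ) (h0 : (0 : ℂ) ∈ Metric.ball c R)
    (hσ : ∀ t ∈ Metric.closedBall c R, ‖σ * t‖ < 1) {v : ℂ} (hv : v ∉ Metric.closedBall c R)
    (n : ℕ) :
    ∑ k ∈ Finset.range n, (σ * v) ^ k * mehlerCoeff z w k
      = -((2 * π * Complex.I)⁻¹ *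
          ∮ t in C(c, R), mehlerKernel z w (σ * t) * (v / t) ^ n * (t - v)⁻¹) := by
  have hR : 0 < R := dist_nonneg.trans_lt (Metric.mem_ball.1 h0)
  have h := sum_mehlerCoeff_eq_circleIntegral z w h0 hσ (v := v)
    (fun h => hv (Metric.sphere_subset_closedBall h)) n
  have hd : ∀ t ∈ Metric.closedBall c R,
      DifferentiableAt ℂ (fun t => (t - v)⁻¹ * mehlerKernel z w (σ * t)) t := fun t ht =>
    ((differentiableAt_id.sub_const v).inv
      (sub_ne_zero.2 fun h => hv (h ▸ ht))).mul (differentiableAt_mehlerKernel_comp z w (hσ t ht))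
  have hc : (∮ t in C(c, R), (t - v)⁻¹ * mehlerKernel z w (σ * t)) = 0 :=
    Complex.circleIntegral_eq_zero_of_differentiable_on_off_countable hR.le
      Set.countable_empty (fun t ht => (hd t ht).continuousAt.continuousWithinAt)
      (fun t ht => hd t (Metric.ball_subset_closedBall ht.1))
  rw [hc] at h
  generalize (∮ t in C(c, R), mehlerKernel z w (σ * t) * (v / t) ^ n * (t - v)⁻¹) = J at h ⊢
  field_simp
  linear_combination h

end Contour

/-! ### Laplace's method with uniform error -/

/-- Second order Taylor expansion of the exponential around `b`, in the half plane
`Re ≤ M`. -/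
theorem norm_exp_sub_exp_sub_le {a b : ℂ} {M : ℝ} (ha : a.re ≤ M) (hb : b.re ≤ M) :
    ‖Complex.exp a - Complex.exp b - (a - b) * Complex.exp b‖ ≤ ‖a - b‖ ^ 2 * Real.exp M := by
  have hs : Convex ℝ {x : ℂ | x.re ≤ M} := convex_halfSpace_re_le M
  have first : ∀ x : ℂ, x.re ≤ M → ‖Complex.exp x - Complex.exp b‖ ≤ Real.exp M * ‖x - b‖ := by
    intro x hx
    refine hs.norm_image_sub_le_of_norm_hasDerivWithin_le
      (f := Complex.exp) (f' := Complex.exp)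
      (fun y _ => (Complex.hasDerivAt_exp y).hasDerivWithinAt) (fun y hy => ?_) hb hx
    rw [Complex.norm_exp]
    exact Real.exp_le_exp.2 hy
  have hseg : segment ℝ b a ⊆ {x : ℂ | x.re ≤ M} := hs.segment_subset hb ha
  have h := (convex_segment b a).norm_image_sub_le_of_norm_hasDerivWithin_le
    (f := fun x => Complex.exp x - x * Complex.exp b)
    (f' := fun x => Complex.exp x - Complex.exp b) (C := Real.exp M * ‖a - b‖)
    (fun y _ => by
      have h1 := (Complex.hasDerivAt_exp y).sub ((hasDerivAt_id y).mul_const (Complex.exp b))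
      rw [one_mul] at h1
      exact h1.hasDerivWithinAt)
    (fun y hy => by
      refine (first y (hseg hy)).trans ?_
      gcongr
      obtain ⟨u, ⟨hu0, hu1⟩, rfl⟩ := (segment_eq_image' ℝ b a ▸ hy)
      rw [add_sub_cancel_left, norm_smul, Real.norm_of_nonneg hu0]
      exact mul_le_of_le_one_left (norm_nonneg _) hu1)
    (left_mem_segment ℝ b a) (right_mem_segment ℝ b a)
  calc _ = ‖Complex.exp a - a * Complex.exp b - (Complex.exp b - b * Complex.exp b)‖ := by
        congr 1; ring
    _ ≤ _ := h
    _ = _ := by ring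

theorem pow_mul_exp_neg_le (k : ℕ) {u : ℝ} (hu : 0 ≤ u) :
    u ^ k * Real.exp (-u) ≤ k.factorial := by
  have h : u ^ k / k.factorial ≤ Real.exp u := by
    exact Real.pow_div_factorial_le_exp u hu k
  rw [div_le_iff₀ (by positivity)] at h
  rw [Real.exp_neg, ← div_eq_mul_inv, div_le_iff₀ (Real.exp_pos u)]
  linarith

/-- The pointwise form of the error term in Laplace's method: powers of `θ` are traded for powers
of `n⁻¹` at the cost of half of the Gaussian. -/
theorem sq_mul_exp_le {c : ℝ} (hc : 0 < c) {n : ℝ} (hn : 0 < n) (θ : ℝ) :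
    (θ ^ 2 + n * θ ^ 4 + n ^ 2 * θ ^ 6) * Real.exp (-(c * n * θ ^ 2))
      ≤ (2 / c + 8 / c ^ 2 + 48 / c ^ 3) / n * Real.exp (-(c / 2 * n) * θ ^ 2) := by
  set u := c / 2 * n * θ ^ 2 with hu
  have hu0 : 0 ≤ u := by positivity
  have e : Real.exp (-(c * n * θ ^ 2)) = Real.exp (-u) * Real.exp (-(c / 2 * n) * θ ^ 2) := by
    rw [← Real.exp_add]; congr 1; rw [hu]; ring
  have hp : θ ^ 2 + n * θ ^ 4 + n ^ 2 * θ ^ 6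
      = (2 / c * u + 4 / c ^ 2 * u ^ 2 + 8 / c ^ 3 * u ^ 3) / n := by
    rw [hu]; field_simp; ring
  have h1 := pow_mul_exp_neg_le 1 hu0
  have h2 := pow_mul_exp_neg_le 2 hu0
  have h3 := pow_mul_exp_neg_le 3 hu0
  norm_num [Nat.factorial] at h1 h2 h3
  rw [e, hp, ← mul_assoc]
  gcongr
  rw [div_mul_eq_mul_div]
  gcongr
  calc _ = 2 / c * (u * Real.exp (-u)) + 4 / c ^ 2 * (u ^ 2 * Real.exp (-u))
        + 8 / c ^ 3 * (u ^ 3 * Real.exp (-u)) := by ring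
    _ ≤ 2 / c * 1 + 4 / c ^ 2 * 2 + 8 / c ^ 3 * 6 := by gcongr
    _ = _ := by ring

/-- The integrand of Laplace's method, minus its Gaussian approximation and minus the odd part of
the next order, is bounded by a Gaussian of relative size `n⁻¹`. -/
theorem laplace_pointwise {c M : ℝ} (hc : 0 < c) (hM : 0 ≤ M) :
    ∃ C : ℝ, 0 ≤ C ∧ ∀ (a ψ a₀ a₁ H K : ℂ) (n θ : ℝ), 1 ≤ n → |θ| ≤ π →
      ‖a₀‖ ≤ M → ‖a₁‖ ≤ M → ‖K‖ ≤ M → c ≤ H.re →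
      ‖a - (a₀ + a₁ * θ)‖ ≤ M * θ ^ 2 → ‖ψ - (-(H * θ ^ 2) + K * θ ^ 3)‖ ≤ M * θ ^ 4 →
      ψ.re ≤ -(c * θ ^ 2) →
      ‖a * Complex.exp (n * ψ) - (a₁ * θ + n * a₀ * K * θ ^ 3) * Complex.exp (-(n * H) * θ ^ 2)
        - a₀ * Complex.exp (-(n * H) * θ ^ 2)‖ ≤ C / n * Real.exp (-(c / 2 * n) * θ ^ 2) := by
  set M₂ := M * (1 + π) with hM2
  set L := (M + M * π + M * π ^ 2) * M₂ ^ 2 + M + M * M₂ * π + M * M + M * M₂ with hL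
  refine ⟨L * (2 / c + 8 / c ^ 2 + 48 / c ^ 3), by positivity, ?_⟩
  intro a ψ a₀ a₁ H K n θ hn hθ ha0 ha1 hK hH ha hψ hre
  have hn0 : 0 < n := by linarith
  set G := Complex.exp (-(n * H) * θ ^ 2) with hG
  have hGe : (-(n * H) * (θ : ℂ) ^ 2).re ≤ -(c * n * θ ^ 2) := by
    have : (-(n * H) * (θ : ℂ) ^ 2).re = -(H.re * n * θ ^ 2) := by
      rw [← Complex.ofReal_pow, Complex.re_mul_ofReal, Complex.neg_re, Complex.re_ofReal_mul]
      ring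
    rw [this]
    gcongr
  have hψn : (n * ψ).re ≤ -(c * n * θ ^ 2) := by
    rw [Complex.re_ofReal_mul]
    nlinarith
  set E := Real.exp (-(c * n * θ ^ 2)) with hE
  have hGn : ‖G‖ ≤ E := by
    rw [hG, Complex.norm_exp]
    exact Real.exp_le_exp.2 hGe
  have hdiff := norm_exp_sub_exp_sub_le hψn hGe
  set T := |θ| with hT
  have e2 : θ ^ 2 = T ^ 2 := (sq_abs θ).symm
  have e4 : θ ^ 4 = T ^ 4 := by rw [show θ ^ 4 = (θ ^ 2) ^ 2 by ring, e2]; ring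
  have e6 : θ ^ 6 = T ^ 6 := by rw [show θ ^ 6 = (θ ^ 2) ^ 3 by ring, e2]; ring
  have nθ : ∀ k : ℕ, ‖(θ : ℂ) ^ k‖ = T ^ k := fun k => by
    rw [norm_pow, Complex.norm_real, Real.norm_eq_abs]
  have hnC : ‖(n : ℂ)‖ = n := by rw [Complex.norm_real, Real.norm_of_nonneg hn0.le]
  -- the difference of the exponents is of third order
  have hd3 : ‖n * ψ - -(n * H) * (θ : ℂ) ^ 2‖ ≤ n * (M₂ * T ^ 3) := by
    have : n * ψ - -(n * H) * (θ : ℂ) ^ 2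
        = n * ((ψ - (-(H * θ ^ 2) + K * θ ^ 3)) + K * θ ^ 3) := by ring
    rw [this, norm_mul, hnC]
    gcongr
    refine (norm_add_le _ _).trans ?_
    rw [norm_mul, nθ]
    rw [e4] at hψ
    calc _ ≤ M * T ^ 4 + M * T ^ 3 := by gcongr
      _ = M * T ^ 3 * T + M * T ^ 3 := by ring
      _ ≤ M * T ^ 3 * π + M * T ^ 3 := by gcongr
      _ = _ := by rw [hM2]; ring
  have hd4 : ‖n * ψ - -(n * H) * (θ : ℂ) ^ 2 - n * K * θ ^ 3‖ ≤ n * (M * T ^ 4) := by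
    have : n * ψ - -(n * H) * (θ : ℂ) ^ 2 - n * K * θ ^ 3
        = n * (ψ - (-(H * θ ^ 2) + K * θ ^ 3)) := by ring
    rw [this, norm_mul, hnC, ← e4]
    gcongr
  have ha' : ‖a‖ ≤ M + M * π + M * π ^ 2 := by
    have : a = (a - (a₀ + a₁ * θ)) + a₀ + a₁ * θ := by ring
    rw [this]
    refine (norm_add₃_le).trans ?_
    rw [norm_mul, Complex.norm_real, Real.norm_eq_abs]
    have : ‖a - (a₀ + a₁ * θ)‖ ≤ M * π ^ 2 := by
      refine ha.trans ?_
      rw [e2]; gcongr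
    have h2 : ‖a₁‖ * |θ| ≤ M * π := by gcongr
    linarith
  have split : a * Complex.exp (n * ψ) - (a₁ * θ + n * a₀ * K * θ ^ 3) * G - a₀ * G
      = a * (Complex.exp (n * ψ) - G - (n * ψ - -(n * H) * (θ : ℂ) ^ 2) * G)
        + (a - (a₀ + a₁ * θ)) * G + (a - (a₀ + a₁ * θ)) * (n * ψ - -(n * H) * (θ : ℂ) ^ 2) * G
        + a₀ * (n * ψ - -(n * H) * (θ : ℂ) ^ 2 - n * K * θ ^ 3) * G
        + a₁ * θ * (n * ψ - -(n * H) * (θ : ℂ) ^ 2) * G := by ring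
  rw [split]
  refine (norm_add_le _ _).trans ?_
  refine (add_le_add (norm_add₄_le) le_rfl).trans ?_
  have t1 : ‖a * (Complex.exp (n * ψ) - G - (n * ψ - -(n * H) * (θ : ℂ) ^ 2) * G)‖
      ≤ (M + M * π + M * π ^ 2) * ((n * (M₂ * T ^ 3)) ^ 2 * E) := by
    rw [norm_mul]
    gcongr
    refine hdiff.trans ?_
    gcongr
  have t2 : ‖(a - (a₀ + a₁ * θ)) * G‖ ≤ M * T ^ 2 * E := by
    rw [norm_mul, ← e2]; gcongr
  have t3 : ‖(a - (a₀ + a₁ * θ)) * (n * ψ - -(n * H) * (θ : ℂ) ^ 2) * G‖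
      ≤ M * (n * M₂ * T ^ 4 * π) * E := by
    rw [norm_mul, norm_mul]
    calc _ ≤ (M * T ^ 2) * (n * (M₂ * T ^ 3)) * E := by rw [← e2]; gcongr
      _ = M * (n * M₂ * T ^ 4 * T) * E := by ring
      _ ≤ _ := by gcongr
  have t4 : ‖a₀ * (n * ψ - -(n * H) * (θ : ℂ) ^ 2 - n * K * θ ^ 3) * G‖
      ≤ M * (n * (M * T ^ 4)) * E := by
    rw [norm_mul, norm_mul]; gcongr
  have t5 : ‖a₁ * θ * (n * ψ - -(n * H) * (θ : ℂ) ^ 2) * G‖ ≤ M * T * (n * (M₂ * T ^ 3)) * E := by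
    rw [norm_mul, norm_mul, norm_mul, Complex.norm_real, Real.norm_eq_abs]; gcongr
  have hfin := sq_mul_exp_le hc hn0 θ
  rw [e2, e4, e6] at hfin
  calc _ ≤ (M + M * π + M * π ^ 2) * ((n * (M₂ * T ^ 3)) ^ 2 * E) + M * T ^ 2 * E
          + M * (n * M₂ * T ^ 4 * π) * E + M * (n * (M * T ^ 4)) * E
          + M * T * (n * (M₂ * T ^ 3)) * E := by gcongr
    _ = ((M + M * π + M * π ^ 2) * M₂ ^ 2 * (n ^ 2 * T ^ 6) + M * T ^ 2
          + (M * M₂ * π + M * M + M * M₂) * (n * T ^ 4)) * E := by ring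
    _ ≤ (L * (n ^ 2 * T ^ 6) + L * T ^ 2 + L * (n * T ^ 4)) * E := by
        have p1 : 0 ≤ (M + M * π + M * π ^ 2) * M₂ ^ 2 := by positivity
        have p2 : 0 ≤ M * M₂ * π := by positivity
        have p3 : 0 ≤ M * M := by positivity
        have p4 : 0 ≤ M * M₂ := by positivity
        gcongr <;> linarith
    _ = L * ((T ^ 2 + n * T ^ 4 + n ^ 2 * T ^ 6) * E) := by ring
    _ ≤ L * ((2 / c + 8 / c ^ 2 + 48 / c ^ 3) / n * Real.exp (-(c / 2 * n) * T ^ 2)) := by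
        rw [hE, e2]
        gcongr
    _ = _ := by rw [e2]; ring

/-- **Laplace's method**, with an error that is uniform in the amplitude and the phase. The cubic
term of the phase and the linear term of the amplitude are odd, so that they do not contribute at
the order `n ^ (-1)`. -/
theorem laplace_integral {c M : ℝ} (hc : 0 < c) (hM : 0 ≤ M) :
    ∃ C : ℝ, 0 ≤ C ∧ ∀ (a ψ : ℝ → ℂ) (a₀ a₁ H K : ℂ) (n : ℝ), 1 ≤ n →
      ‖a₀‖ ≤ M → ‖a₁‖ ≤ M → ‖K‖ ≤ M → c ≤ H.re →
      (∀ θ : ℝ, |θ| ≤ π → ‖a θ - (a₀ + a₁ * θ)‖ ≤ M * θ ^ 2) →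
      (∀ θ : ℝ, |θ| ≤ π → ‖ψ θ - (-(H * θ ^ 2) + K * θ ^ 3)‖ ≤ M * θ ^ 4) →
      (∀ θ : ℝ, |θ| ≤ π → (ψ θ).re ≤ -(c * θ ^ 2)) →
      IntervalIntegrable (fun θ => a θ * Complex.exp (n * ψ θ)) MeasureTheory.volume (-π) π →
      ‖(∫ θ in (-π)..π, a θ * Complex.exp (n * ψ θ)) - a₀ * (π / (n * H)) ^ (1 / 2 : ℂ)‖
        ≤ C / (n * √n) := by
  obtain ⟨C₁, hC₁, h₁⟩ := laplace_pointwise hc hM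
  have hpi := Real.pi_pos
  set B := max C₁ M with hB
  have hB0 : 0 ≤ B := le_max_of_le_left hC₁
  refine ⟨B * (1 + 2 / c) * √(π / (c / 2)), by positivity, ?_⟩
  intro a ψ a₀ a₁ H K n hn ha0 ha1 hK hH ha hψ hre hint
  have hn0 : 0 < n := by linarith
  set G : ℝ → ℂ := fun θ => Complex.exp (-(n * H) * (θ : ℂ) ^ 2) with hG
  have hnH : 0 < (n * H : ℂ).re := by
    rw [Complex.re_ofReal_mul]
    exact mul_pos hn0 (hc.trans_le hH)
  set O : ℝ → ℂ := fun θ => (a₁ * θ + n * a₀ * K * θ ^ 3) * G θ with hO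
  have hOc : Continuous O := by fun_prop
  have hOdd : ∫ θ in (-π)..π, O θ = 0 := by
    have h := intervalIntegral.integral_comp_neg (a := -π) (b := π) O
    have e : ∀ θ, O (-θ) = -O θ := fun θ => by
      simp only [hO, hG]
      push_cast
      ring_nf
    simp only [e, neg_neg, intervalIntegral.integral_neg] at h
    have h2 : (2 : ℂ) * ∫ θ in (-π)..π, O θ = 0 := by linear_combination -h
    simpa using h2
  have hGauss : ∫ θ : ℝ, G θ = (π / (n * H)) ^ (1 / 2 : ℂ) := integral_gaussian_complex hnH
  have hGint : MeasureTheory.Integrable G := integrable_cexp_neg_mul_sq hnH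
  have hle : -π ≤ π := by linarith
  have hdiffint : MeasureTheory.IntegrableOn
      (fun θ => a θ * Complex.exp (n * ψ θ) - O θ) (Set.Ioc (-π) π) := by
    have := hint.sub (hOc.intervalIntegrable (-π) π)
    exact (intervalIntegrable_iff_integrableOn_Ioc_of_le hle).1 this
  have e : (∫ θ in (-π)..π, a θ * Complex.exp (n * ψ θ)) - a₀ * (π / (n * H)) ^ (1 / 2 : ℂ)
      = ∫ θ : ℝ, ((Set.Ioc (-π) π).indicator (fun θ => a θ * Complex.exp (n * ψ θ) - O θ) θ
          - a₀ * G θ) := by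
    rw [MeasureTheory.integral_sub (hdiffint.integrable_indicator measurableSet_Ioc)
      (hGint.const_mul a₀), MeasureTheory.integral_indicator measurableSet_Ioc,
      MeasureTheory.integral_const_mul, hGauss, ← intervalIntegral.integral_of_le hle,
      intervalIntegral.integral_sub hint (hOc.intervalIntegrable _ _), hOdd, sub_zero]
  have hc2 : 0 < c / 2 * n := by positivity
  have hbound : ∀ θ : ℝ, ‖(Set.Ioc (-π) π).indicator
        (fun θ => a θ * Complex.exp (n * ψ θ) - O θ) θ - a₀ * G θ‖
      ≤ B * (1 + 2 / c) / n * Real.exp (-(c / 2 * n) * θ ^ 2) := by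
    intro θ
    by_cases hθ : θ ∈ Set.Ioc (-π) π
    · have hab : |θ| ≤ π := abs_le.2 ⟨hθ.1.le, hθ.2⟩
      rw [Set.indicator_of_mem hθ]
      refine (h₁ (a θ) (ψ θ) a₀ a₁ H K n θ hn hab ha0 ha1 hK hH (ha θ hab) (hψ θ hab)
        (hre θ hab)).trans ?_
      gcongr
      calc C₁ ≤ B := le_max_left _ _
        _ ≤ B * (1 + 2 / c) := le_mul_of_one_le_right hB0 (by linarith [div_pos two_pos hc])
    · have hab : π ^ 2 ≤ θ ^ 2 := by
        rw [Set.mem_Ioc, not_and_or, not_lt, not_le] at hθ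
        rcases hθ with h | h <;> nlinarith
      have h1 : 1 ≤ θ ^ 2 := by nlinarith [Real.pi_gt_three]
      rw [Set.indicator_of_notMem hθ, zero_sub, norm_neg, norm_mul]
      have hGn : ‖G θ‖ ≤ Real.exp (-(c * n * θ ^ 2)) := by
        simp only [hG]
        rw [Complex.norm_exp]
        refine Real.exp_le_exp.2 ?_
        rw [← Complex.ofReal_pow, Complex.re_mul_ofReal, Complex.neg_re, Complex.re_ofReal_mul]
        nlinarith [mul_le_mul_of_nonneg_right (mul_le_mul_of_nonneg_left hH hn0.le) (sq_nonneg θ)]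
      -- outside of the interval half of the Gaussian is already of order `n⁻¹`
      have hx : Real.exp (-(c * n * θ ^ 2)) ≤ 2 / c / n * Real.exp (-(c / 2 * n) * θ ^ 2) := by
        set u := c / 2 * n * θ ^ 2 with hu
        have hu1 : c / 2 * n ≤ u := le_mul_of_one_le_right hc2.le h1
        have := pow_mul_exp_neg_le 1 (hc2.le.trans hu1)
        have e1 : Real.exp (-(c * n * θ ^ 2))
            = Real.exp (-u) * Real.exp (-(c / 2 * n) * θ ^ 2) := by
          rw [← Real.exp_add]; congr 1; rw [hu]; ring
        rw [e1]
        gcongr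
        rw [div_div, le_div_iff₀ (by positivity)]
        norm_num at this
        nlinarith [Real.exp_pos (-u)]
      calc _ ≤ M * (2 / c / n * Real.exp (-(c / 2 * n) * θ ^ 2)) := by
            gcongr; exact hGn.trans hx
        _ = M * (2 / c) / n * Real.exp (-(c / 2 * n) * θ ^ 2) := by ring
        _ ≤ _ := by
            gcongr
            · exact le_max_right _ _
            · linarith
  rw [e]
  refine (MeasureTheory.norm_integral_le_of_norm_le
    ((integrable_exp_neg_mul_sq hc2).const_mul _) (Filter.Eventually.of_forall hbound)).trans ?_
  rw [MeasureTheory.integral_const_mul, integral_gaussian, ← div_div π, Real.sqrt_div' _ hn0.le]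
  apply le_of_eq
  field_simp

/-! ### The phase function on circles through the saddle point -/

/-- First order Taylor expansion of a bounded holomorphic function, with a remainder controlled by
the bound alone. It also holds outside of the disc at the points where the bound persists. -/
theorem exists_taylor_one {f : ℂ → ℂ} {r M : ℝ} (hr : 0 < r)
    (hf : DifferentiableOn ℂ f (Metric.ball 0 r)) (hM : ∀ x ∈ Metric.ball (0 : ℂ) r, ‖f x‖ ≤ M) :
    ∃ f₁ : ℂ, ‖f₁‖ ≤ 2 * M / r ∧ ∀ x : ℂ, ‖f x‖ ≤ M →
      ‖f x - (f 0 + f₁ * x)‖ ≤ 4 * M / r ^ 2 * ‖x‖ ^ 2 := by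
  have h00 : (0 : ℂ) ∈ Metric.ball (0 : ℂ) r := Metric.mem_ball_self hr
  have hnhds : Metric.ball (0 : ℂ) r ∈ nhds (0 : ℂ) := Metric.ball_mem_nhds _ hr
  have hM0 : 0 ≤ M := (norm_nonneg _).trans (hM 0 h00)
  set g := dslope f 0 with hg
  have hgd : DifferentiableOn ℂ g (Metric.ball 0 r) :=
    (Complex.differentiableOn_dslope hnhds).2 hf
  have hgb : ∀ x ∈ Metric.ball (0 : ℂ) r, ‖g x‖ ≤ 2 * M / r := fun x hx => by
    refine Complex.norm_dslope_le_div_of_mapsTo_ball hf (fun y hy => ?_) hx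
    rw [Metric.mem_closedBall, dist_eq_norm]
    exact (norm_sub_le _ _).trans (by linarith [hM y hy, hM 0 h00])
  refine ⟨g 0, hgb 0 h00, fun x hx => ?_⟩
  have hfx : f x = f 0 + x * g x := by
    have := sub_smul_dslope f 0 x
    rw [sub_zero, smul_eq_mul] at this
    rw [hg, this]; ring
  by_cases hxr : x ∈ Metric.ball (0 : ℂ) r
  · have hgx : g x = g 0 + x * dslope g 0 x := by
      have := sub_smul_dslope g 0 x
      rw [sub_zero, smul_eq_mul] at this
      rw [this]; ring
    have hgg : ‖dslope g 0 x‖ ≤ (2 * (2 * M / r)) / r := by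
      refine Complex.norm_dslope_le_div_of_mapsTo_ball hgd (fun y hy => ?_) hxr
      rw [Metric.mem_closedBall, dist_eq_norm]
      exact (norm_sub_le _ _).trans (by linarith [hgb y hy, hgb 0 h00])
    have : f x - (f 0 + g 0 * x) = x ^ 2 * dslope g 0 x := by
      rw [hfx, hgx]; ring
    rw [this, norm_mul, norm_pow]
    calc _ ≤ ‖x‖ ^ 2 * ((2 * (2 * M / r)) / r) := by gcongr
      _ = _ := by ring
  · have hxr' : r ≤ ‖x‖ := by simpa using hxr
    have h1 : 1 ≤ ‖x‖ / r := (one_le_div hr).2 hxr'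
    calc ‖f x - (f 0 + g 0 * x)‖ ≤ ‖f x‖ + (‖f 0‖ + ‖g 0‖ * ‖x‖) := by
          refine (norm_sub_le _ _).trans ?_
          gcongr
          exact (norm_add_le _ _).trans (by rw [norm_mul])
      _ ≤ M + (M + 2 * M / r * ‖x‖) := by gcongr; exacts [hM 0 h00, hgb 0 h00]
      _ = 2 * M * 1 + 2 * M * (‖x‖ / r * 1) := by ring
      _ ≤ 2 * M * (‖x‖ / r) ^ 2 + 2 * M * (‖x‖ / r * (‖x‖ / r)) := by
          gcongr
          exact one_le_pow₀ h1
      _ = _ := by ring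

/-- The rational part of the phase. Here `p = exp (-2 ζ)`, `q = exp (-2 conj ζ')` and `σ² = p q`; if
`n E(s)` is the exponent of the Mehler kernel, then
`E(σ t) = E(σ) + (t - 1) + (t - 1)² phaseQ p q t`. -/
noncomputable def phaseQ (p q t : ℂ) : ℂ := (t * (p * q) - (p + q) / 2) / (1 - t ^ 2 * (p * q))

/-- The phase, relative to its value at the saddle point `t = 1`. -/
noncomputable def phase (p q t : ℂ) : ℂ := t - 1 + (t - 1) ^ 2 * phaseQ p q t - Complex.log t

/-- The second derivative of the phase at the saddle point. -/
noncomputable def saddleCurvature (p q : ℂ) : ℂ := (1 - p) * (1 - q) / (1 - p * q)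

theorem norm_sq_mul_le {p q t : ℂ} {ρ r : ℝ} (hp : ‖p‖ ≤ ρ) (hq : ‖q‖ ≤ ρ) (ht : ‖t‖ ≤ 1 + r) :
    ‖t ^ 2 * (p * q)‖ ≤ ((1 + r) * ρ) ^ 2 := by
  have h0 : 0 ≤ ρ := (norm_nonneg _).trans hp
  rw [norm_mul, norm_mul, norm_pow]
  calc _ ≤ (1 + r) ^ 2 * (ρ * ρ) := by gcongr
    _ = _ := by ring

theorem le_norm_one_sub {z : ℂ} {ν : ℝ} (hz : ‖z‖ ≤ ν) : 1 - ν ≤ ‖1 - z‖ := by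
  have := norm_sub_norm_le (1 : ℂ) z
  rw [norm_one] at this
  linarith

theorem re_inv_ge {z : ℂ} {a b : ℝ} (ha : 0 < a) (h1 : a ≤ z.re) (h2 : ‖z‖ ≤ b) :
    a / b ^ 2 ≤ (z⁻¹).re := by
  have hz : 0 < ‖z‖ := (ha.trans_le h1).trans_le (Complex.re_le_norm z)
  rw [Complex.inv_re, Complex.normSq_eq_norm_sq]
  have h0 : 0 ≤ z.re := ha.le.trans h1
  gcongr

/-- The half plane bound `(1 - ρ) / (1 + ρ) ≤ Re ((1 + z) / (1 - z))` on the disc of radius `ρ`,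
together with the corresponding bound of the modulus. -/
theorem cayley_bounds {z : ℂ} {ρ : ℝ} (hρ : ρ < 1) (hz : ‖z‖ ≤ ρ) :
    (1 - ρ) / (1 + ρ) ≤ ((1 + z) / (1 - z)).re ∧ ‖(1 + z) / (1 - z)‖ ≤ (1 + ρ) / (1 - ρ) := by
  have h0 : 0 ≤ ρ := (norm_nonneg _).trans hz
  have h1 := le_norm_one_sub hz
  have h2 : ‖1 - z‖ ≤ 1 + ρ := (norm_sub_le _ _).trans (by rw [norm_one]; linarith)
  have h3 : ‖1 + z‖ ≤ 1 + ρ := (norm_add_le _ _).trans (by rw [norm_one]; linarith)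
  have hpos : 0 < ‖1 - z‖ := by linarith
  constructor
  · have e : ((1 + z) / (1 - z)).re = (1 - ‖z‖ ^ 2) / ‖1 - z‖ ^ 2 := by
      rw [Complex.div_re, Complex.normSq_eq_norm_sq, ← add_div]
      congr 1
      rw [← Complex.normSq_eq_norm_sq, Complex.normSq_apply]
      simp
      ring
    rw [e]
    calc (1 - ρ) / (1 + ρ) = (1 - ρ ^ 2) / (1 + ρ) ^ 2 := by
          field_simp; ring
      _ ≤ _ := by
          have : 0 ≤ 1 - ‖z‖ ^ 2 := by nlinarith [norm_nonneg z]
          gcongr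
  · rw [norm_div]
    gcongr

/-- Strict decay along the unit circle rests on the positivity of
`Re ((1 - a) (1 - b) / (1 - a b))` for `a`, `b` in the disc; its reciprocal is the mean of two
Cayley transforms. -/
theorem re_curvature_ge {a b : ℂ} {ρ : ℝ} (hρ : ρ < 1) (ha : ‖a‖ ≤ ρ) (hb : ‖b‖ ≤ ρ) :
    ((1 - ρ) / (1 + ρ)) ^ 3 ≤ ((1 - a) * (1 - b) / (1 - a * b)).re := by
  have h0 : 0 ≤ ρ := (norm_nonneg _).trans ha
  have hna : 1 - a ≠ 0 := norm_pos_iff.1 (by linarith [le_norm_one_sub ha])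
  have hnb : 1 - b ≠ 0 := norm_pos_iff.1 (by linarith [le_norm_one_sub hb])
  obtain ⟨ha1, ha2⟩ := cayley_bounds hρ ha
  obtain ⟨hb1, hb2⟩ := cayley_bounds hρ hb
  have e : (1 - a) * (1 - b) / (1 - a * b)
      = (((1 + a) / (1 - a) + (1 + b) / (1 - b)) / 2)⁻¹ := by
    have : ((1 + a) / (1 - a) + (1 + b) / (1 - b)) / 2 = (1 - a * b) / ((1 - a) * (1 - b)) := by
      field_simp; ring
    rw [this, inv_div]
  rw [e]
  have hpos : 0 < (1 - ρ) / (1 + ρ) := div_pos (by linarith) (by linarith)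
  have hre : (1 - ρ) / (1 + ρ) ≤ (((1 + a) / (1 - a) + (1 + b) / (1 - b)) / 2).re := by
    rw [show (2 : ℂ) = ((2 : ℝ) : ℂ) by norm_num, Complex.div_ofReal_re, Complex.add_re]
    linarith
  have hn : ‖((1 + a) / (1 - a) + (1 + b) / (1 - b)) / 2‖ ≤ (1 + ρ) / (1 - ρ) := by
    rw [norm_div]
    have := norm_add_le ((1 + a) / (1 - a)) ((1 + b) / (1 - b))
    norm_num
    linarith
  refine le_trans (le_of_eq ?_) (re_inv_ge hpos hre hn)
  field_simp

/-- On the unit circle `(t - 1)² = -t |t - 1|²`, which makes the real part explicit. -/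
theorem re_phase_unit_circle {p q t : ℂ} {ρ : ℝ} (hρ : ρ < 1) (hp : ‖p‖ ≤ ρ) (hq : ‖q‖ ≤ ρ)
    (ht : ‖t‖ = 1) :
    (t - 1 + (t - 1) ^ 2 * phaseQ p q t).re ≤ -(((1 - ρ) / (1 + ρ)) ^ 3 / 2 * ‖t - 1‖ ^ 2) := by
  have h0 : 0 ≤ ρ := (norm_nonneg _).trans hp
  have hpt : ‖p * t‖ ≤ ρ := by rw [norm_mul, ht, mul_one]; exact hp
  have hqt : ‖q * t‖ ≤ ρ := by rw [norm_mul, ht, mul_one]; exact hq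
  have hc := re_curvature_ge hρ hpt hqt
  have hden : 1 - t ^ 2 * (p * q) ≠ 0 := by
    have := norm_sq_mul_le (r := 0) hp hq (by rw [ht]; norm_num)
    have h1 : (0 : ℝ) < 1 - ((1 + 0) * ρ) ^ 2 := by nlinarith
    exact norm_pos_iff.1 (h1.trans_le (le_norm_one_sub this))
  have htt : t * conj t = 1 := by
    rw [Complex.mul_conj, Complex.normSq_eq_norm_sq, ht]; norm_num
  have hn : ((‖t - 1‖ ^ 2 : ℝ) : ℂ) = 2 - t - conj t := by
    rw [← Complex.normSq_eq_norm_sq, ← Complex.mul_conj, map_sub, map_one]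
    linear_combination htt
  have hsq : (t - 1) ^ 2 = -(t * ((‖t - 1‖ ^ 2 : ℝ) : ℂ)) := by
    rw [hn]; linear_combination -htt
  have hre : (t - 1).re = -(‖t - 1‖ ^ 2 / 2) := by
    have := congrArg Complex.re hn
    rw [Complex.ofReal_re] at this
    simp at this ⊢
    linarith
  have hQ : (1 - p * t) * (1 - q * t) / (1 - p * t * (q * t)) = 1 + 2 * (t * phaseQ p q t) := by
    have : 1 - p * t * (q * t) = 1 - t ^ 2 * (p * q) := by ring
    have hQd : phaseQ p q t * (1 - t ^ 2 * (p * q)) = t * (p * q) - (p + q) / 2 :=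
      div_mul_cancel₀ _ hden
    rw [this, div_eq_iff hden]
    linear_combination -2 * t * hQd
  rw [hQ] at hc
  have hr2 : (1 + 2 * (t * phaseQ p q t)).re = 1 + 2 * (t * phaseQ p q t).re := by simp
  rw [hr2] at hc
  have e : ((t - 1) ^ 2 * phaseQ p q t).re = -(‖t - 1‖ ^ 2 * (t * phaseQ p q t).re) := by
    rw [hsq, ← Complex.re_ofReal_mul, ← Complex.neg_re]
    congr 1
    ring
  rw [Complex.add_re, hre, e]
  nlinarith [sq_nonneg ‖t - 1‖]

theorem norm_phaseQ_le {p q t : ℂ} {ν : ℝ} (hν : ν < 1) (hp : ‖p‖ ≤ 1) (hq : ‖q‖ ≤ 1)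
    (ht : ‖t‖ ≤ 2) (h : ‖t ^ 2 * (p * q)‖ ≤ ν) : ‖phaseQ p q t‖ ≤ 3 / (1 - ν) := by
  have h1 := le_norm_one_sub h
  rw [phaseQ, norm_div]
  gcongr
  refine (norm_sub_le _ _).trans ?_
  have a : ‖t * (p * q)‖ ≤ 2 * (1 * 1) := by rw [norm_mul, norm_mul]; gcongr
  have b : ‖(p + q) / 2‖ ≤ 1 := by
    rw [norm_div]
    have := norm_add_le p q
    norm_num
    linarith
  linarith

theorem norm_phaseQ_sub_le {p q t t' : ℂ} {ν : ℝ} (hν : ν < 1) (hp : ‖p‖ ≤ 1) (hq : ‖q‖ ≤ 1)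
    (ht : ‖t‖ ≤ 2) (ht' : ‖t'‖ ≤ 2) (h : ‖t ^ 2 * (p * q)‖ ≤ ν) (h' : ‖t' ^ 2 * (p * q)‖ ≤ ν) :
    ‖phaseQ p q t - phaseQ p q t'‖ ≤ 9 / (1 - ν) ^ 2 * ‖t - t'‖ := by
  have h1 := le_norm_one_sub h
  have h1' := le_norm_one_sub h'
  have h2 : 0 < 1 - ν := by linarith
  have hd : 1 - t ^ 2 * (p * q) ≠ 0 := norm_pos_iff.1 (h2.trans_le h1)
  have hd' : 1 - t' ^ 2 * (p * q) ≠ 0 := norm_pos_iff.1 (h2.trans_le h1')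
  have hpq : ‖p * q‖ ≤ 1 := by
    rw [norm_mul]; exact mul_le_one₀ hp (norm_nonneg _) hq
  have e : phaseQ p q t - phaseQ p q t'
      = (p * q + t * t' * (p * q) ^ 2 - (p + q) / 2 * (p * q) * (t + t'))
        / ((1 - t ^ 2 * (p * q)) * (1 - t' ^ 2 * (p * q))) * (t - t') := by
    rw [phaseQ, phaseQ, div_sub_div _ _ hd hd', div_mul_eq_mul_div]
    congr 1
    ring
  rw [e, norm_mul, norm_div, norm_mul (1 - t ^ 2 * (p * q)), pow_two (1 - ν)]
  gcongr
  have b : ‖(p + q) / 2‖ ≤ 1 := by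
    rw [norm_div]
    have := norm_add_le p q
    norm_num
    linarith
  have a1 : ‖t * t' * (p * q) ^ 2‖ ≤ 2 * 2 * 1 ^ 2 := by
    rw [norm_mul, norm_mul, norm_pow]; gcongr
  have a2 : ‖(p + q) / 2 * (p * q) * (t + t')‖ ≤ 1 * 1 * (2 + 2) := by
    rw [norm_mul, norm_mul]
    gcongr
    exact (norm_add_le _ _).trans (add_le_add ht ht')
  refine (norm_sub_le _ _).trans ?_
  have := norm_add_le (p * q) (t * t' * (p * q) ^ 2)
  linarith

theorem norm_circle_le {κ ε : ℝ} {u : ℂ} (hu : ‖u‖ = 1) (hκ : |κ - 1| ≤ ε) :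
    ‖1 + κ * (u - 1)‖ ≤ 1 + 2 * ε ∧ 1 - 2 * ε ≤ ‖1 + κ * (u - 1)‖ := by
  have e : 1 + κ * (u - 1) = u + ((κ - 1 : ℝ) : ℂ) * (u - 1) := by push_cast; ring
  have h1 : ‖((κ - 1 : ℝ) : ℂ) * (u - 1)‖ ≤ ε * 2 := by
    rw [norm_mul, Complex.norm_real, Real.norm_eq_abs]
    have := norm_sub_le u 1
    rw [hu, norm_one] at this
    have h0 := (abs_nonneg _).trans hκ
    gcongr
    linarith
  rw [e]
  constructor
  · refine (norm_add_le _ _).trans (by linarith)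
  · have := norm_sub_norm_le u (-(((κ - 1 : ℝ) : ℂ) * (u - 1)))
    rw [norm_neg, sub_neg_eq_add] at this
    linarith

/-- The squared modulus along the circle `1 + κ (u - 1)`, `|u| = 1`. -/
theorem norm_sq_circle {κ : ℝ} {u : ℂ} (hu : ‖u‖ = 1) :
    ‖1 + κ * (u - 1)‖ ^ 2 = 1 - κ * (1 - κ) * ‖u - 1‖ ^ 2 := by
  have h : u.re * u.re + u.im * u.im = 1 := by
    rw [← Complex.normSq_apply, Complex.normSq_eq_norm_sq, hu, one_pow]
  rw [← Complex.normSq_eq_norm_sq, ← Complex.normSq_eq_norm_sq, Complex.normSq_apply,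
    Complex.normSq_apply]
  simp
  linear_combination (κ * (1 - κ) + κ * κ) * h

theorem neg_log_norm_circle_le {κ ε : ℝ} {u : ℂ} (hu : ‖u‖ = 1) (hκ : |κ - 1| ≤ ε)
    (hε : ε ≤ 1 / 4) : -Real.log ‖1 + κ * (u - 1)‖ ≤ 5 / 2 * ε * ‖u - 1‖ ^ 2 := by
  obtain ⟨hκ1, hκ2⟩ := abs_le.1 hκ
  have hsq := norm_sq_circle (κ := κ) hu
  have htl := (norm_circle_le hu hκ).2
  have hε0 := (abs_nonneg _).trans hκ
  generalize ‖1 + (κ : ℂ) * (u - 1)‖ = T at hsq htl ⊢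
  generalize ‖u - 1‖ = Y at hsq ⊢
  have hT : 1 / 2 ≤ T := by linarith
  have h1 := Real.one_sub_inv_le_log_of_pos (show 0 < T ^ 2 by positivity)
  rw [Real.log_pow] at h1
  push_cast at h1
  have hlow : (1 / 2) ^ 2 ≤ T ^ 2 := by gcongr
  have e : (T ^ 2)⁻¹ - 1 = κ * (1 - κ) * Y ^ 2 * (T ^ 2)⁻¹ := by
    field_simp
    linarith
  have i4 : (T ^ 2)⁻¹ ≤ 4 := by
    rw [inv_le_comm₀ (by positivity) (by norm_num)]
    linarith
  have k1 : κ * (1 - κ) ≤ 5 / 4 * ε := by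
    calc κ * (1 - κ) ≤ κ * ε := mul_le_mul_of_nonneg_left (by linarith) (by linarith)
      _ ≤ 5 / 4 * ε := mul_le_mul_of_nonneg_right (by linarith) hε0
  have h2 : (T ^ 2)⁻¹ - 1 ≤ 5 * ε * Y ^ 2 := by
    rw [e]
    calc _ ≤ 5 / 4 * ε * Y ^ 2 * (T ^ 2)⁻¹ := by gcongr
      _ ≤ 5 / 4 * ε * Y ^ 2 * 4 := by gcongr
      _ = _ := by ring
  linarith

/-- The real part of the phase decays quadratically along all circles that touch the unit circle
at the saddle point and are close enough to it. -/
theorem exists_re_phase_le {ρ : ℝ} (hρ0 : 0 ≤ ρ) (hρ : ρ < 1) :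
    ∃ ε₀ c : ℝ, 0 < ε₀ ∧ ε₀ ≤ 1 / 4 ∧ (1 + 2 * ε₀) * ρ < 1 ∧ 0 < c ∧
      ∀ (p q u : ℂ) (κ : ℝ), ‖p‖ ≤ ρ → ‖q‖ ≤ ρ → ‖u‖ = 1 → |κ - 1| ≤ ε₀ →
        (phase p q (1 + κ * (u - 1))).re ≤ -(c * ‖u - 1‖ ^ 2) := by
  set r := (1 - ρ) / 2 with hr
  have hρ1 : (1 + r) * ρ < 1 := by rw [hr]; nlinarith
  set ν := ((1 + r) * ρ) ^ 2 with hν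
  have hν1 : ν < 1 := by
    have : 0 ≤ (1 + r) * ρ := by positivity
    rw [hν]; nlinarith
  set δ := ((1 - ρ) / (1 + ρ)) ^ 3 with hδ
  set S := 3 + 9 / 4 * (3 / (1 - ν)) + 2 * (9 / (1 - ν) ^ 2) with hS
  have hS0 : 0 < S := by positivity
  set ε := min (1 / 4) (min (r / 2) (δ / (4 * S))) with hε
  have hε0 : 0 < ε := by positivity
  have hε1 : ε ≤ 1 / 4 := min_le_left _ _
  have hε2 : 2 * ε ≤ r := by
    have : ε ≤ r / 2 := (min_le_right _ _).trans (min_le_left _ _)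
    linarith
  have hε3 : ε * S ≤ δ / 4 := by
    have : ε ≤ δ / (4 * S) := (min_le_right _ _).trans (min_le_right _ _)
    calc ε * S ≤ δ / (4 * S) * S := by gcongr
      _ = δ / 4 := by field_simp
  refine ⟨ε, δ / 4, hε0, hε1, ?_, by positivity, ?_⟩
  · refine lt_of_le_of_lt ?_ hρ1
    gcongr
  intro p q u κ hp hq hu hκ
  have hp1 : ‖p‖ ≤ 1 := hp.trans hρ.le
  have hq1 : ‖q‖ ≤ 1 := hq.trans hρ.le
  obtain ⟨hκ1, hκ2⟩ := abs_le.1 hκ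
  set Y := ‖u - 1‖ with hY
  have hY2 : Y ≤ 2 := by
    have := norm_sub_le u 1
    rw [hu, norm_one] at this
    linarith
  set t := 1 + κ * (u - 1) with ht
  obtain ⟨htu, htl⟩ := norm_circle_le hu hκ
  rw [← ht] at htu htl
  have hnt : ‖t ^ 2 * (p * q)‖ ≤ ν := norm_sq_mul_le hp hq (htu.trans (by linarith))
  have hnu : ‖u ^ 2 * (p * q)‖ ≤ ν := norm_sq_mul_le hp hq (by rw [hu]; linarith)
  have hA := re_phase_unit_circle hρ hp hq hu
  have hQt := norm_phaseQ_le hν1 hp1 hq1 (t := t) (by linarith) hnt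
  have hL := norm_phaseQ_sub_le hν1 hp1 hq1 (t := t) (t' := u) (by linarith) (by rw [hu]; norm_num)
    hnt hnu
  have htu' : ‖t - u‖ ≤ ε * 2 := by
    have : t - u = ((κ - 1 : ℝ) : ℂ) * (u - 1) := by rw [ht]; push_cast; ring
    rw [this, norm_mul, Complex.norm_real, Real.norm_eq_abs]
    gcongr
  have hlog : -Real.log ‖t‖ ≤ 5 / 2 * ε * Y ^ 2 := neg_log_norm_circle_le hu hκ hε1
  have hdec : (t - 1 + (t - 1) ^ 2 * phaseQ p q t).re
      = (u - 1 + (u - 1) ^ 2 * phaseQ p q u).re + (((κ - 1 : ℝ) : ℂ) * (u - 1)).re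
        + ((u - 1) ^ 2 * (((κ ^ 2 - 1 : ℝ) : ℂ) * phaseQ p q t
          + (phaseQ p q t - phaseQ p q u))).re := by
    rw [← Complex.add_re, ← Complex.add_re]
    congr 1
    rw [ht]; push_cast; ring
  have hre : (((κ - 1 : ℝ) : ℂ) * (u - 1)).re ≤ ε / 2 * Y ^ 2 := by
    have h : u.re * u.re + u.im * u.im = 1 := by
      rw [← Complex.normSq_apply, Complex.normSq_eq_norm_sq, hu, one_pow]
    have hYe : Y ^ 2 = 2 - 2 * u.re := by
      rw [hY, ← Complex.normSq_eq_norm_sq, Complex.normSq_apply]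
      simp
      linear_combination h
    rw [Complex.re_ofReal_mul, Complex.sub_re, Complex.one_re,
      show u.re - 1 = -(Y ^ 2 / 2) by linarith]
    have : (1 - κ) * Y ^ 2 ≤ ε * Y ^ 2 := by gcongr; linarith
    linarith
  have hrem : ((u - 1) ^ 2 * (((κ ^ 2 - 1 : ℝ) : ℂ) * phaseQ p q t
          + (phaseQ p q t - phaseQ p q u))).re
      ≤ Y ^ 2 * (9 / 4 * ε * (3 / (1 - ν)) + 9 / (1 - ν) ^ 2 * (ε * 2)) := by
    refine (Complex.re_le_norm _).trans ?_
    rw [norm_mul, norm_pow]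
    gcongr
    refine (norm_add_le _ _).trans ?_
    rw [norm_mul, Complex.norm_real, Real.norm_eq_abs]
    have : |κ ^ 2 - 1| ≤ 9 / 4 * ε := by
      rw [show κ ^ 2 - 1 = (κ + 1) * (κ - 1) by ring, abs_mul]
      have : |κ + 1| ≤ 9 / 4 := abs_le.2 ⟨by linarith, by linarith⟩
      gcongr
    gcongr
    exact hL.trans (by gcongr)
  rw [phase, Complex.sub_re, Complex.log_re, hdec]
  have hfin : ε * S * Y ^ 2 ≤ δ / 4 * Y ^ 2 := by gcongr
  have hS' : ε * S * Y ^ 2 = Y ^ 2 * (9 / 4 * ε * (3 / (1 - ν)) + 9 / (1 - ν) ^ 2 * (ε * 2))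
      + 5 / 2 * ε * Y ^ 2 + ε / 2 * Y ^ 2 := by rw [hS]; ring
  linarith

/-- Third order expansion of the phase at the saddle point, uniform over circles that stay in a
bounded annulus. -/
theorem exists_phase_expansion {ρ r : ℝ} (hρ0 : 0 ≤ ρ) (hρ : ρ < 1) (hr : 0 < r) (hr1 : r ≤ 1 / 2)
    (hrρ : (1 + r) * ρ < 1) :
    ∃ C : ℝ, 0 ≤ C ∧ ∀ p q : ℂ, ‖p‖ ≤ ρ → ‖q‖ ≤ ρ → ∃ k : ℂ, ‖k‖ ≤ C ∧
      ∀ t : ℂ, 1 / 2 ≤ ‖t‖ → ‖t‖ ≤ 1 + r →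
        ‖phase p q t - (saddleCurvature p q / 2 * (t - 1) ^ 2 + k * (t - 1) ^ 3)‖
          ≤ C * ‖t - 1‖ ^ 4 := by
  set ν := ((1 + r) * ρ) ^ 2 with hν
  have hν1 : ν < 1 := by
    have : 0 ≤ (1 + r) * ρ := by positivity
    rw [hν]; nlinarith
  have h1ν : 0 < 1 - ν := by linarith
  set M := 3 / (1 - ν) with hM
  set C := 2 * M / r + 4 * M / r ^ 2 + 400 with hC
  have hC0 : 0 ≤ C := by positivity
  have hCa : 4 * M / r ^ 2 + 400 ≤ C := by
    rw [hC]
    have : 0 ≤ 2 * M / r := by positivity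
    linarith
  have hCb : 2 * M / r + 1 / 3 ≤ C := by
    rw [hC]
    have : 0 ≤ 4 * M / r ^ 2 := by positivity
    linarith
  refine ⟨C, hC0, fun p q hp hq => ?_⟩
  have hp1 : ‖p‖ ≤ 1 := hp.trans hρ.le
  have hq1 : ‖q‖ ≤ 1 := hq.trans hρ.le
  have hball : ∀ x ∈ Metric.ball (0 : ℂ) r, ‖1 + x‖ ≤ 1 + r := fun x hx => by
    have := norm_add_le 1 x
    rw [norm_one] at this
    rw [mem_ball_zero_iff] at hx
    linarith
  have hQb : ∀ t : ℂ, ‖t‖ ≤ 1 + r → ‖phaseQ p q t‖ ≤ M := fun t ht =>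
    norm_phaseQ_le hν1 hp1 hq1 (by linarith) (norm_sq_mul_le hp hq ht)
  have hQd : DifferentiableOn ℂ (fun x => phaseQ p q (1 + x)) (Metric.ball 0 r) := fun x hx => by
    have hne : 1 - (1 + x) ^ 2 * (p * q) ≠ 0 := norm_pos_iff.1
      (h1ν.trans_le (le_norm_one_sub (norm_sq_mul_le hp hq (hball x hx))))
    refine DifferentiableAt.differentiableWithinAt ?_
    simp only [phaseQ]
    refine DifferentiableAt.div ?_ ?_ hne <;> fun_prop
  obtain ⟨Q₁, hQ1, hQ⟩ := exists_taylor_one hr hQd (fun x hx => hQb _ (hball x hx))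
  refine ⟨Q₁ - 1 / 3, ?_, fun t htl htu => ?_⟩
  · refine (norm_sub_le _ _).trans ?_
    norm_num
    linarith
  set x := t - 1 with hx
  have htx : t = 1 + x := by rw [hx]; ring
  have hQx := hQ x (by rw [← htx]; exact hQb t htu)
  rw [← htx, add_zero] at hQx
  have hcurv : saddleCurvature p q / 2 = 1 / 2 + phaseQ p q 1 := by
    have hne : 1 - 1 ^ 2 * (p * q) ≠ 0 := norm_pos_iff.1
      (h1ν.trans_le (le_norm_one_sub (norm_sq_mul_le hp hq (by rw [norm_one]; linarith))))
    have hne' : 1 - p * q ≠ 0 := by simpa using hne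
    have hd : phaseQ p q 1 * (1 - p * q) = p * q - (p + q) / 2 := by
      have := div_mul_cancel₀ (1 * (p * q) - (p + q) / 2) hne
      simpa [phaseQ] using this
    rw [saddleCurvature, div_div, div_eq_iff (mul_ne_zero hne' two_ne_zero)]
    linear_combination -2 * hd
  have hlog : ‖Complex.log t - (x - x ^ 2 / 2 + x ^ 3 / 3)‖ ≤ 400 * ‖x‖ ^ 4 := by
    by_cases hx2 : ‖x‖ ≤ 1 / 2
    · have h := Complex.norm_log_sub_logTaylor_le 3 (z := x) (by linarith)
      have e : Complex.logTaylor (3 + 1) x = x - x ^ 2 / 2 + x ^ 3 / 3 := by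
        simp [Complex.logTaylor, Finset.sum_range_succ]
        ring
      rw [e, ← htx] at h
      refine h.trans ?_
      have : (1 - ‖x‖)⁻¹ ≤ 2 := by
        rw [inv_le_comm₀ (by linarith) (by norm_num)]; linarith
      norm_num
      have h4 : 0 ≤ ‖x‖ ^ 4 := by positivity
      nlinarith
    · push Not at hx2
      have hl : ‖Complex.log t‖ ≤ 5 := by
        refine (Complex.norm_le_abs_re_add_abs_im _).trans ?_
        rw [Complex.log_re, Complex.log_im]
        have h1 := Complex.abs_arg_le_pi t
        have hpos : 0 < ‖t‖ := by linarith
        have h2 := Real.log_le_sub_one_of_pos hpos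
        have h3 := Real.one_sub_inv_le_log_of_pos hpos
        have h4 : ‖t‖⁻¹ ≤ 2 := by
          rw [inv_le_comm₀ hpos (by norm_num)]; linarith
        have h5 : |Real.log ‖t‖| ≤ 1 := abs_le.2 ⟨by linarith, by linarith⟩
        linarith [Real.pi_lt_d2]
      have hx3 : ‖x‖ ≤ 3 := by
        rw [hx]
        have := norm_sub_le t 1
        rw [norm_one] at this
        linarith
      have b1 : ‖x - x ^ 2 / 2 + x ^ 3 / 3‖ ≤ 3 + 3 ^ 2 / 2 + 3 ^ 3 / 3 := by
        refine (norm_add_le _ _).trans (add_le_add ((norm_sub_le _ _).trans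
          (add_le_add hx3 ?_)) ?_)
        · rw [norm_div, norm_pow]; norm_num; nlinarith [norm_nonneg x]
        · rw [norm_div, norm_pow]; norm_num
          have : ‖x‖ ^ 3 ≤ 3 ^ 3 := by gcongr
          linarith
      have hx4 : (1 / 2) ^ 4 ≤ ‖x‖ ^ 4 := by gcongr
      refine (norm_sub_le _ _).trans ?_
      norm_num at b1 hx4
      linarith
  have e : phase p q t - (saddleCurvature p q / 2 * x ^ 2 + (Q₁ - 1 / 3) * x ^ 3)
      = x ^ 2 * (phaseQ p q t - (phaseQ p q 1 + Q₁ * x))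
        - (Complex.log t - (x - x ^ 2 / 2 + x ^ 3 / 3)) := by
    rw [hcurv, phase, ← hx]; ring
  rw [e]
  refine (norm_sub_le _ _).trans ?_
  rw [norm_mul, norm_pow]
  calc _ ≤ ‖x‖ ^ 2 * (4 * M / r ^ 2 * ‖x‖ ^ 2) + 400 * ‖x‖ ^ 4 := by gcongr
    _ = (4 * M / r ^ 2 + 400) * ‖x‖ ^ 4 := by ring
    _ ≤ _ := by gcongr

/-! ### Position of the pole relative to the circle -/

/-- The power of `t` with respect to the circle with centre `1 - κ` and radius `κ`. -/
theorem norm_sub_sq_sub_sq (κ : ℝ) (t : ℂ) :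
    ‖t - ((1 - κ : ℝ) : ℂ)‖ ^ 2 - κ ^ 2 = κ * (‖t‖ ^ 2 - 1) + (1 - κ) * ‖t - 1‖ ^ 2 := by
  simp only [← Complex.normSq_eq_norm_sq, Complex.normSq_apply]
  simp
  ring

theorem mem_ball_of_norm_lt_one {ε : ℝ} (hε : 0 < ε) {w : ℂ} (hw : ‖w‖ < 1) :
    w ∈ Metric.ball ((1 - (1 + ε) : ℝ) : ℂ) (1 + ε) := by
  have h := norm_sub_sq_sub_sq (1 + ε) w
  have h1 : ‖w‖ ^ 2 < 1 := by nlinarith [norm_nonneg w]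
  rw [mem_ball_iff_norm]
  refine lt_of_pow_lt_pow_left₀ 2 (by linarith) ?_
  nlinarith [sq_nonneg ‖w - 1‖]

theorem notMem_closedBall_of_one_le_norm {ε : ℝ} (hε : 0 < ε) (hε1 : ε ≤ 1 / 4) {w : ℂ}
    (hw : 1 ≤ ‖w‖) (hw1 : 0 < ‖w - 1‖) :
    w ∉ Metric.closedBall ((1 - (1 - ε) : ℝ) : ℂ) (1 - ε) := by
  have h := norm_sub_sq_sub_sq (1 - ε) w
  have h1 : 1 ≤ ‖w‖ ^ 2 := by nlinarith [norm_nonneg w]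
  rw [mem_closedBall_iff_norm, not_le]
  refine lt_of_pow_lt_pow_left₀ 2 (norm_nonneg _) ?_
  have h2 : 0 < ε * ‖w - 1‖ ^ 2 := by positivity
  have h3 : 0 ≤ (1 - ε) * (‖w‖ ^ 2 - 1) := mul_nonneg (by linarith) (by linarith)
  linarith

/-- The circle is pushed away from the side of the unit circle on which the pole lies, so that a
pole at distance `d` from the saddle point stays away from it. -/
theorem le_norm_sub_of_mem_sphere {ε d κ : ℝ} (hε : 0 < ε) (hε1 : ε ≤ 1 / 4) {w t : ℂ}
    (hd : 0 < d) (hwd : d ≤ ‖w - 1‖) (hκ : (κ = 1 + ε ∧ ‖w‖ ≤ 1) ∨ (κ = 1 - ε ∧ 1 ≤ ‖w‖))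
    (ht : t ∈ Metric.sphere ((1 - κ : ℝ) : ℂ) κ) :
    min (d / 2) (ε * d ^ 2 / 24) ≤ ‖t - w‖ := by
  rw [mem_sphere_iff_norm] at ht
  have h := norm_sub_sq_sub_sq κ t
  rw [ht, sub_self] at h
  by_cases ht1 : ‖t - 1‖ < d / 2
  · refine (min_le_left _ _).trans ?_
    have := norm_sub_le_norm_sub_add_norm_sub w t 1
    rw [norm_sub_rev w t] at this
    linarith
  · push Not at ht1
    refine (min_le_right _ _).trans ?_
    have hd2 : d ^ 2 / 4 ≤ ‖t - 1‖ ^ 2 := by nlinarith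
    have hed : ε * (d ^ 2 / 4) ≤ ε * ‖t - 1‖ ^ 2 := by gcongr
    have hnt : ‖t‖ ≤ 2 := by
      have h1 := norm_sub_norm_le t ((1 - κ : ℝ) : ℂ)
      rw [ht, Complex.norm_real, Real.norm_eq_abs] at h1
      have : |1 - κ| ≤ 1 / 4 := by
        rcases hκ with ⟨rfl, _⟩ | ⟨rfl, _⟩ <;> rw [abs_le] <;> constructor <;> linarith
      rcases hκ with ⟨rfl, _⟩ | ⟨rfl, _⟩ <;> linarith
    have h0 := norm_nonneg t
    have he : 0 < ε * (d ^ 2 / 4) := by positivity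
    rcases hκ with ⟨rfl, hw⟩ | ⟨rfl, hw⟩
    · have h1 := norm_sub_norm_le t w
      have h2 : ε * (d ^ 2 / 4) ≤ (1 + ε) * (‖t‖ ^ 2 - 1) := by linarith
      have h3 : 0 < ‖t‖ ^ 2 - 1 := pos_of_mul_pos_right (he.trans_le h2) (by linarith)
      have h4 : (1 + ε) * (‖t‖ ^ 2 - 1) ≤ 5 / 4 * (‖t‖ ^ 2 - 1) := by gcongr; linarith
      have h5 : 0 < ‖t‖ - 1 := by nlinarith
      have h6 : (‖t‖ - 1) * (‖t‖ + 1) ≤ (‖t‖ - 1) * 3 := by gcongr; linarith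
      nlinarith
    · have h1 := norm_sub_norm_le w t
      rw [norm_sub_rev] at h1
      have h2 : ε * (d ^ 2 / 4) ≤ (1 - ε) * (1 - ‖t‖ ^ 2) := by linarith
      have h3 : 0 < 1 - ‖t‖ ^ 2 := pos_of_mul_pos_right (he.trans_le h2) (by linarith)
      have h4 : (1 - ε) * (1 - ‖t‖ ^ 2) ≤ 1 * (1 - ‖t‖ ^ 2) := by gcongr; linarith
      have h5 : 0 < 1 - ‖t‖ := by nlinarith
      have h6 : (1 - ‖t‖) * (‖t‖ + 1) ≤ (1 - ‖t‖) * 3 := by gcongr; linarith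
      nlinarith

/-! ### Asymptotics of the contour integral -/

theorem mul_cpow_half_of_re_pos {x y : ℂ} (hx : 0 < x.re) (hy : 0 < y.re) (a : ℂ) :
    (x * y) ^ a = x ^ a * y ^ a := by
  have hx0 : x ≠ 0 := by rintro rfl; simp at hx
  have hy0 : y ≠ 0 := by rintro rfl; simp at hy
  have h1 := abs_lt.1 (Complex.abs_arg_lt_pi_div_two_iff.2 (Or.inl hx))
  have h2 := abs_lt.1 (Complex.abs_arg_lt_pi_div_two_iff.2 (Or.inl hy))
  rw [Complex.cpow_def_of_ne_zero (mul_ne_zero hx0 hy0), Complex.cpow_def_of_ne_zero hx0,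
    Complex.cpow_def_of_ne_zero hy0, Complex.log_mul hx0 hy0 ⟨by linarith, by linarith⟩,
    add_mul, Complex.exp_add]

/-- Expansions of the powers of `exp (i θ) - 1`. -/
theorem exp_sub_one_expansions (θ : ℝ) (hθ : |θ| ≤ π) :
    ‖Complex.exp (Complex.I * θ) - 1‖ ≤ |θ| ∧
    ‖Complex.exp (Complex.I * θ) - 1 - Complex.I * θ‖ ≤ Real.exp π * θ ^ 2 ∧
    ‖(Complex.exp (Complex.I * θ) - 1) ^ 2 - (-(θ : ℂ) ^ 2 - Complex.I * θ ^ 3)‖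
      ≤ (Real.exp π ^ 2 + 2 * Real.exp π) * θ ^ 4 ∧
    ‖(Complex.exp (Complex.I * θ) - 1) ^ 3 - (-(Complex.I * θ ^ 3))‖
      ≤ 3 * Real.exp π * θ ^ 4 := by
  set z : ℂ := Complex.I * θ with hz
  set y := Complex.exp z - 1 with hy
  have hzn : ‖z‖ = |θ| := by rw [hz, norm_mul, Complex.norm_I, one_mul, Complex.norm_real,
    Real.norm_eq_abs]
  have hB : Real.exp ‖z‖ ≤ Real.exp π := Real.exp_le_exp.2 (hzn ▸ hθ)
  have h2 := Complex.norm_exp_sub_sum_le_norm_mul_exp z 2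
  have h3 := Complex.norm_exp_sub_sum_le_norm_mul_exp z 3
  simp only [Finset.sum_range_succ, Finset.sum_range_zero] at h2 h3
  norm_num [Nat.factorial] at h2 h3
  have e2 : θ ^ 2 = |θ| ^ 2 := (sq_abs θ).symm
  have e4 : θ ^ 4 = |θ| ^ 4 := by rw [show θ ^ 4 = (θ ^ 2) ^ 2 by ring, e2]; ring
  have y1 : ‖y‖ ≤ |θ| := Real.norm_exp_I_mul_ofReal_sub_one_le
  have y2 : ‖y - z‖ ≤ Real.exp π * |θ| ^ 2 := by
    have : y - z = Complex.exp z - (1 + z) := by rw [hy]; ring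
    rw [this]
    refine h2.trans ?_
    rw [hzn] at hB ⊢
    rw [mul_comm]
    gcongr
  have y3 : ‖y - z - z ^ 2 / 2‖ ≤ Real.exp π * |θ| ^ 3 := by
    have : y - z - z ^ 2 / 2 = Complex.exp z - (1 + z + z ^ 2 / 2) := by rw [hy]; ring
    rw [this]
    refine h3.trans ?_
    rw [hzn] at hB ⊢
    rw [mul_comm]
    gcongr
  have I3 : Complex.I ^ 3 = -Complex.I := Complex.I_pow_three
  refine ⟨y1, by rw [e2]; exact y2, ?_, ?_⟩
  · have e : y ^ 2 - (-(θ : ℂ) ^ 2 - Complex.I * θ ^ 3)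
        = (y - z) ^ 2 + 2 * z * (y - z - z ^ 2 / 2) := by
      have : z ^ 2 + z ^ 3 = -(θ : ℂ) ^ 2 - Complex.I * θ ^ 3 := by
        rw [hz, mul_pow, mul_pow, I3, Complex.I_sq]; ring
      rw [← this]; ring
    rw [e, e4]
    refine (norm_add_le _ _).trans ?_
    rw [norm_pow, norm_mul, norm_mul, hzn]
    norm_num
    calc _ ≤ (Real.exp π * |θ| ^ 2) ^ 2 + 2 * |θ| * (Real.exp π * |θ| ^ 3) := by gcongr
      _ = _ := by ring
  · have e : y ^ 3 - (-(Complex.I * θ ^ 3)) = (y - z) * (y ^ 2 + y * z + z ^ 2) := by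
      have : z ^ 3 = -(Complex.I * θ ^ 3) := by rw [hz, mul_pow, I3]; ring
      rw [← this]; ring
    rw [e, e4, norm_mul]
    have : ‖y ^ 2 + y * z + z ^ 2‖ ≤ |θ| ^ 2 + |θ| * |θ| + |θ| ^ 2 := by
      refine norm_add₃_le.trans ?_
      rw [norm_pow, norm_mul, norm_pow, hzn]
      gcongr
    calc _ ≤ Real.exp π * |θ| ^ 2 * (|θ| ^ 2 + |θ| * |θ| + |θ| ^ 2) := by gcongr
      _ = _ := by ring

theorem le_norm_exp_sub_one {θ : ℝ} (hθ : |θ| ≤ π) :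
    4 / π ^ 2 * θ ^ 2 ≤ ‖Complex.exp (Complex.I * θ) - 1‖ ^ 2 := by
  have h := Real.mul_abs_le_abs_sin (x := θ / 2) (by rw [abs_div, abs_two]; linarith)
  rw [Complex.norm_exp_I_mul_ofReal_sub_one, Real.norm_eq_abs, sq_abs]
  have h2 : (2 / π * |θ / 2|) ^ 2 ≤ |Real.sin (θ / 2)| ^ 2 := by gcongr
  rw [mul_pow, sq_abs, sq_abs] at h2
  calc _ = 4 * ((2 / π) ^ 2 * (θ / 2) ^ 2) := by field_simp
    _ ≤ 4 * Real.sin (θ / 2) ^ 2 := by gcongr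
    _ = _ := by ring

/-- The parametrization over `[-π, π]` puts the saddle point in the interior of the interval. -/
theorem circleIntegral_eq_integral_neg_pi_pi (f : ℂ → ℂ) (κ : ℝ) :
    (∮ t in C(((1 - κ : ℝ) : ℂ), κ), f t)
      = ∫ θ in (-π)..π, κ * Complex.I * Complex.exp (Complex.I * θ)
          * f (1 + κ * (Complex.exp (Complex.I * θ) - 1)) := by
  have e : ∀ θ : ℝ, deriv (circleMap ((1 - κ : ℝ) : ℂ) κ) θ • f (circleMap ((1 - κ : ℝ) : ℂ) κ θ)
      = κ * Complex.I * Complex.exp (Complex.I * θ)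
          * f (1 + κ * (Complex.exp (Complex.I * θ) - 1)) := by
    intro θ
    rw [deriv_circleMap, smul_eq_mul]
    have : circleMap ((1 - κ : ℝ) : ℂ) κ θ = 1 + κ * (Complex.exp (Complex.I * θ) - 1) := by
      rw [circleMap, mul_comm Complex.I]
      push_cast; ring
    rw [this, circleMap_zero, mul_comm Complex.I (θ : ℂ)]
    ring
  have hper : Function.Periodic (fun θ : ℝ => κ * Complex.I * Complex.exp (Complex.I * θ)
          * f (1 + κ * (Complex.exp (Complex.I * θ) - 1))) (2 * π) := by
    intro θ
    have : Complex.exp (Complex.I * ((θ + 2 * π : ℝ) : ℂ)) = Complex.exp (Complex.I * θ) := by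
      rw [← Complex.exp_periodic (Complex.I * θ)]
      congr 1
      push_cast; ring
    simp only [this]
  simp only [circleIntegral, e]
  have h := hper.intervalIntegral_add_eq 0 (-π)
  rw [zero_add, show -π + 2 * π = π by ring] at h
  exact h

/-- The factor of the contour integrand that does not depend on `n`: the square root of the Mehler
kernel and the pole at `w`. -/
noncomputable def amplitude (p q w t : ℂ) : ℂ :=
  (1 - t ^ 2 * (p * q)) ^ (-(1 / 2) : ℂ) * (t - w)⁻¹

theorem norm_amplitude_le {p q w t : ℂ} {ν d : ℝ} (hν : ν < 1) (hd : 0 < d)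
    (h : ‖t ^ 2 * (p * q)‖ ≤ ν) (ht : d ≤ ‖t - w‖) :
    ‖amplitude p q w t‖ ≤ (1 - ν) ^ (-(1 / 2) : ℝ) * d⁻¹ := by
  have h1 := le_norm_one_sub h
  rw [amplitude, norm_mul, norm_inv]
  have e : (-(1 / 2) : ℂ) = ((-(1 / 2) : ℝ) : ℂ) := by push_cast; rfl
  rw [e, Complex.norm_cpow_real]
  have h0 : 0 ≤ (1 - ν) ^ (-(1 / 2) : ℝ) := Real.rpow_nonneg (by linarith) _
  have h2 : ‖1 - t ^ 2 * (p * q)‖ ^ (-(1 / 2) : ℝ) ≤ (1 - ν) ^ (-(1 / 2) : ℝ) :=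
    Real.rpow_le_rpow_of_nonpos (by linarith) h1 (by norm_num)
  exact mul_le_mul h2 (by gcongr) (by positivity) h0

theorem differentiableAt_amplitude {p q w t : ℂ} (h : ‖t ^ 2 * (p * q)‖ < 1) (ht : t ≠ w) :
    DifferentiableAt ℂ (amplitude p q w) t := by
  have h1 : 1 - t ^ 2 * (p * q) ∈ Complex.slitPlane := Or.inl (one_sub_re_pos h)
  refine DifferentiableAt.mul (DifferentiableAt.cpow_const ?_ h1)
    (DifferentiableAt.inv ?_ (sub_ne_zero.2 ht)) <;> fun_prop

/-- Along the circle the amplitude has a first order expansion in the angle. -/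
theorem exists_amplitude_expansion {ρ ε d : ℝ} (hρ0 : 0 ≤ ρ) (hε : 0 < ε) (hε1 : ε ≤ 1 / 4)
    (hερ : (1 + 2 * ε) * ρ < 1) (hd : 0 < d) :
    ∃ C : ℝ, 0 ≤ C ∧ ∀ (p q w : ℂ) (κ : ℝ), ‖p‖ ≤ ρ → ‖q‖ ≤ ρ → d ≤ ‖w - 1‖ →
      ((κ = 1 + ε ∧ ‖w‖ ≤ 1) ∨ (κ = 1 - ε ∧ 1 ≤ ‖w‖)) → ∃ a₁ : ℂ,
        ‖κ * Complex.I * amplitude p q w 1‖ ≤ C ∧ ‖a₁‖ ≤ C ∧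
        ∀ θ : ℝ, |θ| ≤ π →
          ‖κ * Complex.I * Complex.exp (Complex.I * θ)
              * amplitude p q w (1 + κ * (Complex.exp (Complex.I * θ) - 1))
            - (κ * Complex.I * amplitude p q w 1 + a₁ * θ)‖ ≤ C * θ ^ 2 := by
  set ν := ((1 + 2 * ε) * ρ) ^ 2 with hν
  have hν1 : ν < 1 := by
    have : 0 ≤ (1 + 2 * ε) * ρ := by positivity
    rw [hν]; nlinarith
  have h1ν : 0 < 1 - ν := by linarith
  set D := min (d / 2) (ε * d ^ 2 / 24) with hD
  have hD0 : 0 < D := by positivity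
  set M := (1 - ν) ^ (-(1 / 2) : ℝ) * D⁻¹ with hM
  set r := min (2 * ε) (d / 2) with hr
  have hr0 : 0 < r := by positivity
  have hr1 : r ≤ 2 * ε := min_le_left _ _
  have hr2 : r ≤ d / 2 := min_le_right _ _
  set F := 2 * M / r with hF
  have hF0 : 0 ≤ F := by positivity
  set G := 4 * M / r ^ 2 with hG
  set C := 2 * (M + F * 2) + 2 * (G * 2 ^ 2 + F * 2 + (M + F * 2) * Real.exp π) with hC
  have hC1 : 2 * M ≤ C := by
    have : 0 ≤ 2 * (G * 2 ^ 2 + F * 2 + (M + F * 2) * Real.exp π) := by positivity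
    rw [hC]; linarith
  have hC2 : 2 * (M + F * 2) ≤ C := by
    have : 0 ≤ 2 * (G * 2 ^ 2 + F * 2 + (M + F * 2) * Real.exp π) := by positivity
    rw [hC]; linarith
  have hC3 : 2 * (G * 2 ^ 2 + F * 2 + (M + F * 2) * Real.exp π) ≤ C := by
    have : 0 ≤ 2 * (M + F * 2) := by positivity
    rw [hC]; linarith
  refine ⟨C, by linarith, ?_⟩
  intro p q w κ hp hq hwd hκ
  have hκa : |κ - 1| ≤ ε := by
    rcases hκ with ⟨rfl, _⟩ | ⟨rfl, _⟩ <;> rw [abs_le] <;> constructor <;> linarith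
  have hκ0 : 0 ≤ κ := by rcases hκ with ⟨rfl, _⟩ | ⟨rfl, _⟩ <;> linarith
  have hκ2 : κ ≤ 2 := by rcases hκ with ⟨rfl, _⟩ | ⟨rfl, _⟩ <;> linarith
  have hκn : ‖(κ : ℂ)‖ ≤ 2 := by rwa [Complex.norm_real, Real.norm_of_nonneg hκ0]
  have hball : ∀ x ∈ Metric.ball (0 : ℂ) r, ‖(1 + x) ^ 2 * (p * q)‖ ≤ ν ∧ D ≤ ‖1 + x - w‖ := by
    intro x hx
    rw [mem_ball_zero_iff] at hx
    constructor
    · refine norm_sq_mul_le hp hq ((norm_add_le _ _).trans ?_)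
      rw [norm_one]; linarith
    · refine (min_le_left _ _).trans ?_
      have := norm_sub_norm_le (w - 1) x
      rw [show w - 1 - x = -(1 + x - w) by ring, norm_neg] at this
      linarith
  have hdiff : DifferentiableOn ℂ (fun x => amplitude p q w (1 + x)) (Metric.ball 0 r) := by
    intro x hx
    obtain ⟨h1, h2⟩ := hball x hx
    have hne : 1 + x ≠ w := fun h => by
      rw [h, sub_self, norm_zero] at h2
      linarith
    refine DifferentiableAt.differentiableWithinAt ?_
    exact (differentiableAt_amplitude (h1.trans_lt hν1) hne).comp x (by fun_prop)
  obtain ⟨f₁, hf1, hf⟩ := exists_taylor_one hr0 hdiff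
    (fun x hx => norm_amplitude_le hν1 hD0 (hball x hx).1 (hball x hx).2)
  have h0 : ‖amplitude p q w 1‖ ≤ M := by
    have := hball 0 (Metric.mem_ball_self hr0)
    rw [add_zero] at this
    exact norm_amplitude_le hν1 hD0 this.1 this.2
  simp only [add_zero] at hf
  set a := amplitude p q w 1 with ha
  have hsum : ‖a + f₁ * κ‖ ≤ M + F * 2 := by
    refine (norm_add_le _ _).trans ?_
    rw [norm_mul]
    gcongr
  refine ⟨κ * Complex.I * (a + f₁ * κ) * Complex.I, ?_, ?_, ?_⟩
  · rw [norm_mul, norm_mul, Complex.norm_I, mul_one]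
    refine le_trans ?_ hC1
    gcongr
  · rw [norm_mul, norm_mul, norm_mul, Complex.norm_I, mul_one, mul_one]
    refine le_trans ?_ hC2
    gcongr
  intro θ hθ
  obtain ⟨y1, y2, -, -⟩ := exp_sub_one_expansions θ hθ
  set y := Complex.exp (Complex.I * θ) - 1 with hy
  have hexp : Complex.exp (Complex.I * θ) = 1 + y := by rw [hy]; ring
  have hu : ‖1 + y‖ = 1 := by
    rw [← hexp, mul_comm, Complex.norm_exp_ofReal_mul_I]
  have e2 : θ ^ 2 = |θ| ^ 2 := (sq_abs θ).symm
  have hcirc := norm_circle_le hu hκa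
  rw [show 1 + y - 1 = y by ring] at hcirc
  have hsph : 1 + κ * y ∈ Metric.sphere ((1 - κ : ℝ) : ℂ) κ := by
    rw [mem_sphere_iff_norm]
    have : 1 + κ * y - ((1 - κ : ℝ) : ℂ) = κ * (1 + y) := by push_cast; ring
    rw [this, norm_mul, hu, mul_one, Complex.norm_real, Real.norm_of_nonneg hκ0]
  have hfx := hf (κ * y) (norm_amplitude_le hν1 hD0 (norm_sq_mul_le hp hq hcirc.1)
    (le_norm_sub_of_mem_sphere hε hε1 hd hwd hκ hsph))
  rw [hexp]
  have e : κ * Complex.I * (1 + y) * amplitude p q w (1 + κ * y)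
        - (κ * Complex.I * a + κ * Complex.I * (a + f₁ * κ) * Complex.I * θ)
      = κ * Complex.I * ((1 + y) * (amplitude p q w (1 + κ * y) - (a + f₁ * (κ * y)))
        + f₁ * κ * y ^ 2 + (a + f₁ * κ) * (y - Complex.I * θ)) := by ring
  rw [e, norm_mul, norm_mul, Complex.norm_I, mul_one]
  have t1 : ‖(1 + y) * (amplitude p q w (1 + κ * y) - (a + f₁ * (κ * y)))‖
      ≤ G * (2 * |θ|) ^ 2 := by
    rw [norm_mul, hu, one_mul]
    refine hfx.trans ?_
    rw [norm_mul]
    gcongr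
  have t2 : ‖f₁ * κ * y ^ 2‖ ≤ F * 2 * |θ| ^ 2 := by
    rw [norm_mul, norm_mul, norm_pow]; gcongr
  have t3 : ‖(a + f₁ * κ) * (y - Complex.I * θ)‖ ≤ (M + F * 2) * (Real.exp π * θ ^ 2) := by
    rw [norm_mul]; gcongr
  calc _ ≤ 2 * (G * (2 * |θ|) ^ 2 + F * 2 * |θ| ^ 2 + (M + F * 2) * (Real.exp π * θ ^ 2)) := by
        gcongr
        exact norm_add₃_le.trans (by gcongr)
    _ = 2 * (G * 2 ^ 2 + F * 2 + (M + F * 2) * Real.exp π) * θ ^ 2 := by rw [e2]; ring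
    _ ≤ _ := by gcongr

theorem exp_phase_pow (p q : ℂ) {t : ℂ} (ht : t ≠ 0) (n : ℕ) :
    (Complex.exp (t - 1 + (t - 1) ^ 2 * phaseQ p q t) / t) ^ n
      = Complex.exp (((n : ℝ) : ℂ) * phase p q t) := by
  rw [Complex.ofReal_natCast, Complex.exp_nat_mul, phase, Complex.exp_sub _ (Complex.log t),
    Complex.exp_log ht]

/-- The radius `κ` of the circle cancels from the leading term. -/
theorem gaussian_factor {κ : ℝ} (hκ : 0 < κ) {n : ℝ} (hn : 0 < n) {h : ℂ} (hh : 0 < h.re) :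
    ((π : ℂ) / (n * (κ ^ 2 * h / 2))) ^ (1 / 2 : ℂ)
      = (κ : ℂ)⁻¹ * (2 * π / (n * h)) ^ (1 / 2 : ℂ) := by
  have hh0 : h ≠ 0 := by rintro rfl; simp at hh
  have e : (π : ℂ) / (n * (κ ^ 2 * h / 2)) = (((κ⁻¹) ^ 2 : ℝ) : ℂ) * (2 * π / (n * h)) := by
    push_cast
    field_simp
  have h1 : 0 < (((κ⁻¹) ^ 2 : ℝ) : ℂ).re := by rw [Complex.ofReal_re]; positivity
  have h2 : 0 < (2 * π / (n * h) : ℂ).re := by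
    have : (2 * π / (n * h) : ℂ) = ((2 * π / n : ℝ) : ℂ) * h⁻¹ := by
      push_cast; field_simp
    rw [this, Complex.re_ofReal_mul, Complex.inv_re]
    have : 0 < Complex.normSq h := Complex.normSq_pos.2 hh0
    positivity
  rw [e, mul_cpow_half_of_re_pos h1 h2]
  congr 1
  have : (1 / 2 : ℂ) = ((1 / 2 : ℝ) : ℂ) := by push_cast; rfl
  rw [this, ← Complex.ofReal_cpow (by positivity), ← Real.sqrt_eq_rpow,
    Real.sqrt_sq (by positivity), Complex.ofReal_inv]

/-- Change of variables in the expansion of the phase, from the position on the circle to the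
angle. -/
theorem norm_sub_angle_expansion_le {P h k : ℂ} {κ S C θ : ℝ} (hC : 0 ≤ C)
    (hκ : ‖(κ : ℂ)‖ ≤ 2) (hh : ‖h‖ ≤ S) (hk : ‖k‖ ≤ C) (hθ : |θ| ≤ π)
    (hP : ‖P - (h / 2 * (κ * (Complex.exp (Complex.I * θ) - 1)) ^ 2
      + k * (κ * (Complex.exp (Complex.I * θ) - 1)) ^ 3)‖
        ≤ C * ‖κ * (Complex.exp (Complex.I * θ) - 1)‖ ^ 4) :
    ‖P - (-(κ ^ 2 * h / 2 * θ ^ 2)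
        + (-(Complex.I * (h / 2 * κ ^ 2)) - Complex.I * (k * κ ^ 3)) * θ ^ 3)‖
      ≤ (2 * S * (Real.exp π ^ 2 + 2 * Real.exp π) + 8 * C * (3 * Real.exp π) + 16 * C)
        * θ ^ 4 := by
  have hS : 0 ≤ S := (norm_nonneg _).trans hh
  obtain ⟨y1, -, y2, y3⟩ := exp_sub_one_expansions θ hθ
  generalize Complex.exp (Complex.I * θ) - 1 = y at *
  have e : P - (-(κ ^ 2 * h / 2 * θ ^ 2)
        + (-(Complex.I * (h / 2 * κ ^ 2)) - Complex.I * (k * κ ^ 3)) * θ ^ 3)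
      = (P - (h / 2 * (κ * y) ^ 2 + k * (κ * y) ^ 3))
        + h / 2 * κ ^ 2 * (y ^ 2 - (-(θ : ℂ) ^ 2 - Complex.I * θ ^ 3))
        + k * κ ^ 3 * (y ^ 3 - (-(Complex.I * θ ^ 3))) := by ring
  have e4 : θ ^ 4 = |θ| ^ 4 := by
    rw [show θ ^ 4 = (θ ^ 2) ^ 2 by ring, ← sq_abs θ]; ring
  have b1 : ‖P - (h / 2 * (κ * y) ^ 2 + k * (κ * y) ^ 3)‖ ≤ C * (2 * |θ|) ^ 4 := by
    refine hP.trans ?_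
    rw [norm_mul]
    gcongr
  have b2 : ‖h / 2 * κ ^ 2 * (y ^ 2 - (-(θ : ℂ) ^ 2 - Complex.I * θ ^ 3))‖
      ≤ S / 2 * 2 ^ 2 * ((Real.exp π ^ 2 + 2 * Real.exp π) * θ ^ 4) := by
    rw [norm_mul, norm_mul, norm_pow, norm_div, Complex.norm_two]
    gcongr
  have b3 : ‖k * κ ^ 3 * (y ^ 3 - (-(Complex.I * θ ^ 3)))‖
      ≤ C * 2 ^ 3 * (3 * Real.exp π * θ ^ 4) := by
    rw [norm_mul, norm_mul, norm_pow]
    gcongr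
  rw [e]
  refine norm_add₃_le.trans ((add_le_add (add_le_add b1 b2) b3).trans (le_of_eq ?_))
  rw [e4]; ring

theorem norm_cubic_coefficient_le {h k : ℂ} {κ S C : ℝ} (hC : 0 ≤ C)
    (hκ : ‖(κ : ℂ)‖ ≤ 2) (hh : ‖h‖ ≤ S) (hk : ‖k‖ ≤ C) :
    ‖-(Complex.I * (h / 2 * κ ^ 2)) - Complex.I * (k * κ ^ 3)‖ ≤ 2 * S + 8 * C := by
  have hS : 0 ≤ S := (norm_nonneg _).trans hh
  refine (norm_sub_le _ _).trans ?_
  rw [norm_neg, norm_mul, norm_mul, norm_mul, norm_mul, norm_pow, norm_pow, Complex.norm_I,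
    norm_div, Complex.norm_two]
  calc _ ≤ 1 * (S / 2 * 2 ^ 2) + 1 * (C * 2 ^ 3) := by gcongr
    _ = _ := by ring

theorem continuous_contour_integrand {p q w : ℂ} {T : ℝ → ℂ} (hT : Continuous T)
    (h0 : ∀ θ, T θ ≠ 0) (hden : ∀ θ, ‖T θ ^ 2 * (p * q)‖ < 1) (hw : ∀ θ, T θ ≠ w) (n : ℕ) :
    Continuous fun θ => amplitude p q w (T θ)
      * (Complex.exp (T θ - 1 + (T θ - 1) ^ 2 * phaseQ p q (T θ)) / T θ) ^ n := by
  have hamp : Continuous fun θ => amplitude p q w (T θ) :=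
    continuous_iff_continuousAt.2 fun θ => ContinuousAt.comp (f := T)
      (differentiableAt_amplitude (hden θ) (hw θ)).continuousAt hT.continuousAt
  have hQ : Continuous fun θ => phaseQ p q (T θ) := by
    simp only [phaseQ]
    exact Continuous.div (by fun_prop) (by fun_prop) fun θ => one_sub_ne_zero_of_norm_lt (hden θ)
  exact hamp.mul ((Continuous.div (by fun_prop) hT h0).pow n)

theorem intervalIntegrable_contour_integrand {ρ ε d κ : ℝ} {p q w : ℂ} (hρ0 : 0 ≤ ρ) (hε : 0 < ε)
    (hε1 : ε ≤ 1 / 4) (hερ : (1 + 2 * ε) * ρ < 1) (hd : 0 < d) (hp : ‖p‖ ≤ ρ) (hq : ‖q‖ ≤ ρ)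
    (hwd : d ≤ ‖w - 1‖) (hκ : (κ = 1 + ε ∧ ‖w‖ ≤ 1) ∨ (κ = 1 - ε ∧ 1 ≤ ‖w‖)) (n : ℕ) :
    IntervalIntegrable (fun θ : ℝ => κ * Complex.I * Complex.exp (Complex.I * θ)
      * amplitude p q w (1 + κ * (Complex.exp (Complex.I * θ) - 1))
      * (Complex.exp (1 + κ * (Complex.exp (Complex.I * θ) - 1) - 1
          + (1 + κ * (Complex.exp (Complex.I * θ) - 1) - 1) ^ 2
            * phaseQ p q (1 + κ * (Complex.exp (Complex.I * θ) - 1)))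
          / (1 + κ * (Complex.exp (Complex.I * θ) - 1))) ^ n) MeasureTheory.volume (-π) π := by
  refine Continuous.intervalIntegrable ?_ _ _
  have hκa : |κ - 1| ≤ ε := by
    rcases hκ with ⟨rfl, _⟩ | ⟨rfl, _⟩ <;> rw [abs_le] <;> constructor <;> linarith
  have hκ0 : 0 ≤ κ := by rcases hκ with ⟨rfl, _⟩ | ⟨rfl, _⟩ <;> linarith
  have ht : ∀ θ : ℝ, ‖Complex.exp (Complex.I * θ)‖ = 1 := fun θ => by
    rw [mul_comm, Complex.norm_exp_ofReal_mul_I]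
  have hcont : Continuous fun θ : ℝ => 1 + κ * (Complex.exp (Complex.I * θ) - 1) := by fun_prop
  have hcirc : ∀ θ : ℝ, ‖1 + κ * (Complex.exp (Complex.I * θ) - 1)‖ ≤ 1 + 2 * ε ∧
      1 - 2 * ε ≤ ‖1 + κ * (Complex.exp (Complex.I * θ) - 1)‖ :=
    fun θ => norm_circle_le (ht θ) hκa
  have hsph : ∀ θ : ℝ, 1 + κ * (Complex.exp (Complex.I * θ) - 1)
      ∈ Metric.sphere ((1 - κ : ℝ) : ℂ) κ := fun θ => by
    rw [mem_sphere_iff_norm]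
    have : 1 + κ * (Complex.exp (Complex.I * θ) - 1) - ((1 - κ : ℝ) : ℂ)
        = κ * Complex.exp (Complex.I * θ) := by push_cast; ring
    rw [this, norm_mul, ht, mul_one, Complex.norm_real, Real.norm_of_nonneg hκ0]
  have hexp : Continuous fun θ : ℝ => κ * Complex.I * Complex.exp (Complex.I * θ) := by fun_prop
  have h := continuous_contour_integrand (p := p) (q := q) (w := w) hcont
    (fun θ => norm_pos_iff.1 (by linarith [(hcirc θ).2]))
    (fun θ => (norm_sq_mul_le hp hq (hcirc θ).1).trans_lt (by
      have : 0 ≤ (1 + 2 * ε) * ρ := by positivity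
      nlinarith))
    (fun θ heq => by
      have h1 := le_norm_sub_of_mem_sphere hε hε1 hd hwd hκ (hsph θ)
      rw [heq, sub_self, norm_zero] at h1
      have : 0 < min (d / 2) (ε * d ^ 2 / 24) := by positivity
      linarith) n
  exact (hexp.mul h).congr fun θ => (mul_assoc _ _ _).symm

/-- Steepest descent along a circle that touches the unit circle at the saddle point `t = 1`, and
that leaves the pole `w` on the side on which it lies relative to the unit circle. -/
theorem exists_contour_asymptotics {ρ : ℝ} (hρ0 : 0 ≤ ρ) (hρ : ρ < 1) {d : ℝ} (hd : 0 < d) :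
    ∃ ε C : ℝ, 0 < ε ∧ ε ≤ 1 / 4 ∧ (1 + 2 * ε) * ρ < 1 ∧ 0 ≤ C ∧
      ∀ (p q w : ℂ) (κ : ℝ), ‖p‖ ≤ ρ → ‖q‖ ≤ ρ → d ≤ ‖w - 1‖ →
        ((κ = 1 + ε ∧ ‖w‖ ≤ 1) ∨ (κ = 1 - ε ∧ 1 ≤ ‖w‖)) → ∀ n : ℕ, 1 ≤ n →
        ‖(∮ t in C(((1 - κ : ℝ) : ℂ), κ), amplitude p q w t
              * (Complex.exp (t - 1 + (t - 1) ^ 2 * phaseQ p q t) / t) ^ n)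
            - Complex.I * amplitude p q w 1
              * (2 * π / (n * saddleCurvature p q)) ^ (1 / 2 : ℂ)‖ ≤ C / (n * √n) := by
  obtain ⟨ε, c, hε, hε1, hερ, hc, hre⟩ := exists_re_phase_le hρ0 hρ
  obtain ⟨C₁, hC₁, hphase⟩ := exists_phase_expansion hρ0 hρ (r := 2 * ε) (by linarith)
    (by linarith) hερ
  obtain ⟨C₂, hC₂, hamp⟩ := exists_amplitude_expansion hρ0 hε hε1 hερ hd
  set δ := ((1 - ρ) / (1 + ρ)) ^ 3 with hδ
  have hδ0 : 0 < δ := by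
    positivity
  set c' := min (c * (4 / π ^ 2)) (δ / 4) with hc'
  have hc'0 : 0 < c' := by positivity
  set S := 4 / (1 - ρ) with hS
  set M₃ := 2 * S + 8 * C₁ with hM₃
  set M₄ := 2 * S * (Real.exp π ^ 2 + 2 * Real.exp π) + 8 * C₁ * (3 * Real.exp π) + 16 * C₁ with hM₄
  have hM₃0 : 0 ≤ M₃ := by positivity
  have hM₄0 : 0 ≤ M₄ := by positivity
  set M := C₂ + M₃ + M₄ with hM
  obtain ⟨C, hC, hlap⟩ := laplace_integral hc'0 (show 0 ≤ M by positivity)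
  refine ⟨ε, C, hε, hε1, hερ, hC, ?_⟩
  intro p q w κ hp hq hwd hκ n hn
  have hκa : |κ - 1| ≤ ε := by
    rcases hκ with ⟨rfl, _⟩ | ⟨rfl, _⟩ <;> rw [abs_le] <;> constructor <;> linarith
  have hκ34 : 3 / 4 ≤ κ := by rcases hκ with ⟨rfl, _⟩ | ⟨rfl, _⟩ <;> linarith
  have hκ0 : 0 < κ := by linarith
  have hκ2 : κ ≤ 2 := by rcases hκ with ⟨rfl, _⟩ | ⟨rfl, _⟩ <;> linarith
  have hκn : ‖(κ : ℂ)‖ ≤ 2 := by rwa [Complex.norm_real, Real.norm_of_nonneg hκ0.le]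
  have hn0 : (0 : ℝ) < n := by exact_mod_cast hn
  obtain ⟨a₁, ha0, ha1, ha⟩ := hamp p q w κ hp hq hwd hκ
  obtain ⟨k, hk, hψ⟩ := hphase p q hp hq
  set h := saddleCurvature p q with hh
  have hcurv : δ ≤ h.re := re_curvature_ge hρ hp hq
  have hhn : ‖h‖ ≤ S := by
    have h1 : 1 - ρ ≤ ‖1 - p * q‖ := by
      refine le_norm_one_sub ?_
      rw [norm_mul]
      nlinarith [norm_nonneg p, norm_nonneg q]
    have h2 : ∀ {z : ℂ}, ‖z‖ ≤ ρ → ‖1 - z‖ ≤ 2 := fun {z} hz =>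
      (norm_sub_le _ _).trans (by rw [norm_one]; linarith)
    rw [hh, saddleCurvature, norm_div, norm_mul, hS]
    gcongr
    calc _ ≤ 2 * 2 := mul_le_mul (h2 hp) (h2 hq) (norm_nonneg _) (by norm_num)
      _ = _ := by norm_num
  have ht : ∀ θ : ℝ, ‖Complex.exp (Complex.I * θ)‖ = 1 := fun θ => by
    rw [mul_comm, Complex.norm_exp_ofReal_mul_I]
  have hcirc := fun θ : ℝ => norm_circle_le (ht θ) hκa
  have ht0 : ∀ θ : ℝ, 1 + κ * (Complex.exp (Complex.I * θ) - 1) ≠ 0 := fun θ =>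
    norm_pos_iff.1 (by linarith [(hcirc θ).2])
  have key := hlap
    (fun θ => κ * Complex.I * Complex.exp (Complex.I * θ)
      * amplitude p q w (1 + κ * (Complex.exp (Complex.I * θ) - 1)))
    (fun θ => phase p q (1 + κ * (Complex.exp (Complex.I * θ) - 1)))
    (κ * Complex.I * amplitude p q w 1) a₁ (κ ^ 2 * h / 2)
    (-(Complex.I * (h / 2 * κ ^ 2)) - Complex.I * (k * κ ^ 3)) n (by exact_mod_cast hn)
    (ha0.trans (by linarith)) (ha1.trans (by linarith)) ?_ ?_
    (fun θ hθ => (ha θ hθ).trans (by gcongr; linarith)) ?_ ?_ ?_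
  · rw [circleIntegral_eq_integral_neg_pi_pi]
    rw [gaussian_factor hκ0 hn0 (hδ0.trans_le hcurv)] at key
    have e1 : κ * Complex.I * amplitude p q w 1 * ((κ : ℂ)⁻¹ * (2 * π / (n * h)) ^ (1 / 2 : ℂ))
        = Complex.I * amplitude p q w 1 * (2 * π / (n * h)) ^ (1 / 2 : ℂ) := by
      have : (κ : ℂ) ≠ 0 := by exact_mod_cast hκ0.ne'
      field_simp
    rw [Complex.ofReal_natCast, e1] at key
    convert key using 4
    funext θ
    rw [exp_phase_pow p q (ht0 θ) n, Complex.ofReal_natCast]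
    ring
  · exact (norm_cubic_coefficient_le hC₁ hκn hhn hk).trans (by linarith)
  · have : ((κ : ℂ) ^ 2 * h / 2).re = κ ^ 2 * h.re / 2 := by
      rw [show (κ : ℂ) ^ 2 * h / 2 = ((κ ^ 2 / 2 : ℝ) : ℂ) * h by push_cast; ring,
        Complex.re_ofReal_mul]
      ring
    rw [this]
    refine (min_le_right _ _).trans ?_
    have : 9 / 16 ≤ κ ^ 2 := by nlinarith
    nlinarith
  · intro θ hθ
    have hp' := hψ _ (by linarith [(hcirc θ).2]) (hcirc θ).1
    rw [add_sub_cancel_left] at hp'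
    refine (norm_sub_angle_expansion_le hC₁ hκn hhn hk hθ hp').trans ?_
    gcongr
    linarith
  · intro θ hθ
    refine (hre p q _ κ hp hq (ht θ) hκa).trans ?_
    have h1 := le_norm_exp_sub_one hθ
    have h2 : c' ≤ c * (4 / π ^ 2) := min_le_left _ _
    have h3 : c' * θ ^ 2 ≤ c * (4 / π ^ 2) * θ ^ 2 := by gcongr
    have h4 : c * (4 / π ^ 2 * θ ^ 2) ≤ c * ‖Complex.exp (Complex.I * θ) - 1‖ ^ 2 := by gcongr
    linarith
  · have hI := intervalIntegrable_contour_integrand hρ0 hε hε1 hερ hd hp hq hwd hκ n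
    refine hI.congr fun θ _ => ?_
    simp only [exp_phase_pow p q (ht0 θ) n]

/-! ### The rate function -/

/-- The entire function `(exp x - 1 - x) / x ^ 2`, as an integral so that the value at `0` and the
continuity there need no separate treatment. -/
noncomputable def expRemainder (x : ℝ) : ℝ := ∫ s in (0 : ℝ)..1, (1 - s) * Real.exp (s * x)

theorem continuous_expRemainder : Continuous expRemainder := by
  refine intervalIntegral.continuous_parametric_intervalIntegral_of_continuous'
    (f := fun x s => (1 - s) * Real.exp (s * x)) ?_ 0 1
  simp only [Function.uncurry_def]
  fun_prop

theorem sq_mul_expRemainder (x : ℝ) : x ^ 2 * expRemainder x = Real.exp x - 1 - x := by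
  have h : ∀ s ∈ Set.uIcc (0 : ℝ) 1, HasDerivAt
      (fun s => (x * (1 - s) + 1) * Real.exp (s * x)) (x ^ 2 * ((1 - s) * Real.exp (s * x))) s := by
    intro s _
    have h1 : HasDerivAt (fun s : ℝ => x * (1 - s) + 1) (x * (-1)) s :=
      (((hasDerivAt_id s).const_sub 1).const_mul x).add_const 1
    have h2 : HasDerivAt (fun s : ℝ => Real.exp (s * x)) (Real.exp (s * x) * (1 * x)) s :=
      ((hasDerivAt_id s).mul_const x).exp
    refine (h1.mul h2).congr_deriv ?_
    ring
  have hi := intervalIntegral.integral_eq_sub_of_hasDerivAt h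
    (Continuous.intervalIntegrable (by fun_prop) _ _)
  rw [intervalIntegral.integral_const_mul] at hi
  rw [expRemainder, hi]
  simp
  ring

theorem expRemainder_zero : expRemainder 0 = 1 / 2 := by
  simp only [expRemainder, mul_zero, Real.exp_zero, mul_one]
  rw [intervalIntegral.integral_sub (by simp) (by simp)]
  norm_num

theorem expRemainder_mono : Monotone expRemainder := by
  intro x y hxy
  refine intervalIntegral.integral_mono_on (by norm_num)
    (Continuous.intervalIntegrable (by fun_prop) _ _)
    (Continuous.intervalIntegrable (by fun_prop) _ _) fun s hs => ?_
  have h1 : 0 ≤ 1 - s := by linarith [hs.2]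
  have h0 := hs.1
  gcongr

theorem expRemainder_nonneg (x : ℝ) : 0 ≤ expRemainder x :=
  intervalIntegral.integral_nonneg (by norm_num) fun s hs =>
    mul_nonneg (by linarith [hs.2]) (Real.exp_pos _).le

/-- Equivalent to `tanh (y / 2) > y / 2` for `y < 0`. -/
theorem mul_exp_add_one_lt {y : ℝ} (hy : y < 0) :
    y * (Real.exp y + 1) < 2 * (Real.exp y - 1) := by
  have hd : ∀ x : ℝ, HasDerivAt (fun x => 2 * (Real.exp x - 1) - x * (Real.exp x + 1))
      (2 * Real.exp x - (1 * (Real.exp x + 1) + x * Real.exp x)) x := fun x =>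
    (((Real.hasDerivAt_exp x).sub_const 1).const_mul 2).sub
      ((hasDerivAt_id x).mul ((Real.hasDerivAt_exp x).add_const 1))
  have hanti : StrictAntiOn (fun x => 2 * (Real.exp x - 1) - x * (Real.exp x + 1))
      (Set.Iic 0) := by
    refine strictAntiOn_of_deriv_neg (convex_Iic 0)
      (fun x _ => (hd x).continuousAt.continuousWithinAt) fun x hx => ?_
    rw [interior_Iic] at hx
    rw [(hd x).deriv]
    have h1 := Real.add_one_lt_exp (x := -x) (by linarith [Set.mem_Iio.1 hx])
    have h2 : Real.exp x * Real.exp (-x) = 1 := by rw [← Real.exp_add]; simp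
    nlinarith [Real.exp_pos x]
  have := hanti (Set.mem_Iic.2 hy.le) (Set.mem_Iic.2 le_rfl) hy
  simp at this
  linarith

theorem exp_neg_two_mul_xiTau {τ : ℝ} (hτ : 0 < τ) : Real.exp (-2 * xiTau τ) = τ := by
  rw [xiTau, show -2 * (-(1 / 2) * Real.log τ) = Real.log τ by ring, Real.exp_log hτ]

/-- The exponent `(ξ - ξ_τ)² g` is affine in `cos (2 η)`, with entire coefficients in `ξ`. -/
theorem exponent_eq {τ : ℝ} (hτ0 : 0 < τ) (hτ1 : τ < 1) (ξ η : ℝ) :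
    -(1 / 2 + ξ - xiTau τ + 1 / 2 * Real.exp (-2 * ξ) * Real.cos (2 * η)
        - 2 * τ * (Real.cosh ξ ^ 2 * Real.cos η ^ 2 / (1 + τ))
        - 2 * τ * (Real.sinh ξ ^ 2 * Real.sin η ^ 2 / (1 - τ)))
      = (ξ - xiTau τ) ^ 2 * (2 / (1 - τ ^ 2) *
        ((1 - τ * Real.cos (2 * η)) * expRemainder (2 * (ξ - xiTau τ))
          + (τ ^ 2 - τ * Real.cos (2 * η)) * expRemainder (-(2 * (ξ - xiTau τ))))) := by
  set x := ξ - xiTau τ with hx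
  have h1 := sq_mul_expRemainder (2 * x)
  have h2 := sq_mul_expRemainder (-(2 * x))
  have hE := exp_neg_two_mul_xiTau hτ0
  have p1 : 1 - τ ≠ 0 := by linarith
  have p2 : 1 + τ ≠ 0 := by linarith
  have e1 : Real.exp (-2 * ξ) = τ * Real.exp (-(2 * x)) := by
    rw [← hE, ← Real.exp_add]; congr 1; rw [hx]; ring
  have e2 : Real.exp (2 * ξ) * τ = Real.exp (2 * x) := by
    rw [← hE, ← Real.exp_add]; congr 1; rw [hx]; ring
  have ch : Real.cosh ξ ^ 2 = (Real.exp (2 * ξ) + Real.exp (-2 * ξ) + 2) / 4 := by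
    have := Real.cosh_two_mul ξ
    have hc := Real.cosh_eq (2 * ξ)
    have hs := Real.cosh_sq ξ
    rw [show -(2 * ξ) = -2 * ξ by ring] at hc
    linarith
  have sh : Real.sinh ξ ^ 2 = (Real.exp (2 * ξ) + Real.exp (-2 * ξ) - 2) / 4 := by
    have hs := Real.cosh_sq ξ
    linarith
  have c2 := Real.cos_sq η
  have s2 : Real.sin η ^ 2 = 1 / 2 - Real.cos (2 * η) / 2 := by
    have := Real.sin_sq_add_cos_sq η
    linarith
  have e2' : Real.exp (2 * ξ) = Real.exp (2 * x) / τ := by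
    rw [eq_div_iff hτ0.ne', e2]
  rw [ch, sh, c2, s2, e2', e1]
  generalize Real.cos (2 * η) = c
  have key : x ^ 2 * (2 / (1 - τ ^ 2) * ((1 - τ * c) * expRemainder (2 * x)
        + (τ ^ 2 - τ * c) * expRemainder (-(2 * x))))
      = 1 / (2 * (1 - τ ^ 2)) * ((1 - τ * c) * (Real.exp (2 * x) - 1 - 2 * x)
        + (τ ^ 2 - τ * c) * (Real.exp (-(2 * x)) - 1 - -(2 * x))) := by
    rw [← h1, ← h2]; field_simp
  rw [key, show ξ = x + xiTau τ by rw [hx]; ring]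
  generalize Real.exp (2 * x) = a
  generalize Real.exp (-(2 * x)) = b
  rw [show 1 - τ ^ 2 = (1 - τ) * (1 + τ) by ring]
  field_simp
  ring

theorem rate_eq {τ : ℝ} (hτ0 : 0 < τ) (hτ1 : τ < 1) (ζ : ℂ) :
    rate τ ζ = 2 / (1 - τ ^ 2) *
        ((1 - τ * Real.cos (2 * ζ.im)) * expRemainder (2 * (ζ.re - xiTau τ))
          + (τ ^ 2 - τ * Real.cos (2 * ζ.im)) * expRemainder (-(2 * (ζ.re - xiTau τ)))) := by
  rw [rate]
  split_ifs with h
  · rw [h, sub_self, mul_zero, neg_zero, expRemainder_zero]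
    ring
  · have hne : (ζ.re - xiTau τ) ^ 2 ≠ 0 := pow_ne_zero 2 (sub_ne_zero.2 h)
    rw [exponent_eq hτ0 hτ1, mul_div_cancel_left₀ _ hne]

theorem continuous_rate {τ : ℝ} (hτ0 : 0 < τ) (hτ1 : τ < 1) : Continuous (rate τ) := by
  rw [show rate τ = _ from funext (rate_eq hτ0 hτ1)]
  have := continuous_expRemainder
  fun_prop

theorem sq_mul_rate {τ : ℝ} (hτ0 : 0 < τ) (hτ1 : τ < 1) (ξ η : ℝ) :
    (ξ - xiTau τ) ^ 2 * rate τ ((ξ : ℂ) + (η : ℂ) * Complex.I)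
      = -(1 / 2 + ξ - xiTau τ + 1 / 2 * Real.exp (-2 * ξ) * Real.cos (2 * η)
        - 2 * τ * (Real.cosh ξ ^ 2 * Real.cos η ^ 2 / (1 + τ))
        - 2 * τ * (Real.sinh ξ ^ 2 * Real.sin η ^ 2 / (1 - τ))) := by
  rw [exponent_eq hτ0 hτ1, rate_eq hτ0 hτ1]
  simp

/-- Positivity of the rate function at `cos (2 η) = 1` inside of the limiting ellipse, where
`τ ≤ exp (2 x)`. -/
theorem expRemainder_sub_pos {τ x : ℝ} (hτ0 : 0 < τ) (hτ1 : τ < 1) (hx : -xiTau τ ≤ x)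
    (hx0 : x ≤ 0) : 0 < expRemainder (2 * x) - τ * expRemainder (-(2 * x)) := by
  rcases hx0.eq_or_lt with rfl | hneg
  · rw [mul_zero, neg_zero, expRemainder_zero]; linarith
  · have h1 := sq_mul_expRemainder (2 * x)
    have h2 := sq_mul_expRemainder (-(2 * x))
    have h3 := mul_exp_add_one_lt (y := 2 * x) (by linarith)
    have hτx : τ ≤ Real.exp (2 * x) := by
      rw [← exp_neg_two_mul_xiTau hτ0]
      exact Real.exp_le_exp.2 (by linarith)
    have e3 : Real.exp (2 * x) * Real.exp (-(2 * x)) = 1 := by rw [← Real.exp_add]; simp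
    have h4 : τ * expRemainder (-(2 * x)) ≤ Real.exp (2 * x) * expRemainder (-(2 * x)) :=
      mul_le_mul_of_nonneg_right hτx (expRemainder_nonneg _)
    have h5 : 0 < (2 * x) ^ 2 * (expRemainder (2 * x)
        - Real.exp (2 * x) * expRemainder (-(2 * x))) := by
      have : (2 * x) ^ 2 * (expRemainder (2 * x) - Real.exp (2 * x) * expRemainder (-(2 * x)))
          = (Real.exp (2 * x) - 1 - 2 * x)
            - Real.exp (2 * x) * (Real.exp (-(2 * x)) - 1 - -(2 * x)) := by
        rw [← h1, ← h2]; ring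
      rw [this]
      nlinarith
    have h6 := pos_of_mul_pos_right h5 (sq_nonneg _)
    linarith

theorem exists_rate_lower_bound {τ : ℝ} (hτ0 : 0 < τ) (hτ1 : τ < 1) :
    ∃ c : ℝ, 0 < c ∧ ∀ ζ : ℂ, 0 ≤ ζ.re → c ≤ rate τ ζ := by
  have hcont : Continuous fun x : ℝ => expRemainder (2 * x) - τ * expRemainder (-(2 * x)) := by
    have := continuous_expRemainder
    fun_prop
  obtain ⟨m, hm, hmle⟩ := (isCompact_Icc (a := -xiTau τ) (b := 0)).exists_forall_le'
    hcont.continuousOn (fun x hx => expRemainder_sub_pos hτ0 hτ1 hx.1 hx.2)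
  have h2τ : 0 < 1 - τ ^ 2 := by nlinarith
  refine ⟨2 * (1 - τ) / (1 - τ ^ 2) * min m ((1 - τ) / 2), by positivity, fun ζ hζ => ?_⟩
  rw [rate_eq hτ0 hτ1]
  set x := ζ.re - xiTau τ with hx
  have hle : min m ((1 - τ) / 2) ≤ expRemainder (2 * x) - τ * expRemainder (-(2 * x)) := by
    rcases le_total x 0 with h | h
    · exact (min_le_left _ _).trans (hmle x ⟨by linarith, h⟩)
    · refine (min_le_right _ _).trans ?_
      have a := expRemainder_mono (show 0 ≤ 2 * x by linarith)
      have b := expRemainder_mono (show -(2 * x) ≤ 0 by linarith)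
      rw [expRemainder_zero] at a b
      nlinarith
  have hcos := Real.cos_le_one (2 * ζ.im)
  -- the expression is decreasing in the cosine
  have hmon : (1 - τ) * (expRemainder (2 * x) - τ * expRemainder (-(2 * x)))
      ≤ (1 - τ * Real.cos (2 * ζ.im)) * expRemainder (2 * x)
        + (τ ^ 2 - τ * Real.cos (2 * ζ.im)) * expRemainder (-(2 * x)) := by
    have := mul_nonneg (mul_nonneg hτ0.le (sub_nonneg.2 hcos))
      (add_nonneg (expRemainder_nonneg (2 * x)) (expRemainder_nonneg (-(2 * x))))
    linarith
  calc _ ≤ 2 * (1 - τ) / (1 - τ ^ 2) * (expRemainder (2 * x) - τ * expRemainder (-(2 * x))) := by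
        gcongr
    _ = 2 / (1 - τ ^ 2) * ((1 - τ) * (expRemainder (2 * x) - τ * expRemainder (-(2 * x)))) := by
        ring
    _ ≤ _ := by gcongr

/-! ### Uniform bounds on compact sets of pairs -/

theorem norm_exp_add_mul_I (x y : ℝ) : ‖Complex.exp ((x : ℂ) + (y : ℂ) * Complex.I)‖
    = Real.exp x := by
  rw [Complex.norm_exp]; simp

theorem le_norm_ellipticPoint {τ ξ : ℝ} (hξ : 0 ≤ ξ) (η : ℝ) :
    2 * √τ * ξ ≤ ‖ellipticPoint τ ξ η‖ := by
  rw [ellipticPoint, norm_mul, norm_mul, Complex.norm_two, Complex.norm_real,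
    Real.norm_of_nonneg (Real.sqrt_nonneg _)]
  gcongr
  refine (Real.self_le_sinh_iff.2 hξ).trans ?_
  rw [Complex.cosh, norm_div, Complex.norm_two, Real.sinh_eq]
  gcongr
  have h := norm_sub_norm_le (Complex.exp ((ξ : ℂ) + (η : ℂ) * Complex.I))
    (-Complex.exp (-((ξ : ℂ) + (η : ℂ) * Complex.I)))
  have hn : ‖Complex.exp (-((ξ : ℂ) + (η : ℂ) * Complex.I))‖ = Real.exp (-ξ) := by
    rw [Complex.norm_exp]; simp
  rw [norm_neg, sub_neg_eq_add, norm_exp_add_mul_I, hn] at h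
  exact h

/-- The elliptic coordinates determine the point outside of the focal segment: `exp (ξ + i η)` is
the root of modulus greater than one of `X + X⁻¹ = Z / √τ`. -/
theorem exp_eq_of_ellipticPoint_eq {τ ξ η ξ₀ η₀ : ℝ} (hτ : 0 < τ) (hξ : 0 ≤ ξ) (hξ₀ : 0 < ξ₀)
    (h : ellipticPoint τ ξ η = ellipticPoint τ ξ₀ η₀) :
    Complex.exp ((ξ : ℂ) + (η : ℂ) * Complex.I)
      = Complex.exp ((ξ₀ : ℂ) + (η₀ : ℂ) * Complex.I) := by
  have hs : ((√τ : ℝ) : ℂ) ≠ 0 := by exact_mod_cast (Real.sqrt_pos.2 hτ).ne'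
  have hn := norm_exp_add_mul_I ξ η
  have hn₀ := norm_exp_add_mul_I ξ₀ η₀
  simp only [ellipticPoint, Complex.cosh, Complex.exp_neg] at h
  have hx := Complex.exp_ne_zero ((ξ : ℂ) + (η : ℂ) * Complex.I)
  have hy := Complex.exp_ne_zero ((ξ₀ : ℂ) + (η₀ : ℂ) * Complex.I)
  generalize Complex.exp ((ξ : ℂ) + (η : ℂ) * Complex.I) = X at *
  generalize Complex.exp ((ξ₀ : ℂ) + (η₀ : ℂ) * Complex.I) = Y at *
  have h' : X + X⁻¹ = Y + Y⁻¹ := by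
    have := mul_left_cancel₀ (mul_ne_zero two_ne_zero hs) h
    linear_combination 2 * this
  have hprod : (X - Y) * (X * Y - 1) = 0 := by
    field_simp at h'
    linear_combination h'
  rcases mul_eq_zero.1 hprod with h1 | h1
  · exact sub_eq_zero.1 h1
  · exfalso
    have h2 : ‖X * Y‖ = 1 := by rw [sub_eq_zero.1 h1, norm_one]
    rw [norm_mul, hn, hn₀, ← Real.exp_add] at h2
    have := Real.exp_eq_one_iff _ |>.1 h2
    linarith

/-- The pole does not meet the saddle point. The restriction of the angles to `(-π, π]` excludes
`η - η' = ±2π`, where the exponential is `1` as well. -/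
theorem pole_ne_one {τ ξ η ξ' η' : ℝ} (hτ : 0 < τ) (h : Admissible τ ξ η ξ' η') :
    (τ : ℂ) * (Complex.exp ((ξ : ℂ) + (η : ℂ) * Complex.I)
      * conj (Complex.exp ((ξ' : ℂ) + (η' : ℂ) * Complex.I))) ≠ 1 := by
  intro h1
  obtain ⟨-, -, ⟨ha, hb⟩, ⟨ha', hb'⟩, hpos⟩ := h
  have hE := exp_neg_two_mul_xiTau hτ
  have hw : Complex.exp (((ξ + ξ' - 2 * xiTau τ : ℝ) : ℂ)
      + ((η - η' : ℝ) : ℂ) * Complex.I) = 1 := by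
    have hτE : (τ : ℂ) = Complex.exp ((-2 * xiTau τ : ℝ) : ℂ) := by
      rw [← Complex.ofReal_exp, hE]
    rw [← h1, ← Complex.exp_conj, hτE, ← Complex.exp_add, ← Complex.exp_add]
    congr 1
    simp
    ring
  have hre : ξ + ξ' - 2 * xiTau τ = 0 := by
    have := congrArg norm hw
    rw [norm_exp_add_mul_I, norm_one] at this
    exact Real.exp_eq_one_iff _ |>.1 this
  obtain ⟨k, hk⟩ := Complex.exp_eq_one_iff.1 hw
  have him := congrArg Complex.im hk
  simp at him
  have hk0 : k = 0 := by
    have h3 : (k : ℝ) < 1 := by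
      by_contra hc
      push Not at hc
      nlinarith
    have h4 : (-1 : ℝ) < k := by
      by_contra hc
      push Not at hc
      nlinarith
    have h5 : k < 1 := by exact_mod_cast h3
    have h6 : -1 < k := by exact_mod_cast h4
    lia
  rw [hk0] at him
  simp at him
  have e1 : (ξ + ξ') / 2 - xiTau τ = 0 := by linarith
  rw [e1, him] at hpos
  simp at hpos

/-- The elliptic coordinates of a pair of points, allowing points of the focal segment. -/
def coordinateSet (τ : ℝ) (K : Set (ℂ × ℂ)) : Set ((ℝ × ℝ) × (ℝ × ℝ)) :=
  {x | (0 ≤ x.1.1 ∧ x.1.2 ∈ Set.Icc (-π) π) ∧ (0 ≤ x.2.1 ∧ x.2.2 ∈ Set.Icc (-π) π) ∧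
    (ellipticPoint τ x.1.1 x.1.2, ellipticPoint τ x.2.1 x.2.2) ∈ K}

theorem isCompact_coordinateSet {τ : ℝ} (hτ : 0 < τ) {K : Set (ℂ × ℂ)} (hK : IsCompact K) :
    IsCompact (coordinateSet τ K) := by
  have hE : Continuous fun x : ℝ × ℝ => ellipticPoint τ x.1 x.2 := by
    simp only [ellipticPoint]
    exact continuous_const.mul (Complex.continuous_cosh.comp (by fun_prop))
  have hP : Continuous fun x : (ℝ × ℝ) × (ℝ × ℝ) =>
      (ellipticPoint τ x.1.1 x.1.2, ellipticPoint τ x.2.1 x.2.2) :=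
    (hE.comp continuous_fst).prodMk (hE.comp continuous_snd)
  obtain ⟨B, hB⟩ := hK.isBounded.exists_norm_le
  have hs : 0 < 2 * √τ := by have := Real.sqrt_pos.2 hτ; positivity
  have hbox : IsCompact (Set.Icc 0 (B / (2 * √τ)) ×ˢ Set.Icc (-π) π) :=
    isCompact_Icc.prod isCompact_Icc
  refine ((hbox.prod hbox).inter_right (hK.isClosed.preimage hP)).of_isClosed_subset ?_ ?_
  · have hc : IsClosed ({x : ℝ × ℝ | 0 ≤ x.1 ∧ x.2 ∈ Set.Icc (-π) π}) :=
      (isClosed_le continuous_const continuous_fst).inter (isClosed_Icc.preimage continuous_snd)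
    exact (hc.preimage continuous_fst).inter
      ((hc.preimage continuous_snd).inter (hK.isClosed.preimage hP))
  · rintro ⟨⟨ξ, η⟩, ⟨ξ', η'⟩⟩ ⟨⟨h1, h2⟩, ⟨h3, h4⟩, hmem⟩
    have hb := hB _ hmem
    refine ⟨⟨⟨⟨h1, ?_⟩, h2⟩, ⟨h3, ?_⟩, h4⟩, hmem⟩
    · rw [le_div_iff₀ hs, mul_comm]
      exact (le_norm_ellipticPoint h1 η).trans ((norm_fst_le _).trans hb)
    · rw [le_div_iff₀ hs, mul_comm]
      exact (le_norm_ellipticPoint h3 η').trans ((norm_snd_le _).trans hb)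

/-- On `coordinateSet τ K` the coordinates are not assumed to be admissible, but their exponentials
agree with those of admissible coordinates of the same points. -/
theorem coordinateSet_pos {τ : ℝ} (hτ : 0 < τ) {K : Set (ℂ × ℂ)} (hKa : K ⊆ admissiblePairs τ)
    {x : (ℝ × ℝ) × (ℝ × ℝ)} (hx : x ∈ coordinateSet τ K) : 0 < x.1.1 ∧ 0 < x.2.1 ∧
      0 < ‖(τ : ℂ) * (Complex.exp ((x.1.1 : ℂ) + (x.1.2 : ℂ) * Complex.I)
          * conj (Complex.exp ((x.2.1 : ℂ) + (x.2.2 : ℂ) * Complex.I))) - 1‖ := by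
  obtain ⟨⟨hx1, -⟩, ⟨hx2, -⟩, hxK⟩ := hx
  obtain ⟨ξ₀, η₀, ξ₀', η₀', hA, hpair⟩ := hKa hxK
  obtain ⟨h1, h2⟩ := Prod.mk.inj hpair
  have e1 := exp_eq_of_ellipticPoint_eq hτ hx1 hA.1 h1
  have e2 := exp_eq_of_ellipticPoint_eq hτ hx2 hA.2.1 h2
  have n1 := congrArg norm e1
  have n2 := congrArg norm e2
  rw [norm_exp_add_mul_I, norm_exp_add_mul_I, Real.exp_eq_exp] at n1 n2
  refine ⟨by rw [n1]; exact hA.1, by rw [n2]; exact hA.2.1, ?_⟩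
  rw [e1, e2, norm_pos_iff, sub_ne_zero]
  exact pole_ne_one hτ hA

/-- On a compact set of admissible pairs, `|exp (-2 ζ)|` and `|exp (-2 ζ')|` are bounded away from
`1`, and so is the pole from the saddle point. -/
theorem exists_uniform_bounds {τ : ℝ} (hτ : 0 < τ) {K : Set (ℂ × ℂ)} (hK : IsCompact K)
    (hKa : K ⊆ admissiblePairs τ) :
    ∃ ρ d : ℝ, 0 ≤ ρ ∧ ρ < 1 ∧ 0 < d ∧ ∀ ξ η ξ' η' : ℝ, Admissible τ ξ η ξ' η' →
      (ellipticPoint τ ξ η, ellipticPoint τ ξ' η') ∈ K →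
      Real.exp (-2 * ξ) ≤ ρ ∧ Real.exp (-2 * ξ') ≤ ρ ∧
        d ≤ ‖(τ : ℂ) * (Complex.exp ((ξ : ℂ) + (η : ℂ) * Complex.I)
          * conj (Complex.exp ((ξ' : ℂ) + (η' : ℂ) * Complex.I))) - 1‖ := by
  have hTc := isCompact_coordinateSet hτ hK
  have hpos := fun x hx => coordinateSet_pos (x := x) hτ hKa hx
  have c1 : Continuous fun x : (ℝ × ℝ) × (ℝ × ℝ) => x.1.1 := by fun_prop
  have c2 : Continuous fun x : (ℝ × ℝ) × (ℝ × ℝ) => x.2.1 := by fun_prop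
  have cE : Continuous fun x : ℝ × ℝ => Complex.exp ((x.1 : ℂ) + (x.2 : ℂ) * Complex.I) := by
    fun_prop
  have c3 : Continuous fun x : (ℝ × ℝ) × (ℝ × ℝ) =>
      ‖(τ : ℂ) * (Complex.exp ((x.1.1 : ℂ) + (x.1.2 : ℂ) * Complex.I)
          * conj (Complex.exp ((x.2.1 : ℂ) + (x.2.2 : ℂ) * Complex.I))) - 1‖ :=
    ((continuous_const.mul ((cE.comp continuous_fst).mul
      (Complex.continuous_conj.comp (cE.comp continuous_snd)))).sub continuous_const).norm
  obtain ⟨m₁, hm1, hm1'⟩ := hTc.exists_forall_le' c1.continuousOn (fun x hx => (hpos x hx).1)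
  obtain ⟨m₂, hm2, hm2'⟩ := hTc.exists_forall_le' c2.continuousOn (fun x hx => (hpos x hx).2.1)
  obtain ⟨d, hd, hd'⟩ := hTc.exists_forall_le' c3.continuousOn (fun x hx => (hpos x hx).2.2)
  refine ⟨Real.exp (-2 * min m₁ m₂), d, (Real.exp_pos _).le, ?_, hd, ?_⟩
  · rw [Real.exp_lt_one_iff]
    have : 0 < min m₁ m₂ := lt_min hm1 hm2
    linarith
  intro ξ η ξ' η' hA hmem
  have hx : ((ξ, η), (ξ', η')) ∈ coordinateSet τ K :=
    ⟨⟨hA.1.le, hA.2.2.1.1.le, hA.2.2.1.2⟩, ⟨hA.2.1.le, hA.2.2.2.1.1.le, hA.2.2.2.1.2⟩, hmem⟩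
  have h1 : m₁ ≤ ξ := hm1' _ hx
  have h2 : m₂ ≤ ξ' := hm2' _ hx
  have h3 := hd' _ hx
  refine ⟨Real.exp_le_exp.2 ?_, Real.exp_le_exp.2 ?_, h3⟩
  · linarith [min_le_left m₁ m₂]
  · linarith [min_le_right m₁ m₂]

/-! ### The kernel in elliptic coordinates -/

/-- `exp (ξ + i η)`; the complex conjugate is `expCoord ξ (-η)`. -/
noncomputable def expCoord (ξ η : ℝ) : ℂ := Complex.exp ((ξ : ℂ) + (η : ℂ) * Complex.I)

theorem expCoord_ne_zero (ξ η : ℝ) : expCoord ξ η ≠ 0 := Complex.exp_ne_zero _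

theorem norm_expCoord (ξ η : ℝ) : ‖expCoord ξ η‖ = Real.exp ξ := norm_exp_add_mul_I ξ η

theorem conj_expCoord (ξ η : ℝ) : conj (expCoord ξ η) = expCoord ξ (-η) := by
  rw [expCoord, expCoord, ← Complex.exp_conj]
  congr 1
  simp

theorem ellipticPoint_eq (τ ξ η : ℝ) :
    ellipticPoint τ ξ η = ((√τ : ℝ) : ℂ) * (expCoord ξ η + (expCoord ξ η)⁻¹) := by
  rw [ellipticPoint, Complex.cosh, expCoord, Complex.exp_neg]
  ring

theorem conj_ellipticPoint (τ ξ η : ℝ) :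
    conj (ellipticPoint τ ξ η) = ellipticPoint τ ξ (-η) := by
  rw [ellipticPoint_eq, ellipticPoint_eq, map_mul, map_add, map_inv₀, conj_expCoord,
    Complex.conj_ofReal]

/-- The argument `√n Z / √(2τ)` of the Hermite polynomials. -/
noncomputable def hermiteArg (τ : ℝ) (n : ℕ) (ξ η : ℝ) : ℂ :=
  ((√(n : ℝ) : ℝ) : ℂ) * ellipticPoint τ ξ η / ((√(2 * τ) : ℝ) : ℂ)

theorem hermiteArg_mul {τ : ℝ} (hτ : 0 < τ) (n : ℕ) (ξ η ξ' η' : ℝ) :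
    hermiteArg τ n ξ η * hermiteArg τ n ξ' η'
      = n / (2 * τ) * (ellipticPoint τ ξ η * ellipticPoint τ ξ' η') := by
  have h1 : ((√(n : ℝ) : ℝ) : ℂ) * ((√(n : ℝ) : ℝ) : ℂ) = n := by
    rw [← Complex.ofReal_mul, Real.mul_self_sqrt (by positivity)]; simp
  have h2 : ((√(2 * τ) : ℝ) : ℂ) * ((√(2 * τ) : ℝ) : ℂ) = 2 * τ := by
    rw [← Complex.ofReal_mul, Real.mul_self_sqrt (by positivity)]; simp
  rw [hermiteArg, hermiteArg, div_mul_div_comm, h2, ← h1]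
  ring

theorem ellipticPoint_mul {τ : ℝ} (hτ : 0 < τ) (ξ η ξ' η' : ℝ) :
    ellipticPoint τ ξ η * ellipticPoint τ ξ' η' = τ * ((expCoord ξ η + (expCoord ξ η)⁻¹)
      * (expCoord ξ' η' + (expCoord ξ' η')⁻¹)) := by
  have h1 : ((√τ : ℝ) : ℂ) * ((√τ : ℝ) : ℂ) = τ := by
    rw [← Complex.ofReal_mul, Real.mul_self_sqrt hτ.le]
  rw [ellipticPoint_eq, ellipticPoint_eq, ← h1]
  ring

/-- The product of the square roots of the weights at the scaled points. -/
noncomputable def sqrtWeights (τ : ℝ) (n : ℕ) (Z Z' : ℂ) : ℝ :=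
  Real.exp (-((n : ℝ) / 2 * ((Z.re ^ 2 / (1 + τ) + Z.im ^ 2 / (1 - τ))
    + (Z'.re ^ 2 / (1 + τ) + Z'.im ^ 2 / (1 - τ)))))

theorem sqrt_weight_mul_weight (τ : ℝ) (n : ℕ) (Z Z' : ℂ) :
    √(weight τ (((√(n : ℝ) : ℝ) : ℂ) * Z) * weight τ (((√(n : ℝ) : ℝ) : ℂ) * Z'))
      = sqrtWeights τ n Z Z' := by
  have hn : √(n : ℝ) ^ 2 = n := Real.sq_sqrt (by positivity)
  rw [weight, weight, ← Real.exp_add, Real.sqrt_eq_rpow, ← Real.exp_mul, sqrtWeights]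
  congr 1
  simp only [Complex.re_ofReal_mul, Complex.im_ofReal_mul, mul_pow, hn]
  ring

theorem scaledKernel_eq_sum {τ : ℝ} (n : ℕ) (ξ η ξ' η' : ℝ) :
    scaledKernel τ n (ellipticPoint τ ξ η) (ellipticPoint τ ξ' η')
      = (((n : ℝ) / (π * √(1 - τ ^ 2)) : ℝ) : ℂ)
          * (sqrtWeights τ n (ellipticPoint τ ξ η) (ellipticPoint τ ξ' η') : ℂ)
          * ∑ k ∈ Finset.range n, (τ : ℂ) ^ k
            * mehlerCoeff (hermiteArg τ n ξ η) (hermiteArg τ n ξ' (-η')) k := by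
  have hc : conj (((√(n : ℝ) : ℝ) : ℂ) * ellipticPoint τ ξ' η' / ((√(2 * τ) : ℝ) : ℂ))
      = hermiteArg τ n ξ' (-η') := by
    rw [map_div₀, map_mul, Complex.conj_ofReal, Complex.conj_ofReal, conj_ellipticPoint,
      hermiteArg]
  rw [scaledKernel, kernel, sqrt_weight_mul_weight, Finset.mul_sum, Finset.mul_sum,
    Finset.mul_sum]
  refine Finset.sum_congr rfl fun k _ => ?_
  rw [conj_hermiteH, hc, mehlerCoeff, show ((√(n : ℝ) : ℝ) : ℂ) * ellipticPoint τ ξ η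
    / ((√(2 * τ) : ℝ) : ℂ) = hermiteArg τ n ξ η from rfl]
  push_cast
  rw [div_pow]
  ring

/-! ### The bulk term -/

/-- The residue of the Mehler kernel at the pole is the bulk term. -/
theorem bulkTerm_eq {τ : ℝ} (hτ0 : 0 < τ) (hτ1 : τ < 1) (n : ℕ) (ξ η ξ' η' : ℝ) :
    (((n : ℝ) / (π * √(1 - τ ^ 2)) : ℝ) : ℂ)
        * (sqrtWeights τ n (ellipticPoint τ ξ η) (ellipticPoint τ ξ' η') : ℂ)
        * mehlerKernel (hermiteArg τ n ξ η) (hermiteArg τ n ξ' (-η')) τ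
      = bulkTerm τ n (ellipticPoint τ ξ η) (ellipticPoint τ ξ' η') := by
  have h1 : 0 < 1 - τ ^ 2 := by nlinarith
  have hz := hermiteArg_mul hτ0 n ξ η ξ η
  have hw := hermiteArg_mul hτ0 n ξ' (-η') ξ' (-η')
  have hzw := hermiteArg_mul hτ0 n ξ η ξ' (-η')
  rw [← conj_ellipticPoint] at hw hzw
  have hpre : (1 - (τ : ℂ) ^ 2) ^ (-(1 / 2) : ℂ) = ((√(1 - τ ^ 2) : ℝ) : ℂ)⁻¹ := by
    have e : (1 - (τ : ℂ) ^ 2) = ((1 - τ ^ 2 : ℝ) : ℂ) := by push_cast; ring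
    have e2 : (1 / 2 : ℂ) = ((1 / 2 : ℝ) : ℂ) := by push_cast; rfl
    rw [Complex.cpow_neg, e, e2, ← Complex.ofReal_cpow h1.le, ← Real.sqrt_eq_rpow]
  rw [mehlerKernel, sq (hermiteArg τ n ξ η), sq (hermiteArg τ n ξ' (-η')), hzw, hz, hw, hpre,
    bulkTerm, cocycleC, sqrtWeights, Complex.ofReal_exp]
  generalize ellipticPoint τ ξ η = Z
  generalize ellipticPoint τ ξ' η' = Z'
  have hfac : (((n : ℝ) / (π * √(1 - τ ^ 2)) : ℝ) : ℂ) * ((√(1 - τ ^ 2) : ℝ) : ℂ)⁻¹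
      = (((n : ℝ) / (π * (1 - τ ^ 2)) : ℝ) : ℂ) := by
    rw [← Complex.ofReal_inv, ← Complex.ofReal_mul]
    congr 1
    have := Real.mul_self_sqrt h1.le
    rw [← div_eq_mul_inv, div_div, mul_assoc, this]
  rw [← hfac, mul_mul_mul_comm, mul_assoc (_ * _) (Complex.exp _), ← Complex.exp_add,
    ← Complex.exp_add]
  congr 2
  have hτC : (τ : ℂ) ≠ 0 := by exact_mod_cast hτ0.ne'
  have p1 : (1 - τ : ℂ) ≠ 0 := by exact_mod_cast (by linarith : 1 - τ ≠ 0)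
  have p2 : (1 + τ : ℂ) ≠ 0 := by exact_mod_cast (by linarith : 1 + τ ≠ 0)
  have hn1 : ‖Z‖ ^ 2 = Z.re ^ 2 + Z.im ^ 2 := by
    rw [← Complex.normSq_eq_norm_sq, Complex.normSq_apply]; ring
  have hn2 : ‖Z'‖ ^ 2 = Z'.re ^ 2 + Z'.im ^ 2 := by
    rw [← Complex.normSq_eq_norm_sq, Complex.normSq_apply]; ring
  have him : (Z ^ 2 - Z' ^ 2).im = 2 * Z.re * Z.im - 2 * Z'.re * Z'.im := by
    simp [sq]; ring
  have c1 : Z = Z.re + Z.im * Complex.I := (Complex.re_add_im Z).symm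
  have c3 : conj Z' = Z'.re - Z'.im * Complex.I := by
    apply Complex.ext <;> simp
  rw [hn1, hn2, him, c3]
  generalize Z.re = x at *
  generalize Z.im = y at *
  generalize Z'.re = x' at *
  generalize Z'.im = y' at *
  rw [c1]
  push_cast
  rw [show (1 - (τ : ℂ) ^ 2) = (1 - τ) * (1 + τ) by ring]
  field_simp
  ring_nf
  simp only [Complex.I_sq]
  ring

/-! ### The contour integral in elliptic coordinates -/

/-- At the scaled points, the exponent of the Mehler kernel is `n` times its value at the saddle
point plus the phase without its logarithm. -/
theorem mehlerKernel_eq {τ : ℝ} (hτ : 0 < τ) (n : ℕ) (ξ η ξ' η' : ℝ) {p q σ t : ℂ}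
    (hp : p = (expCoord ξ η)⁻¹ ^ 2) (hq : q = (expCoord ξ' η')⁻¹ ^ 2)
    (hσ : σ = (expCoord ξ η * expCoord ξ' η')⁻¹) (ht : ‖σ * t‖ < 1) :
    mehlerKernel (hermiteArg τ n ξ η) (hermiteArg τ n ξ' η') (σ * t)
      = (1 - t ^ 2 * (p * q)) ^ (-(1 / 2) : ℂ) * (Complex.exp (n * (1 + (p + q) / 2))
        * Complex.exp (t - 1 + (t - 1) ^ 2 * phaseQ p q t) ^ n) := by
  have hτC : (τ : ℂ) ≠ 0 := by exact_mod_cast hτ.ne'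
  have hden := one_sub_ne_zero_of_norm_lt (norm_sq_lt_one ht)
  have hz := hermiteArg_mul hτ n ξ η ξ η
  have hw := hermiteArg_mul hτ n ξ' η' ξ' η'
  have hzw := hermiteArg_mul hτ n ξ η ξ' η'
  rw [ellipticPoint_mul hτ] at hz hw hzw
  rw [mehlerKernel, sq (hermiteArg τ n ξ η), sq (hermiteArg τ n ξ' η'), hzw, hz, hw]
  have hx := expCoord_ne_zero ξ η
  have hx' := expCoord_ne_zero ξ' η'
  generalize expCoord ξ η = x at *
  generalize expCoord ξ' η' = x' at *
  have hpq : (σ * t) ^ 2 = t ^ 2 * (p * q) := by rw [hσ, hp, hq]; field_simp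
  rw [hpq, ← Complex.exp_nat_mul, ← Complex.exp_add]
  congr 2
  rw [hpq] at hden
  have hQ : phaseQ p q t * (1 - t ^ 2 * (p * q)) = t * (p * q) - (p + q) / 2 :=
    div_mul_cancel₀ _ hden
  have e1 : 2 * (σ * t) * (n / (2 * τ) * (τ * ((x + x⁻¹) * (x' + x'⁻¹))))
      = n * (t * ((1 + p) * (1 + q))) := by
    rw [hσ, hp, hq]; field_simp
  have e2 : t ^ 2 * (p * q) * (n / (2 * τ) * (τ * ((x + x⁻¹) * (x + x⁻¹)))
        + n / (2 * τ) * (τ * ((x' + x'⁻¹) * (x' + x'⁻¹))))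
      = n * (t ^ 2 / 2 * (q * (1 + p) ^ 2 + p * (1 + q) ^ 2)) := by
    rw [hp, hq]; field_simp
  rw [e1, e2, div_eq_iff hden]
  linear_combination -n * (t - 1) ^ 2 * hQ

/-- The exponential factors collect to the decay factor and the cocycle of the boundary term. -/
theorem sqrtWeights_mul_saddle_value {τ : ℝ} (hτ0 : 0 < τ) (hτ1 : τ < 1) (n : ℕ)
    (ξ η ξ' η' : ℝ) {p q w : ℂ} (hp : p = (expCoord ξ η)⁻¹ ^ 2)
    (hq : q = (expCoord ξ' (-η'))⁻¹ ^ 2) (hw : w = τ * (expCoord ξ η * expCoord ξ' (-η'))) :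
    (sqrtWeights τ n (ellipticPoint τ ξ η) (ellipticPoint τ ξ' η') : ℂ)
        * (Complex.exp (n * (1 + (p + q) / 2)) * w ^ n)
      = decay τ n ξ η ξ' η' * cocycleD n ξ η ξ' η' := by
  have hV : ∀ ξ η : ℝ, (ellipticPoint τ ξ η).re ^ 2 = 4 * τ * (Real.cosh ξ ^ 2 * Real.cos η ^ 2)
      ∧ (ellipticPoint τ ξ η).im ^ 2 = 4 * τ * (Real.sinh ξ ^ 2 * Real.sin η ^ 2) := by
    intro ξ η
    have hs := Real.sq_sqrt hτ0.le
    have e : ellipticPoint τ ξ η = ((2 * √τ * (Real.cosh ξ * Real.cos η) : ℝ) : ℂ)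
        + ((2 * √τ * (Real.sinh ξ * Real.sin η) : ℝ) : ℂ) * Complex.I := by
      rw [ellipticPoint, Complex.cosh_add, Complex.cosh_mul_I, Complex.sinh_mul_I]
      push_cast; ring
    rw [e]
    constructor
    · rw [Complex.add_re, Complex.ofReal_re, Complex.re_ofReal_mul, Complex.I_re, mul_zero,
        add_zero, mul_pow, mul_pow, hs]
      ring
    · rw [Complex.add_im, Complex.ofReal_im, Complex.im_ofReal_mul, Complex.I_im, mul_one,
        zero_add, mul_pow, mul_pow, hs]
      ring
  have hE : ∀ ξ η : ℝ, -(n : ℝ) * (ξ - xiTau τ) ^ 2 * rate τ ((ξ : ℂ) + (η : ℂ) * Complex.I)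
      = n * (1 / 2 + ξ - xiTau τ + 1 / 2 * Real.exp (-2 * ξ) * Real.cos (2 * η))
        - n / 2 * ((ellipticPoint τ ξ η).re ^ 2 / (1 + τ)
          + (ellipticPoint τ ξ η).im ^ 2 / (1 - τ)) := by
    intro ξ η
    rw [mul_assoc, sq_mul_rate hτ0 hτ1, (hV ξ η).1, (hV ξ η).2]
    ring
  have hsq : ∀ ξ η : ℝ, (expCoord ξ η)⁻¹ ^ 2 = ((Real.exp (-2 * ξ) * Real.cos (2 * η) : ℝ) : ℂ)
      - ((Real.exp (-2 * ξ) * Real.sin (2 * η) : ℝ) : ℂ) * Complex.I := by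
    intro ξ η
    rw [expCoord, ← Complex.exp_neg, ← Complex.exp_nat_mul]
    rw [show ((2 : ℕ) : ℂ) * -((ξ : ℂ) + (η : ℂ) * Complex.I)
      = ((-2 * ξ : ℝ) : ℂ) + ((-(2 * η) : ℝ) : ℂ) * Complex.I by push_cast; ring,
      Complex.exp_add_mul_I, ← Complex.ofReal_exp, ← Complex.ofReal_cos, ← Complex.ofReal_sin,
      Real.cos_neg, Real.sin_neg]
    push_cast; ring
  have hτE : (τ : ℂ) = Complex.exp ((-2 * xiTau τ : ℝ) : ℂ) := by
    rw [← Complex.ofReal_exp, exp_neg_two_mul_xiTau hτ0]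
  have hwn : w ^ n = Complex.exp (n * (((-2 * xiTau τ : ℝ) : ℂ)
      + (((ξ : ℂ) + (η : ℂ) * Complex.I) + ((ξ' : ℂ) + ((-η' : ℝ) : ℂ) * Complex.I)))) := by
    rw [Complex.exp_nat_mul, hw, hτE, expCoord, expCoord, ← Complex.exp_add, ← Complex.exp_add]
  rw [hwn, decay, cocycleD, hE, hE, sqrtWeights, Complex.ofReal_mul (Real.exp _),
    Complex.ofReal_exp, Complex.ofReal_exp, Complex.ofReal_exp, ← Complex.exp_add,
    ← Complex.exp_add, ← Complex.exp_add, ← Complex.exp_add, hp, hq, hsq, hsq]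
  congr 1
  rw [show 2 * -η' = -(2 * η') by ring, Real.cos_neg, Real.sin_neg]
  push_cast
  ring

/-! ### The boundary term -/

theorem csqrt_mul_self (z : ℂ) : csqrt z * csqrt z = z := by
  by_cases hz : z = 0
  · simp [csqrt, hz]
  · rw [csqrt, ← Complex.cpow_add _ _ hz]
    norm_num

/-- The sign of the boundary term is the quotient of the two square roots that define it. -/
theorem csqrt_eq_boundarySign_mul (ξ η ξ' η' : ℝ) :
    (boundarySign ξ η ξ' η' = 1 ∨ boundarySign ξ η ξ' η' = -1) ∧
    csqrt (Complex.exp (-(((ξ + ξ' : ℝ) : ℂ) + ((η - η' : ℝ) : ℂ) * Complex.I))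
        * sinhProd ξ η ξ' η')
      = boundarySign ξ η ξ' η'
        * (Complex.exp (-((((ξ + ξ') / 2 : ℝ) : ℂ) + (((η - η') / 2 : ℝ) : ℂ) * Complex.I))
        * csqrt (sinhProd ξ η ξ' η')) := by
  have hA := csqrt_mul_self (Complex.exp (-(((ξ + ξ' : ℝ) : ℂ) + ((η - η' : ℝ) : ℂ) * Complex.I))
        * sinhProd ξ η ξ' η')
  have hS := csqrt_mul_self (sinhProd ξ η ξ' η')
  have hE : Complex.exp (-((((ξ + ξ') / 2 : ℝ) : ℂ) + (((η - η') / 2 : ℝ) : ℂ) * Complex.I))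
      * Complex.exp (-((((ξ + ξ') / 2 : ℝ) : ℂ) + (((η - η') / 2 : ℝ) : ℂ) * Complex.I))
      = Complex.exp (-(((ξ + ξ' : ℝ) : ℂ) + ((η - η' : ℝ) : ℂ) * Complex.I)) := by
    rw [← Complex.exp_add]
    congr 1
    push_cast
    ring
  rw [boundarySign]
  split_ifs with h
  · exact ⟨Or.inl rfl, by rw [h, one_mul]⟩
  · refine ⟨Or.inr rfl, ?_⟩
    rw [← hE] at hA h ⊢
    generalize csqrt (_ * sinhProd ξ η ξ' η') = A at *
    generalize csqrt (sinhProd ξ η ξ' η') = B at *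
    generalize Complex.exp _ = E at *
    have hprod : (A - E * B) * (A + E * B) = 0 := by
      linear_combination hA - E * E * hS
    rcases mul_eq_zero.1 hprod with h1 | h1
    · exact absurd (sub_eq_zero.1 h1) h
    · linear_combination h1

theorem cpow_half_ofReal {x : ℝ} (hx : 0 ≤ x) : (x : ℂ) ^ (1 / 2 : ℂ) = ((√x : ℝ) : ℂ) := by
  rw [show (1 / 2 : ℂ) = ((1 / 2 : ℝ) : ℂ) by push_cast; rfl, ← Complex.ofReal_cpow hx,
    ← Real.sqrt_eq_rpow]

theorem inv_cpow_half_of_re_pos {z : ℂ} (hz : 0 < z.re) :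
    z⁻¹ ^ (1 / 2 : ℂ) = (z ^ (1 / 2 : ℂ))⁻¹ := by
  refine Complex.inv_cpow _ _ fun h => ?_
  have := abs_lt.1 (Complex.abs_arg_lt_pi_div_two_iff.2 (Or.inl hz))
  rw [h] at this
  linarith [Real.pi_pos]

/-- The Gaussian factor and the square root in the Mehler kernel combine to one principal square
root, since all of the factors lie in the right half plane. -/
theorem saddle_factor_eq {p q w : ℂ} (hp : ‖p‖ < 1) (hq : ‖q‖ < 1) {n : ℕ} (hn : 1 ≤ n) :
    amplitude p q w 1 * (2 * π / (n * saddleCurvature p q)) ^ (1 / 2 : ℂ)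
      = ((√(2 * π / n) : ℝ) : ℂ) * ((1 - w) * (2 * csqrt ((1 - p) * (1 - q) / 4)))⁻¹ := by
  have hpq : ‖p * q‖ < 1 := by
    rw [norm_mul]; nlinarith [norm_nonneg p, norm_nonneg q]
  have r1 := one_sub_re_pos hp
  have r2 := one_sub_re_pos hq
  have r3 := one_sub_re_pos hpq
  set ρ := max ‖p‖ ‖q‖ with hρ
  have r4 : 0 < (saddleCurvature p q).re := by
    have hρ1 : ρ < 1 := max_lt hp hq
    have hρ0 : 0 ≤ ρ := (norm_nonneg p).trans (le_max_left _ _)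
    refine lt_of_lt_of_le ?_ (re_curvature_ge hρ1 (le_max_left _ _) (le_max_right _ _))
    positivity
  have r5 : 0 < (saddleCurvature p q)⁻¹.re := by
    rw [Complex.inv_re]
    refine div_pos r4 (Complex.normSq_pos.2 fun h => ?_)
    rw [h] at r4; simp at r4
  have hne : 1 - p * q ≠ 0 := one_sub_ne_zero_of_norm_lt hpq
  have hG : (2 * π / (n * saddleCurvature p q) : ℂ) ^ (1 / 2 : ℂ)
      = ((√(2 * π / n) : ℝ) : ℂ) * (saddleCurvature p q ^ (1 / 2 : ℂ))⁻¹ := by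
    have e : (2 * π / (n * saddleCurvature p q) : ℂ)
        = ((2 * π / n : ℝ) : ℂ) * (saddleCurvature p q)⁻¹ := by
      push_cast
      rw [← div_div, div_eq_mul_inv]
    rw [e, mul_cpow_half_of_re_pos (by rw [Complex.ofReal_re]; positivity) r5,
      cpow_half_ofReal (by positivity), inv_cpow_half_of_re_pos r4]
  have hprod : (1 - p * q) ^ (1 / 2 : ℂ) * saddleCurvature p q ^ (1 / 2 : ℂ)
      = 2 * csqrt ((1 - p) * (1 - q) / 4) := by
    rw [← mul_cpow_half_of_re_pos r3 r4, saddleCurvature, mul_div_cancel₀ _ hne,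
      mul_cpow_half_of_re_pos r1 r2, csqrt,
      show (1 - p) * (1 - q) / 4 = (((1 / 4 : ℝ) : ℂ) * (1 - p)) * (1 - q) by push_cast; ring,
      mul_cpow_half_of_re_pos (by rw [Complex.re_ofReal_mul]; positivity) r2,
      mul_cpow_half_of_re_pos (by rw [Complex.ofReal_re]; norm_num) r1,
      cpow_half_ofReal (by norm_num), show (1 / 4 : ℝ) = (1 / 2) ^ 2 by norm_num,
      Real.sqrt_sq (by norm_num)]
    push_cast
    ring
  rw [amplitude, hG, ← hprod, one_pow, one_mul, Complex.cpow_neg, mul_inv, mul_inv]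
  ring

theorem boundary_coefficient_eq {τ : ℝ} (hτ0 : 0 < τ) (hτ1 : τ < 1) {n : ℕ} (hn : 1 ≤ n) :
    (n : ℝ) / (π * √(1 - τ ^ 2)) * (1 / (2 * π)) * √(2 * π / n) * (1 / (4 * √τ))
      = √((n : ℝ) / (32 * π ^ 3 * τ * (1 - τ ^ 2))) := by
  have h1 : 0 < 1 - τ ^ 2 := by nlinarith
  symm
  rw [Real.sqrt_eq_iff_mul_self_eq (by positivity) (by positivity)]
  have s1 := Real.mul_self_sqrt h1.le
  have s2 := Real.mul_self_sqrt hτ0.le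
  have s3 := Real.mul_self_sqrt (show 0 ≤ 2 * π / n by positivity)
  have e : (n : ℝ) / (π * √(1 - τ ^ 2)) * (1 / (2 * π)) * √(2 * π / n) * (1 / (4 * √τ))
      * ((n : ℝ) / (π * √(1 - τ ^ 2)) * (1 / (2 * π)) * √(2 * π / n) * (1 / (4 * √τ)))
      = n ^ 2 * (√(2 * π / n) * √(2 * π / n))
        / (64 * π ^ 4 * (√(1 - τ ^ 2) * √(1 - τ ^ 2)) * (√τ * √τ)) := by
    field_simp
    norm_num
  rw [e, s1, s2, s3]
  field_simp
  norm_num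

/-- The leading term of the contour integral is the boundary term. -/
theorem boundaryTerm_eq {τ : ℝ} (hτ0 : 0 < τ) (hτ1 : τ < 1) {n : ℕ} (hn : 1 ≤ n)
    {ξ η ξ' η' : ℝ} (hξ : 0 < ξ) (hξ' : 0 < ξ') {p q w : ℂ} (hp : p = (expCoord ξ η)⁻¹ ^ 2)
    (hq : q = (expCoord ξ' (-η'))⁻¹ ^ 2) (hw : w = τ * (expCoord ξ η * expCoord ξ' (-η'))) :
    -((((n : ℝ) / (π * √(1 - τ ^ 2)) : ℝ) : ℂ)
        * (decay τ n ξ η ξ' η' * cocycleD n ξ η ξ' η') * ((2 * π * Complex.I)⁻¹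
        * (Complex.I * amplitude p q w 1
          * (2 * π / (n * saddleCurvature p q)) ^ (1 / 2 : ℂ))))
      = boundarySign ξ η ξ' η' * boundaryTerm τ n ξ η ξ' η' := by
  have hnp : ‖p‖ < 1 := by
    rw [hp, norm_pow, norm_inv, norm_expCoord, ← Real.exp_neg]
    exact pow_lt_one₀ (Real.exp_pos _).le (by rw [Real.exp_lt_one_iff]; linarith) two_ne_zero
  have hnq : ‖q‖ < 1 := by
    rw [hq, norm_pow, norm_inv, norm_expCoord, ← Real.exp_neg]
    exact pow_lt_one₀ (Real.exp_pos _).le (by rw [Real.exp_lt_one_iff]; linarith) two_ne_zero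
  have hsad := saddle_factor_eq (w := w) hnp hnq hn
  obtain ⟨hsign, hroot⟩ := csqrt_eq_boundarySign_mul ξ η ξ' η'
  have hx := expCoord_ne_zero ξ η
  have hx' := expCoord_ne_zero ξ' (-η')
  -- the argument of the square root in terms of the hyperbolic sines
  have hy : (1 - p) * (1 - q) / 4
      = Complex.exp (-(((ξ + ξ' : ℝ) : ℂ) + ((η - η' : ℝ) : ℂ) * Complex.I))
        * sinhProd ξ η ξ' η' := by
    have e1 : Complex.exp (-(((ξ + ξ' : ℝ) : ℂ) + ((η - η' : ℝ) : ℂ) * Complex.I))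
        = (expCoord ξ η * expCoord ξ' (-η'))⁻¹ := by
      rw [expCoord, expCoord, ← Complex.exp_add, ← Complex.exp_neg]
      congr 1
      push_cast
      ring
    have e2 : (ξ' : ℂ) - (η' : ℂ) * Complex.I = (ξ' : ℂ) + ((-η' : ℝ) : ℂ) * Complex.I := by
      push_cast; ring
    rw [e1, sinhProd, e2, Complex.sinh, Complex.sinh, Complex.exp_neg, Complex.exp_neg, hp, hq]
    simp only [← expCoord.eq_1]
    field_simp
    norm_num
  set u : ℂ := (((ξ + ξ') / 2 - xiTau τ : ℝ) : ℂ) + (((η - η') / 2 : ℝ) : ℂ) * Complex.I with hu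
  set v : ℂ := (((ξ + ξ') / 2 : ℝ) : ℂ) + (((η - η') / 2 : ℝ) : ℂ) * Complex.I with hv
  have hτE := exp_neg_two_mul_xiTau hτ0
  have hτC : (τ : ℂ) = Complex.exp ((-2 * xiTau τ : ℝ) : ℂ) := by
    rw [← Complex.ofReal_exp, hτE]
  have hsτ : Real.exp (-xiTau τ) = √τ := by
    symm
    rw [Real.sqrt_eq_iff_mul_self_eq hτ0.le (Real.exp_pos _).le, ← Real.exp_add,
      show -xiTau τ + -xiTau τ = -2 * xiTau τ by ring, hτE]
  have huv : Complex.exp u = Complex.exp v * ((√τ : ℝ) : ℂ) := by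
    rw [← hsτ, Complex.ofReal_exp, ← Complex.exp_add]
    congr 1
    rw [hu, hv]; push_cast; ring
  have hwu : w = Complex.exp u * Complex.exp u := by
    rw [hw, expCoord, expCoord, hτC, ← Complex.exp_add, ← Complex.exp_add,
      ← Complex.exp_add]
    congr 1
    rw [hu]; push_cast; ring
  have h1w : 1 - w = -2 * Complex.exp u * Complex.sinh u := by
    rw [hwu, Complex.sinh, Complex.exp_neg]
    field_simp
    ring
  have hvv : Complex.exp v * Complex.exp (-v) = 1 := by rw [← Complex.exp_add]; simp
  have hεε : boundarySign ξ η ξ' η' * boundarySign ξ η ξ' η' = 1 := by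
    rcases hsign with h | h <;> rw [h] <;> norm_num
  have hεi : (boundarySign ξ η ξ' η')⁻¹ = boundarySign ξ η ξ' η' :=
    inv_eq_of_mul_eq_one_left hεε
  rw [hy, hroot, h1w, huv] at hsad
  have hden : (-2 * (Complex.exp v * ((√τ : ℝ) : ℂ)) * Complex.sinh u * (2 *
      (boundarySign ξ η ξ' η' * (Complex.exp (-v) * csqrt (sinhProd ξ η ξ' η')))))⁻¹
      = -(((1 / (4 * √τ) : ℝ) : ℂ)
        * (boundarySign ξ η ξ' η' * (Complex.sinh u * csqrt (sinhProd ξ η ξ' η'))⁻¹)) := by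
    have : -2 * (Complex.exp v * ((√τ : ℝ) : ℂ)) * Complex.sinh u * (2 *
        (boundarySign ξ η ξ' η' * (Complex.exp (-v) * csqrt (sinhProd ξ η ξ' η'))))
        = -4 * ((√τ : ℝ) : ℂ) * (boundarySign ξ η ξ' η'
          * (Complex.sinh u * csqrt (sinhProd ξ η ξ' η'))) := by
      linear_combination (-4 * ((√τ : ℝ) : ℂ) * (boundarySign ξ η ξ' η'
          * (Complex.sinh u * csqrt (sinhProd ξ η ξ' η')))) * hvv
    rw [this, mul_inv, mul_inv (boundarySign ξ η ξ' η'), hεi, mul_inv (-4)]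
    push_cast
    rw [one_div, mul_inv (4 : ℂ)]
    norm_num
  have hII : (2 * π * Complex.I : ℂ)⁻¹ * Complex.I = ((1 / (2 * π) : ℝ) : ℂ) := by
    push_cast
    field_simp
  rw [mul_assoc Complex.I, ← mul_assoc _ Complex.I, hII, hsad, hden, boundaryTerm,
    ← boundary_coefficient_eq hτ0 hτ1 hn, ← hu]
  clear_value u v
  push_cast
  rw [div_eq_mul_inv (decay τ n ξ η ξ' η' : ℂ)]
  ring

/-! ### The partial sums near the saddle point -/

/-- The kernel is the bulk term, present if the pole lies inside of the circle, minus a contour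
integral over a circle through the saddle point. -/
theorem scaledKernel_eq_contour {τ : ℝ} (hτ0 : 0 < τ) (hτ1 : τ < 1) (n : ℕ) {ξ η ξ' η' ρ ε κ : ℝ}
    {p q w : ℂ} (hp : p = (expCoord ξ η)⁻¹ ^ 2) (hq : q = (expCoord ξ' (-η'))⁻¹ ^ 2)
    (hw : w = τ * (expCoord ξ η * expCoord ξ' (-η'))) (hpρ : Real.exp (-2 * ξ) ≤ ρ)
    (hqρ : Real.exp (-2 * ξ') ≤ ρ) (hε : 0 < ε) (hε1 : ε ≤ 1 / 4) (hερ : (1 + 2 * ε) * ρ < 1)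
    (hw1 : 0 < ‖w - 1‖) (hκ : (κ = 1 + ε ∧ ‖w‖ < 1) ∨ (κ = 1 - ε ∧ 1 ≤ ‖w‖)) :
    scaledKernel τ n (ellipticPoint τ ξ η) (ellipticPoint τ ξ' η')
      = (if ‖w‖ < 1 then bulkTerm τ n (ellipticPoint τ ξ η) (ellipticPoint τ ξ' η') else 0)
        - (((n : ℝ) / (π * √(1 - τ ^ 2)) : ℝ) : ℂ)
        * (decay τ n ξ η ξ' η' * cocycleD n ξ η ξ' η') * ((2 * π * Complex.I)⁻¹
        * ∮ t in C(((1 - κ : ℝ) : ℂ), κ), amplitude p q w t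
              * (Complex.exp (t - 1 + (t - 1) ^ 2 * phaseQ p q t) / t) ^ n) := by
  have hρ0 : 0 < ρ := (Real.exp_pos _).trans_le hpρ
  set σ : ℂ := (expCoord ξ η * expCoord ξ' (-η'))⁻¹ with hσ
  have hxx : expCoord ξ η * expCoord ξ' (-η') ≠ 0 :=
    mul_ne_zero (expCoord_ne_zero _ _) (expCoord_ne_zero _ _)
  have hσw : σ * w = τ := by
    rw [hσ, hw, mul_left_comm, inv_mul_cancel₀ hxx, mul_one]
  have hκa : |1 - κ| ≤ ε := by
    rcases hκ with ⟨rfl, _⟩ | ⟨rfl, _⟩ <;> rw [abs_le] <;> constructor <;> linarith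
  have hκ34 : 3 / 4 ≤ κ := by rcases hκ with ⟨rfl, _⟩ | ⟨rfl, _⟩ <;> linarith
  have hκu : κ ≤ 1 + ε := by rcases hκ with ⟨rfl, _⟩ | ⟨rfl, _⟩ <;> linarith
  have hσn : ‖σ‖ ≤ ρ := by
    have e : ‖σ‖ ^ 2 = Real.exp (-2 * ξ) * Real.exp (-2 * ξ') := by
      rw [hσ, norm_inv, norm_mul, norm_expCoord, norm_expCoord, ← Real.exp_add, ← Real.exp_neg,
        ← Real.exp_nat_mul, ← Real.exp_add]
      congr 1
      push_cast
      ring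
    have : ‖σ‖ ^ 2 ≤ ρ ^ 2 := by
      rw [e, sq]; gcongr
    exact le_of_sq_le_sq this hρ0.le
  have h0 : (0 : ℂ) ∈ Metric.ball ((1 - κ : ℝ) : ℂ) κ := by
    rw [mem_ball_iff_norm, zero_sub, norm_neg, Complex.norm_real, Real.norm_eq_abs]
    linarith
  have hσt : ∀ t ∈ Metric.closedBall ((1 - κ : ℝ) : ℂ) κ, ‖σ * t‖ < 1 := by
    intro t ht
    rw [mem_closedBall_iff_norm] at ht
    have h1 := norm_sub_norm_le t ((1 - κ : ℝ) : ℂ)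
    rw [Complex.norm_real, Real.norm_eq_abs] at h1
    have h2 : ‖t‖ ≤ 1 + 2 * ε := by linarith
    rw [norm_mul]
    calc _ ≤ ρ * (1 + 2 * ε) := by gcongr
      _ < 1 := by linarith
  set z := hermiteArg τ n ξ η with hz
  set z' := hermiteArg τ n ξ' (-η') with hz'
  have hI : (∮ t in C(((1 - κ : ℝ) : ℂ), κ), mehlerKernel z z' (σ * t) * (w / t) ^ n * (t - w)⁻¹)
      = (Complex.exp (n * (1 + (p + q) / 2)) * w ^ n)
        * ∮ t in C(((1 - κ : ℝ) : ℂ), κ), amplitude p q w t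
              * (Complex.exp (t - 1 + (t - 1) ^ 2 * phaseQ p q t) / t) ^ n := by
    rw [← circleIntegral.integral_const_mul]
    refine circleIntegral.integral_congr (by linarith) fun t ht => ?_
    rw [mehlerKernel_eq hτ0 n ξ η ξ' (-η') hp hq hσ (hσt t (Metric.sphere_subset_closedBall ht)),
      amplitude, div_pow, div_pow]
    ring
  have hsum : ∑ k ∈ Finset.range n, (τ : ℂ) ^ k * mehlerCoeff z z' k
      = (if ‖w‖ < 1 then mehlerKernel z z' τ else 0) - (2 * π * Complex.I)⁻¹ *
        ∮ t in C(((1 - κ : ℝ) : ℂ), κ), mehlerKernel z z' (σ * t) * (w / t) ^ n * (t - w)⁻¹ := by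
    rcases hκ with ⟨rfl, h⟩ | ⟨rfl, h⟩
    · rw [if_pos h, ← hσw]
      exact sum_mehlerCoeff_of_mem_ball z z' h0 hσt (mem_ball_of_norm_lt_one hε h) n
    · rw [if_neg (not_lt.2 h), zero_sub, ← hσw]
      exact sum_mehlerCoeff_of_notMem_closedBall z z' h0 hσt
        (notMem_closedBall_of_one_le_norm hε hε1 h hw1) n
  rw [scaledKernel_eq_sum, hsum, hI, ← sqrtWeights_mul_saddle_value hτ0 hτ1 n ξ η ξ' η' hp hq hw,
    mul_sub, mul_ite, mul_zero, bulkTerm_eq hτ0 hτ1]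
  ring

theorem norm_cocycleD (n : ℕ) (ξ η ξ' η' : ℝ) : ‖cocycleD n ξ η ξ' η'‖ = 1 := by
  rw [cocycleD, mul_comm, Complex.norm_exp_ofReal_mul_I]

/-- On a compact set of admissible pairs one pair of bounds `ρ`, `d` serves all points, so that one
`ε` and one constant in the contour asymptotics do. The factor `n` in front of the contour integral
turns the error `n ^ (-3 / 2)` into `n ^ (-1 / 2)`. -/
theorem exists_kernel_bound {τ : ℝ} (hτ0 : 0 < τ) (hτ1 : τ < 1) {K : Set (ℂ × ℂ)}
    (hK : IsCompact K) (hKa : K ⊆ admissiblePairs τ) :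
    ∃ C : ℝ, ∀ n : ℕ, 1 ≤ n → ∀ ξ η ξ' η' : ℝ, Admissible τ ξ η ξ' η' →
      (ellipticPoint τ ξ η, ellipticPoint τ ξ' η') ∈ K →
      ‖scaledKernel τ n (ellipticPoint τ ξ η) (ellipticPoint τ ξ' η')
          - ((if (ξ + ξ') / 2 < xiTau τ then
                bulkTerm τ n (ellipticPoint τ ξ η) (ellipticPoint τ ξ' η')
              else 0)
            + boundarySign ξ η ξ' η' * boundaryTerm τ n ξ η ξ' η')‖
        ≤ C * (1 / √(n : ℝ)) * decay τ n ξ η ξ' η' := by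
  have hpi := Real.pi_pos
  obtain ⟨ρ, d, hρ0, hρ1, hd, hunif⟩ := exists_uniform_bounds hτ0 hK hKa
  obtain ⟨ε, C, hε, hε1, hερ, hC, hJ⟩ := exists_contour_asymptotics hρ0 hρ1 hd
  refine ⟨1 / (π * √(1 - τ ^ 2)) * (1 / (2 * π)) * C, ?_⟩
  intro n hn ξ η ξ' η' hA hmem
  have hn0 : (0 : ℝ) < n := by exact_mod_cast hn
  obtain ⟨hpρ, hqρ, hwd⟩ := hunif ξ η ξ' η' hA hmem
  set p : ℂ := (expCoord ξ η)⁻¹ ^ 2 with hp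
  set q : ℂ := (expCoord ξ' (-η'))⁻¹ ^ 2 with hq
  set w : ℂ := τ * (expCoord ξ η * expCoord ξ' (-η')) with hw
  have hwd' : d ≤ ‖w - 1‖ := by rw [hw, ← conj_expCoord]; exact hwd
  have hnorm : ∀ ξ η : ℝ, ‖(expCoord ξ η)⁻¹ ^ 2‖ = Real.exp (-2 * ξ) := fun ξ η => by
    rw [norm_pow, norm_inv, norm_expCoord, ← Real.exp_neg, ← Real.exp_nat_mul]
    congr 1
    push_cast
    ring
  have hpn : ‖p‖ ≤ ρ := (hnorm ξ η).le.trans hpρ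
  have hqn : ‖q‖ ≤ ρ := (hnorm ξ' (-η')).le.trans hqρ
  have hwn : ‖w‖ < 1 ↔ (ξ + ξ') / 2 < xiTau τ := by
    have e : ‖w‖ = Real.exp (-2 * xiTau τ + (ξ + ξ')) := by
      rw [hw, norm_mul, norm_mul, norm_expCoord, norm_expCoord, Complex.norm_real,
        Real.norm_of_nonneg hτ0.le, Real.exp_add, exp_neg_two_mul_xiTau hτ0, Real.exp_add]
    rw [e, Real.exp_lt_one_iff]
    constructor <;> intro h <;> linarith
  obtain ⟨κ, hκ⟩ : ∃ κ : ℝ, (κ = 1 + ε ∧ ‖w‖ < 1) ∨ (κ = 1 - ε ∧ 1 ≤ ‖w‖) := by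
    rcases lt_or_ge ‖w‖ 1 with h | h
    · exact ⟨_, Or.inl ⟨rfl, h⟩⟩
    · exact ⟨_, Or.inr ⟨rfl, h⟩⟩
  have hker := scaledKernel_eq_contour hτ0 hτ1 n hp hq hw hpρ hqρ hε hε1 hερ (hd.trans_le hwd') hκ
  have hbd := boundaryTerm_eq hτ0 hτ1 hn hA.1 hA.2.1 hp hq hw
  have hj := hJ p q w κ hpn hqn hwd' (hκ.imp (fun h => ⟨h.1, h.2.le⟩) id) n hn
  simp only [hwn] at hker
  rw [hker, ← hbd]
  generalize (∮ t in C(((1 - κ : ℝ) : ℂ), κ), amplitude p q w t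
              * (Complex.exp (t - 1 + (t - 1) ^ 2 * phaseQ p q t) / t) ^ n) = J at *
  generalize Complex.I * amplitude p q w 1
          * (2 * π / (n * saddleCurvature p q)) ^ (1 / 2 : ℂ) = J₀ at *
  generalize (if (ξ + ξ') / 2 < xiTau τ then
                bulkTerm τ n (ellipticPoint τ ξ η) (ellipticPoint τ ξ' η')
              else 0) = B at *
  have e : B - (((n : ℝ) / (π * √(1 - τ ^ 2)) : ℝ) : ℂ)
        * (decay τ n ξ η ξ' η' * cocycleD n ξ η ξ' η') * ((2 * π * Complex.I)⁻¹ * J)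
        - (B + -((((n : ℝ) / (π * √(1 - τ ^ 2)) : ℝ) : ℂ)
        * (decay τ n ξ η ξ' η' * cocycleD n ξ η ξ' η') * ((2 * π * Complex.I)⁻¹ * J₀)))
      = -((((n : ℝ) / (π * √(1 - τ ^ 2)) : ℝ) : ℂ)
        * (decay τ n ξ η ξ' η' * cocycleD n ξ η ξ' η') * ((2 * π * Complex.I)⁻¹ * (J - J₀))) := by
    ring
  have hdec : 0 ≤ decay τ n ξ η ξ' η' :=
    mul_nonneg (Real.exp_pos _).le (Real.exp_pos _).le
  have h2pi : ‖(2 * π * Complex.I : ℂ)⁻¹‖ = 1 / (2 * π) := by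
    rw [norm_inv, norm_mul, norm_mul, Complex.norm_I, Complex.norm_two, Complex.norm_real,
      Real.norm_of_nonneg hpi.le, mul_one, one_div]
  have hpre : 0 ≤ (n : ℝ) / (π * √(1 - τ ^ 2)) := by positivity
  rw [e, norm_neg, norm_mul, norm_mul, norm_mul, norm_mul, norm_cocycleD, h2pi, Complex.norm_real,
    Complex.norm_real, Real.norm_of_nonneg hpre, Real.norm_of_nonneg hdec]
  calc _ ≤ (n : ℝ) / (π * √(1 - τ ^ 2)) * (decay τ n ξ η ξ' η' * 1)
        * (1 / (2 * π) * (C / (n * √n))) := by gcongr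
    _ = _ := by
      field_simp

end EllipticGinibre

theorem mainTheorem1 (τ : ℝ) (hτ0 : 0 < τ) (hτ1 : τ < 1) :
    ContinuousOn (EllipticGinibre.rate τ) {ζ : ℂ | 0 ≤ ζ.re} ∧
    (∃ c : ℝ, 0 < c ∧ ∀ ζ : ℂ, 0 ≤ ζ.re → c ≤ EllipticGinibre.rate τ ζ) ∧
    ∀ K : Set (ℂ × ℂ), IsCompact K → K ⊆ EllipticGinibre.admissiblePairs τ →
      ∃ (C : ℝ) (N : ℕ), ∀ n : ℕ, N ≤ n → ∀ ξ η ξ' η' : ℝ,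
        EllipticGinibre.Admissible τ ξ η ξ' η' →
        (EllipticGinibre.ellipticPoint τ ξ η, EllipticGinibre.ellipticPoint τ ξ' η') ∈ K →
        ‖EllipticGinibre.scaledKernel τ n
              (EllipticGinibre.ellipticPoint τ ξ η) (EllipticGinibre.ellipticPoint τ ξ' η')
            - ((if (ξ + ξ') / 2 < EllipticGinibre.xiTau τ then
                  EllipticGinibre.bulkTerm τ n
                    (EllipticGinibre.ellipticPoint τ ξ η) (EllipticGinibre.ellipticPoint τ ξ' η')
                else 0)
              + EllipticGinibre.boundarySign ξ η ξ' η'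
                  * EllipticGinibre.boundaryTerm τ n ξ η ξ' η')‖
          ≤ C * (1 / √(n : ℝ)) * EllipticGinibre.decay τ n ξ η ξ' η' := by
  refine ⟨(EllipticGinibre.continuous_rate hτ0 hτ1).continuousOn,
    EllipticGinibre.exists_rate_lower_bound hτ0 hτ1, fun K hK hKa => ?_⟩
  obtain ⟨C, hC⟩ := EllipticGinibre.exists_kernel_bound hτ0 hτ1 hK hKa
  exact ⟨C, 1, hC⟩
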